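/- **Theorem 2.** Let $M$ be a smooth manifold and $H$ a closed 3-form on $M$. On $TM\oplus T^*M$ consider the natural metric $\langle X+\xi,Y+\eta\rangle=\frac12(\xi(Y)+\eta(X))$ and the $H$-twisted Courant bracket $$[X+\xi,Y+\eta]_H=[X,Y]+L_X\eta-L_Y\xi-\tfrac12(d\imath_X\eta-d\imath_Y\xi)+\imath_Y\imath_XH .$$ An $H$-twisted generalized complex structure is a smooth endomorphism $I$ of $TM\oplus T^*M$ with $I^2=-\mathrm{Id}$ which preserves $\langle\cdot,\cdot\rangle$ and whose $+i$-eigenbundle in $(TM\oplus T^*M)\otimes\mathbb C$ is involutive for $[\cdot,\cdot]_H$. An $H$-twisted generalized pseudo-Kähler structure is a pair $(I_1,I_2)$ of commuting $H$-twisted generalized complex structures such that the $\pm1$-eigenbundles $L^\pm$ of $I_1I_2$ are transversal to $T^*M$ and $\langle\cdot,\cdot\rangle$ is non-degenerate on $L^\pm$. Then $H$-twisted generalized pseudo-Kähler structures $(I_1,I_2)$ on $M$ are in one-to-one correspondence with quadruples $(g,J_+,J_-,b)$, where $g$ is a pseudo-Riemannian metric, $J_+$ and $J_-$ are $g$-Hermitian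 complex structures (integrable almost complex structures with $g(J_\pm X,J_\pm Y)=g(X,Y)$), and $b$ is a 2-form such that $$d^+F^+=-d^-F^-=H+db .$$ Here $F^\pm(X,Y)=g(J_\pm X,Y)$ is the Kähler form of $(g,J_\pm)$ and $d^\pm=i(\bar\partial_\pm-\partial_\pm)$ for the complex structure $J_\pm$, so that $d^\pm F^\pm(X,Y,Z)=-dF^\pm(J_\pm X,J_\pm Y,J_\pm Z)$. The correspondence is characterized by $$L^\pm=\{X+\imath_Xb\mp g(X,\cdot)\;:\;X\in TM\},\qquad I_1\bigl(X+\imath_Xb\mp g(X,\cdot)\bigr)=J_\pm X+\imath_{J_\pm X}b\mp g(J_\pm X,\cdot).$$ -/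

import Mathlib

open Bundle Set
open scoped Manifold ContDiff

noncomputable section

namespace GenPK

section Bundles

variable (E : Type*) [NormedAddCommGroup E] [NormedSpace ℝ E]
variable {M : Type*} [TopologicalSpace M] [ChartedSpace E M] [IsManifold 𝓘(ℝ, E) ∞ M]

/-- The tangent space `T_x M` of a manifold `M` modelled on `E`. -/
abbrev Tan (x : M) : Type _ := TangentSpace 𝓘(ℝ, E) x

/-- The cotangent space `T_x^* M`. -/
abbrev Cot (x : M) : Type _ := Tan E x →L[ℝ] ℝ

/-- The fibre at `x` of the generalized tangent bundle `TM ⊕ T^*M`; an element `(X, ξ)` stands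
for `X + ξ`. -/
abbrev GTan (x : M) : Type _ := Tan E x × Cot E x

/-- Alternating `k`-linear forms on `T_x M`. -/
abbrev Alt (k : ℕ) (x : M) : Type _ := Tan E x [⋀^Fin k]→L[ℝ] ℝ

variable {E}

/-! ### Smooth tensor fields -/

/-- `X` is a smooth vector field on `U`. -/
def SmoothVectorOn (X : ∀ x : M, Tan E x) (U : Set M) : Prop :=
  ContMDiffOn 𝓘(ℝ, E) (𝓘(ℝ, E).prod 𝓘(ℝ, E)) ∞
    (fun x ↦ (TotalSpace.mk' E x (X x) : TangentBundle 𝓘(ℝ, E) M)) U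

/-- `ξ` is a smooth section of `T^*M` on `U`. -/
def SmoothCovectorOn (ξ : ∀ x : M, Cot E x) (U : Set M) : Prop :=
  ContMDiffOn 𝓘(ℝ, E) (𝓘(ℝ, E).prod 𝓘(ℝ, E →L[ℝ] ℝ)) ∞
    (fun x ↦ TotalSpace.mk' (E →L[ℝ] ℝ) (E := fun x : M ↦ Cot E x) x (ξ x)) U

/-- `A` is a smooth section of `TM ⊕ T^*M` on `U`. -/
def SmoothGenOn (A : ∀ x : M, GTan E x) (U : Set M) : Prop :=
  SmoothVectorOn (fun x ↦ (A x).1) U ∧ SmoothCovectorOn (fun x ↦ (A x).2) U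

/-- `θ` is a smooth differential `k`-form on `M`. -/
def SmoothForm {k : ℕ} (θ : ∀ x : M, Alt E k x) : Prop :=
  ContMDiff 𝓘(ℝ, E) (𝓘(ℝ, E).prod 𝓘(ℝ, E [⋀^Fin k]→L[ℝ] ℝ)) ∞
    (fun x ↦ TotalSpace.mk' (E [⋀^Fin k]→L[ℝ] ℝ) (E := fun x : M ↦ Alt E k x) x (θ x))

/-- `g` is a smooth field of bilinear forms on `TM`. -/
def SmoothBilin (g : ∀ x : M, Tan E x →L[ℝ] Tan E x →L[ℝ] ℝ) : Prop :=
  ContMDiff 𝓘(ℝ, E) (𝓘(ℝ, E).prod 𝓘(ℝ, E →L[ℝ] E →L[ℝ] ℝ)) ∞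
    (fun x ↦ TotalSpace.mk' (E →L[ℝ] E →L[ℝ] ℝ)
      (E := fun x : M ↦ Tan E x →L[ℝ] Tan E x →L[ℝ] ℝ) x (g x))

/-- `J` is a smooth endomorphism of `TM`. -/
def SmoothEnd (J : ∀ x : M, Tan E x →L[ℝ] Tan E x) : Prop :=
  ContMDiff 𝓘(ℝ, E) (𝓘(ℝ, E).prod 𝓘(ℝ, E →L[ℝ] E)) ∞
    (fun x ↦ TotalSpace.mk' (E →L[ℝ] E) (E := fun x : M ↦ Tan E x →L[ℝ] Tan E x) x (J x))

/-- `I` is a smooth endomorphism of the vector bundle `TM ⊕ T^*M`. -/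
def SmoothGenEnd (I : ∀ x : M, GTan E x →L[ℝ] GTan E x) : Prop :=
  ContMDiff 𝓘(ℝ, E)
    (𝓘(ℝ, E).prod 𝓘(ℝ, (E × (E →L[ℝ] ℝ)) →L[ℝ] (E × (E →L[ℝ] ℝ)))) ∞
    (fun x ↦ TotalSpace.mk' ((E × (E →L[ℝ] ℝ)) →L[ℝ] (E × (E →L[ℝ] ℝ)))
      (E := fun x : M ↦ GTan E x →L[ℝ] GTan E x) x (I x))

/-! ### Calculus of differential forms -/

/-- The form `θ` written in the chart around `x₀`, i.e. its pullback under the inverse chart. -/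
def chartForm {k : ℕ} (θ : ∀ x : M, Alt E k x) (x₀ : M) (y : E) : E [⋀^Fin k]→L[ℝ] ℝ :=
  (θ ((extChartAt 𝓘(ℝ, E) x₀).symm y)).compContinuousLinearMap
    (mfderiv 𝓘(ℝ, E) 𝓘(ℝ, E) (extChartAt 𝓘(ℝ, E) x₀).symm y)

/-- The exterior derivative `dθ` of a `k`-form, computed at `x` in the chart around `x`. With
Mathlib's normalization, `dθ(X₀, …, X_k) = ∑ (-1)^i X_i (θ(…, X̂_i, …))` for commuting fields. -/
def extD {k : ℕ} (θ : ∀ x : M, Alt E k x) (x : M) : Alt E (k + 1) x :=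
  (extDeriv (chartForm θ x) (extChartAt 𝓘(ℝ, E) x x)).compContinuousLinearMap
    (mfderiv 𝓘(ℝ, E) 𝓘(ℝ, E) (extChartAt 𝓘(ℝ, E) x) x)

/-- The differential of a function, as a section of `T^*M`. -/
def dFun (f : M → ℝ) (x : M) : Cot E x := mfderiv 𝓘(ℝ, E) 𝓘(ℝ, ℝ) f x

/-- `i_X b = b(X, ·)` for a 2-form `b`. -/
def contract₂ {x : M} (b : Alt E 2 x) (X : Tan E x) : Cot E x :=
  b.toContinuousLinearMap ![X, 0] 1

/-- `i_Y i_X H = H(X, Y, ·)` for a 3-form `H`. -/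
def contract₃ {x : M} (H : Alt E 3 x) (X Y : Tan E x) : Cot E x :=
  H.toContinuousLinearMap ![X, Y, 0] 2

/-- A section of `T^*M`, regarded as a differential 1-form. -/
def toOneForm (ξ : ∀ x : M, Cot E x) (x : M) : Alt E 1 x :=
  ContinuousAlternatingMap.ofSubsingleton ℝ (Tan E x) ℝ (0 : Fin 1) (ξ x)

/-- The Lie derivative of a 1-form along a vector field, `L_X η = i_X dη + d i_X η`. -/
def lieOneForm (X : ∀ x : M, Tan E x) (η : ∀ x : M, Cot E x) (x : M) : Cot E x :=
  contract₂ (extD (toOneForm η) x) (X x) + dFun (fun y ↦ η y (X y)) x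

theorem contract₂_apply {x : M} (b : Alt E 2 x) (X Y : Tan E x) :
    contract₂ b X Y = b ![X, Y] := by
  change b (Function.update ![X, 0] 1 Y) = _
  congr 1
  ext i
  fin_cases i <;> rfl

theorem contract₃_apply {x : M} (H : Alt E 3 x) (X Y Z : Tan E x) :
    contract₃ H X Y Z = H ![X, Y, Z] := by
  change H (Function.update ![X, Y, 0] 2 Z) = _
  congr 1
  ext i
  fin_cases i <;> rfl

/-! ### Generalized complex structures -/

/-- The natural metric `⟨X + ξ, Y + η⟩ = ½ (ξ(Y) + η(X))` on `TM ⊕ T^*M`. -/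
def pairing {x : M} (A B : GTan E x) : ℝ := (1 / 2 : ℝ) * (A.2 B.1 + B.2 A.1)

/-- The `H`-twisted Courant bracket
`[X + ξ, Y + η]_H = [X, Y] + L_X η - L_Y ξ - ½ (d i_X η - d i_Y ξ) + i_Y i_X H`. -/
def courant (H : ∀ x : M, Alt E 3 x) (A B : ∀ x : M, GTan E x) (x : M) : GTan E x :=
  (VectorField.mlieBracket 𝓘(ℝ, E) (fun y ↦ (A y).1) (fun y ↦ (B y).1) x,
    lieOneForm (fun y ↦ (A y).1) (fun y ↦ (B y).2) x
      - lieOneForm (fun y ↦ (B y).1) (fun y ↦ (A y).2) x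
      - (1 / 2 : ℝ) • (dFun (fun y ↦ (B y).2 (A y).1) x - dFun (fun y ↦ (A y).2 (B y).1) x)
      + contract₃ (H x) (A x).1 (B x).1)

/-- A section of the complexified bundle `(TM ⊕ T^*M) ⊗ ℂ`, given by its real part `re` and its
imaginary part `im`. -/
structure CSection (E : Type*) [NormedAddCommGroup E] [NormedSpace ℝ E]
    (M : Type*) [TopologicalSpace M] [ChartedSpace E M] where
  re : ∀ x : M, GTan E x
  im : ∀ x : M, GTan E x

/-- Smoothness on `U` of a complex section. -/
def CSection.SmoothOn (A : CSection E M) (U : Set M) : Prop :=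
  SmoothGenOn A.re U ∧ SmoothGenOn A.im U

/-- On `U` the complex section lies in the `+i`-eigenbundle of `I`:
`I (a + i b) = i (a + i b)`, i.e. `I a = - b` and `I b = a`. -/
def CSection.InPlusI (I : ∀ x : M, GTan E x →L[ℝ] GTan E x) (A : CSection E M) (U : Set M) :
    Prop :=
  ∀ x ∈ U, I x (A.re x) = - A.im x ∧ I x (A.im x) = A.re x

/-- The complex bilinear extension of the `H`-twisted Courant bracket. -/
def CSection.courant (H : ∀ x : M, Alt E 3 x) (A B : CSection E M) : CSection E M where
  re := fun x ↦ GenPK.courant H A.re B.re x - GenPK.courant H A.im B.im x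
  im := fun x ↦ GenPK.courant H A.re B.im x + GenPK.courant H A.im B.re x

/-- `H`-twisted generalized complex structures: smooth endomorphisms `I` of `TM ⊕ T^*M` with
`I² = -Id` that preserve the natural metric and whose `+i`-eigenbundle is involutive with respect
to the `H`-twisted Courant bracket (tested on local sections over open sets). -/
structure IsGenComplex (H : ∀ x : M, Alt E 3 x) (I : ∀ x : M, GTan E x →L[ℝ] GTan E x) :
    Prop where
  smooth : SmoothGenEnd I
  sq : ∀ (x : M) (A : GTan E x), I x (I x A) = -A
  orthogonal : ∀ (x : M) (A B : GTan E x), pairing (I x A) (I x B) = pairing A B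
  involutive : ∀ (U : Set M), IsOpen U → ∀ A B : CSection E M,
    A.SmoothOn U → B.SmoothOn U → A.InPlusI I U → B.InPlusI I U →
      (A.courant H B).InPlusI I U

/-- The `c`-eigenspace at `x` of `G = I₁ I₂` in `T_x M ⊕ T_x^* M`. -/
def eigenG (I₁ I₂ : ∀ x : M, GTan E x →L[ℝ] GTan E x) (c : ℝ) (x : M) :
    Submodule ℝ (GTan E x) :=
  Module.End.eigenspace ((I₁ x ∘L I₂ x : GTan E x →L[ℝ] GTan E x) : Module.End ℝ (GTan E x)) c

/-- The cotangent space `T_x^* M` as a subspace of `T_x M ⊕ T_x^* M`. -/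
def cotSub (x : M) : Submodule ℝ (GTan E x) := LinearMap.range (LinearMap.inr ℝ (Tan E x) (Cot E x))

/-- `H`-twisted generalized pseudo-Kähler structures: commuting `H`-twisted generalized complex
structures `I₁, I₂` such that the `±1`-eigenspaces `L^±` of `G = I₁ I₂` are transversal
(complementary) to `T^*M` and the natural metric is non-degenerate on `L^±`. -/
structure GenPseudoKahler (H : ∀ x : M, Alt E 3 x) where
  I₁ : ∀ x : M, GTan E x →L[ℝ] GTan E x
  I₂ : ∀ x : M, GTan E x →L[ℝ] GTan E x
  genComplex₁ : IsGenComplex H I₁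
  genComplex₂ : IsGenComplex H I₂
  comm : ∀ (x : M) (A : GTan E x), I₁ x (I₂ x A) = I₂ x (I₁ x A)
  transversal_plus : ∀ x : M, IsCompl (eigenG I₁ I₂ 1 x) (cotSub x)
  transversal_minus : ∀ x : M, IsCompl (eigenG I₁ I₂ (-1) x) (cotSub x)
  nondeg_plus : ∀ (x : M), ∀ A ∈ eigenG I₁ I₂ 1 x,
    (∀ B ∈ eigenG I₁ I₂ 1 x, pairing A B = 0) → A = 0
  nondeg_minus : ∀ (x : M), ∀ A ∈ eigenG I₁ I₂ (-1) x,
    (∀ B ∈ eigenG I₁ I₂ (-1) x, pairing A B = 0) → A = 0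

/-! ### Pseudo-Hermitian structures -/

/-- Pseudo-Riemannian metrics: smooth fields of symmetric non-degenerate bilinear forms on `TM`. -/
structure IsPseudoRiemannian (g : ∀ x : M, Tan E x →L[ℝ] Tan E x →L[ℝ] ℝ) : Prop where
  smooth : SmoothBilin g
  symm : ∀ (x : M) (X Y : Tan E x), g x X Y = g x Y X
  nondeg : ∀ (x : M) (X : Tan E x), (∀ Y : Tan E x, g x X Y = 0) → X = 0

/-- The Nijenhuis tensor `[JX, JY] - J [JX, Y] - J [X, JY] - [X, Y]`. -/
def nijenhuis (J : ∀ x : M, Tan E x →L[ℝ] Tan E x) (X Y : ∀ x : M, Tan E x) (x : M) : Tan E x :=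
  VectorField.mlieBracket 𝓘(ℝ, E) (fun y ↦ J y (X y)) (fun y ↦ J y (Y y)) x
    - J x (VectorField.mlieBracket 𝓘(ℝ, E) (fun y ↦ J y (X y)) Y x)
    - J x (VectorField.mlieBracket 𝓘(ℝ, E) X (fun y ↦ J y (Y y)) x)
    - VectorField.mlieBracket 𝓘(ℝ, E) X Y x

/-- Complex structures, as integrable almost complex structures: smooth endomorphisms `J` of `TM`
with `J² = -Id` and vanishing Nijenhuis tensor. -/
structure IsComplexStructure (J : ∀ x : M, Tan E x →L[ℝ] Tan E x) : Prop where
  smooth : SmoothEnd J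
  sq : ∀ (x : M) (X : Tan E x), J x (J x X) = -X
  integrable : ∀ (U : Set M), IsOpen U → ∀ X Y : ∀ x : M, Tan E x,
    SmoothVectorOn X U → SmoothVectorOn Y U → ∀ x ∈ U, nijenhuis J X Y x = 0

/-- `J` is a `g`-Hermitian complex structure. -/
structure IsHermitian (g : ∀ x : M, Tan E x →L[ℝ] Tan E x →L[ℝ] ℝ)
    (J : ∀ x : M, Tan E x →L[ℝ] Tan E x) : Prop where
  complex : IsComplexStructure J
  compatible : ∀ (x : M) (X Y : Tan E x), g x (J x X) (J x Y) = g x X Y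

theorem IsHermitian.alternating {g : ∀ x : M, Tan E x →L[ℝ] Tan E x →L[ℝ] ℝ}
    {J : ∀ x : M, Tan E x →L[ℝ] Tan E x} (hg : IsPseudoRiemannian g) (hJ : IsHermitian g J)
    (x : M) (X : Tan E x) : g x (J x X) X = 0 := by
  have h1 := hJ.compatible x (J x X) X
  rw [hJ.complex.sq, map_neg, neg_apply, hg.symm] at h1
  linarith

/-- The alternating form attached to a continuous bilinear map that vanishes on the diagonal. -/
def altOfBilin {V : Type*} [NormedAddCommGroup V] [NormedSpace ℝ V] (B : V →L[ℝ] V →L[ℝ] ℝ)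
    (hB : ∀ v, B v v = 0) : V [⋀^Fin 2]→L[ℝ] ℝ where
  toFun v := B (v 0) (v 1)
  map_update_add' := by
    intro inst v i a b
    rw [Subsingleton.elim inst (instDecidableEqFin 2)]
    fin_cases i <;> simp
  map_update_smul' := by
    intro inst v i c a
    rw [Subsingleton.elim inst (instDecidableEqFin 2)]
    fin_cases i <;> simp
  cont := by fun_prop
  map_eq_zero_of_eq' := by
    intro v i j hij hne
    fin_cases i <;> fin_cases j <;> simp_all

/-- The Kähler form `F(X, Y) = g(JX, Y)` of a pseudo-Hermitian structure `(g, J)`. -/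
def kahlerForm {g : ∀ x : M, Tan E x →L[ℝ] Tan E x →L[ℝ] ℝ}
    {J : ∀ x : M, Tan E x →L[ℝ] Tan E x} (hg : IsPseudoRiemannian g) (hJ : IsHermitian g J)
    (x : M) : Alt E 2 x :=
  altOfBilin (V := E) (g x ∘L J x) (hJ.alternating hg x)

theorem kahlerForm_apply {g : ∀ x : M, Tan E x →L[ℝ] Tan E x →L[ℝ] ℝ}
    {J : ∀ x : M, Tan E x →L[ℝ] Tan E x} (hg : IsPseudoRiemannian g) (hJ : IsHermitian g J)
    (x : M) (X Y : Tan E x) : kahlerForm hg hJ x ![X, Y] = g x (J x X) Y := rfl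

/-- The form `J θ = θ(J·, …, J·)`. -/
def actJ {k : ℕ} (J : ∀ x : M, Tan E x →L[ℝ] Tan E x) (θ : ∀ x : M, Alt E k x) (x : M) :
    Alt E k x :=
  (θ x).compContinuousLinearMap (J x)

/-- The real operator `d^c = J⁻¹ ∘ d ∘ J = i (∂̄ - ∂)` of a complex structure `J`, where `J` acts
on forms by `J θ = θ(J·, …, J·)`. For the Kähler form `F`, which satisfies `J F = F`, this is
`d^c F (X, Y, Z) = - dF (JX, JY, JZ)`. -/
def dc {k : ℕ} (J : ∀ x : M, Tan E x →L[ℝ] Tan E x) (θ : ∀ x : M, Alt E k x) :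
    ∀ x : M, Alt E (k + 1) x :=
  actJ (fun x ↦ -J x) (extD (actJ J θ))

/-- Quadruples `(g, J₊, J₋, b)` of a pseudo-Riemannian metric, two `g`-Hermitian complex structures
and a 2-form with `d^+F^+ = - d^-F^- = H + db`. -/
structure PseudoBihermitian (H : ∀ x : M, Alt E 3 x) where
  g : ∀ x : M, Tan E x →L[ℝ] Tan E x →L[ℝ] ℝ
  Jp : ∀ x : M, Tan E x →L[ℝ] Tan E x
  Jm : ∀ x : M, Tan E x →L[ℝ] Tan E x
  b : ∀ x : M, Alt E 2 x
  metric : IsPseudoRiemannian g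
  hermitian_plus : IsHermitian g Jp
  hermitian_minus : IsHermitian g Jm
  smooth_b : SmoothForm b
  dc_plus : ∀ x : M, dc Jp (kahlerForm metric hermitian_plus) x = H x + extD b x
  dc_minus : ∀ x : M, -dc Jm (kahlerForm metric hermitian_minus) x = H x + extD b x

/-! ### The correspondence -/

/-- The element `X + i_X b - g(X, ·)` of `T_x M ⊕ T_x^* M`. -/
def PseudoBihermitian.liftPlus {H : ∀ x : M, Alt E 3 x} (Q : PseudoBihermitian H) (x : M)
    (X : Tan E x) : GTan E x := (X, contract₂ (Q.b x) X - Q.g x X)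

/-- The element `X + i_X b + g(X, ·)` of `T_x M ⊕ T_x^* M`. -/
def PseudoBihermitian.liftMinus {H : ∀ x : M, Alt E 3 x} (Q : PseudoBihermitian H) (x : M)
    (X : Tan E x) : GTan E x := (X, contract₂ (Q.b x) X + Q.g x X)

/-- The quadruple `(g, J₊, J₋, b)` is associated with `(I₁, I₂)`: the `±1`-eigenbundles `L^±` of
`I₁ I₂` are the graphs of `b ∓ g : TM → T^*M`, and the restriction of `I₁` to `L^±` corresponds to
`J_±` under the projection `L^± → TM`. -/
structure IsAssociated {H : ∀ x : M, Alt E 3 x} (S : GenPseudoKahler H)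
    (Q : PseudoBihermitian H) : Prop where
  graph_plus : ∀ (x : M) (A : GTan E x),
    A ∈ eigenG S.I₁ S.I₂ 1 x ↔ ∃ X : Tan E x, A = Q.liftPlus x X
  graph_minus : ∀ (x : M) (A : GTan E x),
    A ∈ eigenG S.I₁ S.I₂ (-1) x ↔ ∃ X : Tan E x, A = Q.liftMinus x X
  complex_plus : ∀ (x : M) (X : Tan E x), S.I₁ x (Q.liftPlus x X) = Q.liftPlus x (Q.Jp x X)
  complex_minus : ∀ (x : M) (X : Tan E x), S.I₁ x (Q.liftMinus x X) = Q.liftMinus x (Q.Jm x X)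

end Bundles

end GenPK

end

noncomputable section

namespace GenPK

/-! ### Exterior derivatives on vector fields, by passage to charts. -/

section CartanFormula

open VectorField Filter
open scoped Topology

variable {E : Type*} [NormedAddCommGroup E] [NormedSpace ℝ E]
variable {M : Type*} [TopologicalSpace M] [ChartedSpace E M] [IsManifold 𝓘(ℝ, E) ∞ M]

/-! Pointwise, the correspondence is linear algebra. `G = I₁ I₂` is a self-adjoint involution
commuting with `I₁`. Transversality makes its eigenspaces `L^±` graphs over `TM`, and comparing
`TM`-components in `G A = ± A` writes them as graphs of `b ∓ g`, where `-g` inverts the component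
`T^*M → TM` of `G` and `b` is `g` composed with the component `TM → TM`. Orthogonality of `L^+` and
`L^-` says that `b` is alternating and `g` symmetric. `I₁` preserves `L^±` and projects to `J_±`.
Since `I₂ = ∓ I₁` on `L^±`, these data determine both structures. The pairing restricts to `∓ g` on
`L^±`, so orthogonality of `I₁` means that `J_±` are `g`-orthogonal.

For integrability, involutivity is equivalent to the vanishing of a Nijenhuis expression formed with
the Courant bracket (`IsGenComplex.genNijenhuis_eq_zero`, `involutive_of_genNijenhuis`). Paired with
lifts to the graphs of signs `σ, τ, ρ`, it involves only the functions `T σ τ ρ` of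
`two_mul_pairing_courant_lift`, in which `H` and `b` enter only through `K = H + db`. Let `S Z X Y =
(∇_Z F)(X, Y)`, with the Levi-Civita connection expressed by the Koszul formula. The components of
type `(σ, σ, -σ)` say that `2σ (∇_Z F)(X, Y) = K(JX, Y, Z) + K(X, JY, Z)`. Given this, the component
`(σ, σ, σ)` says that `K` has no part of type (3,0)+(0,3). The components `(σ, -σ, σ)` reduce to the
`(σ, σ, -σ)` ones, because the pairing is invariant under the bracket up to exact terms. Together
the two conditions are equivalent to integrability of `J` and `d^c F = σ K`. This uses the classical
formula `2 (∇_Z F)(X, Y) = dF(Z, X, Y) - dF(Z, JX, JY) + g(N(X, Y), JZ)` (`two_mul_S`), and the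
equivalence is `integrable_of_T_of_N` with `T_and_N_of_integrable`.

These identities need only the formal rules for `X g(Y, Z)` and `g([X, Y], Z)`. They are therefore
proved for abstract symbols (`HermitianSymbols`) and applied to germs of vector fields, without
constructing a connection. The two constructions are mutually inverse because each quadruple, and
each pair, is associated with at most one partner. -/

theorem mfderiv_extChartAt_symm_inverse_apply (x : M) {y : E}
    (hy : y ∈ (extChartAt 𝓘(ℝ, E) x).target) (v : Tan E ((extChartAt 𝓘(ℝ, E) x).symm y)) :
    mfderiv 𝓘(ℝ, E) 𝓘(ℝ, E) (extChartAt 𝓘(ℝ, E) x).symm y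
      ((mfderiv 𝓘(ℝ, E) 𝓘(ℝ, E) (extChartAt 𝓘(ℝ, E) x).symm y).inverse v) = v := by
  have h := isInvertible_mfderivWithin_extChartAt_symm (I := 𝓘(ℝ, E)) hy
  rw [ModelWithCorners.range_eq_univ, mfderivWithin_univ] at h
  exact h.self_apply_inverse v

theorem mfderiv_extChartAt_apply_symm (x : M) {y : E}
    (hy : y ∈ (extChartAt 𝓘(ℝ, E) x).target) (v : E) :
    mfderiv 𝓘(ℝ, E) 𝓘(ℝ, E) (extChartAt 𝓘(ℝ, E) x) ((extChartAt 𝓘(ℝ, E) x).symm y)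
      (mfderiv 𝓘(ℝ, E) 𝓘(ℝ, E) (extChartAt 𝓘(ℝ, E) x).symm y v) = v := by
  have h := mfderiv_extChartAt_comp_mfderivWithin_extChartAt_symm (I := 𝓘(ℝ, E)) hy
  rw [ModelWithCorners.range_eq_univ, mfderivWithin_univ] at h
  exact congrArg (fun L : E →L[ℝ] E ↦ L v) h

theorem mfderiv_extChartAt_symm_apply (x : M) {y : M}
    (hy : y ∈ (extChartAt 𝓘(ℝ, E) x).source) (v : Tan E y) :
    mfderiv 𝓘(ℝ, E) 𝓘(ℝ, E) (extChartAt 𝓘(ℝ, E) x).symm (extChartAt 𝓘(ℝ, E) x y)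
      (mfderiv 𝓘(ℝ, E) 𝓘(ℝ, E) (extChartAt 𝓘(ℝ, E) x) y v) = v := by
  have h := mfderivWithin_extChartAt_symm_comp_mfderiv_extChartAt' (I := 𝓘(ℝ, E)) hy
  rw [ModelWithCorners.range_eq_univ, mfderivWithin_univ] at h
  exact congrArg (fun L : E →L[ℝ] E ↦ L v) h

/-- A vector field written in the chart around `x`. -/
def chartField (V : ∀ x : M, Tan E x) (x : M) (y : E) : E :=
  mpullback 𝓘(ℝ, E) 𝓘(ℝ, E) (extChartAt 𝓘(ℝ, E) x).symm V y

theorem chartField_self (V : ∀ x : M, Tan E x) (x : M) :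
    chartField V x (extChartAt 𝓘(ℝ, E) x x) =
      mfderiv 𝓘(ℝ, E) 𝓘(ℝ, E) (extChartAt 𝓘(ℝ, E) x) x (V x) := by
  have h1 := mfderiv_extChartAt_symm_inverse_apply x (mem_extChartAt_target (I := 𝓘(ℝ, E)) x)
    (V ((extChartAt 𝓘(ℝ, E) x).symm (extChartAt 𝓘(ℝ, E) x x)))
  have h2 := mfderiv_extChartAt_apply_symm x (mem_extChartAt_target (I := 𝓘(ℝ, E)) x)
    (chartField V x (extChartAt 𝓘(ℝ, E) x x))
  rw [← h2]
  change mfderiv 𝓘(ℝ, E) 𝓘(ℝ, E) (extChartAt 𝓘(ℝ, E) x) _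
    (mfderiv 𝓘(ℝ, E) 𝓘(ℝ, E) (extChartAt 𝓘(ℝ, E) x).symm _ (ContinuousLinearMap.inverse _ _)) = _
  rw [h1, extChartAt_to_inv]

theorem mfderiv_symm_chartField (V : ∀ x : M, Tan E x) (x : M) {y : E}
    (hy : y ∈ (extChartAt 𝓘(ℝ, E) x).target) :
    mfderiv 𝓘(ℝ, E) 𝓘(ℝ, E) (extChartAt 𝓘(ℝ, E) x).symm y (chartField (E := E) V x y) =
      V ((extChartAt 𝓘(ℝ, E) x).symm y) :=
  mfderiv_extChartAt_symm_inverse_apply x hy _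

theorem differentiableAt_chartField [CompleteSpace E] {V : ∀ x : M, Tan E x} {x : M}
    (hV : MDifferentiableAt 𝓘(ℝ, E) (𝓘(ℝ, E).prod 𝓘(ℝ, E))
      (fun x ↦ (TotalSpace.mk' E x (V x) : TangentBundle 𝓘(ℝ, E) M)) x) :
    DifferentiableAt ℝ (chartField V x) (extChartAt 𝓘(ℝ, E) x x) := by
  have := MDifferentiableWithinAt.differentiableWithinAt_mpullbackWithin_vectorField
    (I := 𝓘(ℝ, E)) (s := univ) hV.mdifferentiableWithinAt
  rw [preimage_univ, univ_inter, ModelWithCorners.range_eq_univ, mpullbackWithin_univ] at this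
  exact differentiableWithinAt_univ.1 this

/-- The manifold bracket is the pullback of the flat bracket of the chart representatives. Applying
the chart derivative undoes this pullback. -/
theorem mfderiv_mlieBracket (V W : ∀ x : M, Tan E x) (x : M) :
    mfderiv 𝓘(ℝ, E) 𝓘(ℝ, E) (extChartAt 𝓘(ℝ, E) x) x (mlieBracket 𝓘(ℝ, E) V W x) =
      lieBracket ℝ (chartField V x) (chartField W x) (extChartAt 𝓘(ℝ, E) x x) := by
  rw [← mlieBracketWithin_univ, mlieBracketWithin_apply]
  have h := isInvertible_mfderiv_extChartAt (I := 𝓘(ℝ, E)) (mem_extChartAt_source (I := 𝓘(ℝ, E)) x)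
  refine (h.self_apply_inverse _).trans ?_
  rw [ModelWithCorners.range_eq_univ, preimage_univ, inter_univ, mpullbackWithin_univ,
    mpullbackWithin_univ]
  change lieBracketWithin ℝ (chartField V x) (chartField W x) univ _ = _
  rw [lieBracketWithin_univ]

theorem chartForm_chartField {k : ℕ} (θ : ∀ x : M, Alt E k x) (V : Fin k → ∀ x : M, Tan E x)
    (x : M) {y : E} (hy : y ∈ (extChartAt 𝓘(ℝ, E) x).target) :
    chartForm θ x y (fun i ↦ chartField (V i) x y) =
      θ ((extChartAt 𝓘(ℝ, E) x).symm y) (fun i ↦ V i ((extChartAt 𝓘(ℝ, E) x).symm y)) := by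
  change θ ((extChartAt 𝓘(ℝ, E) x).symm y) (fun i ↦
    mfderiv 𝓘(ℝ, E) 𝓘(ℝ, E) (extChartAt 𝓘(ℝ, E) x).symm y (chartField (E := E) (V i) x y)) = _
  simp only [mfderiv_symm_chartField _ x hy]

theorem form_apply_congr {k : ℕ} (θ : ∀ x : M, Alt E k x) {p q : M} (h : p = q) (v : Fin k → E) :
    θ p v = θ q v := by
  subst h
  rfl

theorem chartForm_self {k : ℕ} (θ : ∀ x : M, Alt E k x) (x : M) {w : Fin k → E}
    {u : Fin k → Tan E x}
    (h : ∀ i, w i = mfderiv 𝓘(ℝ, E) 𝓘(ℝ, E) (extChartAt 𝓘(ℝ, E) x) x (u i)) :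
    chartForm θ x (extChartAt 𝓘(ℝ, E) x x) w = θ x u := by
  obtain rfl := funext h
  change θ ((extChartAt 𝓘(ℝ, E) x).symm (extChartAt 𝓘(ℝ, E) x x)) (fun i ↦
    mfderiv 𝓘(ℝ, E) 𝓘(ℝ, E) (extChartAt 𝓘(ℝ, E) x).symm (extChartAt 𝓘(ℝ, E) x x)
      (mfderiv 𝓘(ℝ, E) 𝓘(ℝ, E) (extChartAt 𝓘(ℝ, E) x) x (u i))) = _
  refine Eq.trans ?_ (form_apply_congr θ (extChartAt_to_inv (I := 𝓘(ℝ, E)) x) u)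
  congr 1
  funext i
  exact mfderiv_extChartAt_symm_apply x (mem_extChartAt_source (I := 𝓘(ℝ, E)) x) (u i)

/-- Chain rule for `f = h ∘ chart` near `x`. Leaving `h` free allows it to be a chart form evaluated
on chart fields, which is the shape produced by the flat formula for `d`. -/
theorem dFun_eq_fderiv_chart {f : M → ℝ} {x : M} {h : E → ℝ}
    (hh : DifferentiableAt ℝ h (extChartAt 𝓘(ℝ, E) x x))
    (hf : ∀ y ∈ (extChartAt 𝓘(ℝ, E) x).target, h y = f ((extChartAt 𝓘(ℝ, E) x).symm y))
    (v : Tan E x) :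
    dFun f x v =
      fderiv ℝ h (extChartAt 𝓘(ℝ, E) x x)
        (mfderiv 𝓘(ℝ, E) 𝓘(ℝ, E) (extChartAt 𝓘(ℝ, E) x) x v) := by
  have e : f =ᶠ[𝓝 x] h ∘ extChartAt 𝓘(ℝ, E) x := by
    filter_upwards [extChartAt_source_mem_nhds (I := 𝓘(ℝ, E)) x] with y hy
    rw [Function.comp_apply, hf _ ((extChartAt 𝓘(ℝ, E) x).map_source hy),
      (extChartAt 𝓘(ℝ, E) x).left_inv hy]
  rw [dFun, e.mfderiv_eq, mfderiv_comp x hh.mdifferentiableAt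
    (mdifferentiableAt_extChartAt (mem_chart_source E x)), mfderiv_eq_fderiv]
  rfl

/-- The exterior derivative of a form, evaluated on vector fields. -/
theorem extD_apply_vectorField [CompleteSpace E] {n : ℕ} {θ : ∀ x : M, Alt E (n + 1) x}
    {V : Fin (n + 2) → ∀ x : M, Tan E x} {x : M}
    (hθ : DifferentiableAt ℝ (chartForm θ x) (extChartAt 𝓘(ℝ, E) x x))
    (hV : ∀ i, MDifferentiableAt 𝓘(ℝ, E) (𝓘(ℝ, E).prod 𝓘(ℝ, E))
      (fun x ↦ (TotalSpace.mk' E x (V i x) : TangentBundle 𝓘(ℝ, E) M)) x) :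
    extD θ x (fun i ↦ V i x) =
      (∑ i : Fin (n + 2), (-1) ^ i.val •
        dFun (fun y ↦ θ y (fun j ↦ V (i.succAbove j) y)) x (V i x)) -
      ∑ i : Fin (n + 1), ∑ j ≥ i, (-1) ^ (i + j : ℕ) •
        θ x (Matrix.vecCons (mlieBracket 𝓘(ℝ, E) (V i.castSucc) (V j.succ) x)
          (j.removeNth <| i.castSucc.removeNth (V · x))) := by
  have hV' := fun i ↦ differentiableAt_chartField (hV i)
  -- The formula in the model space, applied to the chart representatives. What remains is to
  -- identify each of its terms with the corresponding intrinsic one.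
  have key := extDeriv_apply_vectorField hθ hV'
  have e0 : extD θ x (fun i ↦ V i x) = extDeriv (chartForm θ x) (extChartAt 𝓘(ℝ, E) x x)
      (fun i ↦ chartField (V i) x (extChartAt 𝓘(ℝ, E) x x)) := by
    simp only [chartField_self]
    rfl
  rw [e0, key]
  congr 1
  · refine Finset.sum_congr rfl fun i _ ↦ ?_
    congr 1
    rw [dFun_eq_fderiv_chart (h := fun y ↦ chartForm θ x y
      (i.removeNth fun i ↦ chartField (V i) x y)), chartField_self]
    · exact hθ.continuousAlternatingMap_apply (fun j ↦ hV' _)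
    · intro y hy
      exact chartForm_chartField θ (fun j ↦ V (i.succAbove j)) x hy
  · refine Finset.sum_congr rfl fun i _ ↦ Finset.sum_congr rfl fun j _ ↦ ?_
    congr 1
    refine chartForm_self θ x fun l ↦ ?_
    refine Fin.cases ?_ (fun l ↦ ?_) l
    · exact (mfderiv_mlieBracket _ _ x).symm
    · exact chartField_self _ x

/-- Cartan's formula for the exterior derivative of a 1-form. -/
theorem extD_toOneForm_apply [CompleteSpace E] {ξ : ∀ x : M, Cot E x}
    {X Y : ∀ x : M, Tan E x} {x : M}
    (hξ : DifferentiableAt ℝ (chartForm (toOneForm ξ) x) (extChartAt 𝓘(ℝ, E) x x))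
    (hX : MDifferentiableAt 𝓘(ℝ, E) (𝓘(ℝ, E).prod 𝓘(ℝ, E))
      (fun x ↦ (TotalSpace.mk' E x (X x) : TangentBundle 𝓘(ℝ, E) M)) x)
    (hY : MDifferentiableAt 𝓘(ℝ, E) (𝓘(ℝ, E).prod 𝓘(ℝ, E))
      (fun x ↦ (TotalSpace.mk' E x (Y x) : TangentBundle 𝓘(ℝ, E) M)) x) :
    extD (toOneForm ξ) x ![X x, Y x] =
      dFun (fun y ↦ ξ y (Y y)) x (X x) - dFun (fun y ↦ ξ y (X y)) x (Y x)
        - ξ x (mlieBracket 𝓘(ℝ, E) X Y x) := by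
  have key := extD_apply_vectorField (V := ![X, Y]) hξ (by
    intro i
    fin_cases i
    · exact hX
    · exact hY)
  have e : (fun i ↦ (![X, Y] : Fin 2 → ∀ x : M, Tan E x) i x) = ![X x, Y x] := by
    funext i
    fin_cases i <;> rfl
  rw [e] at key
  rw [key]
  rw [Fin.sum_univ_two, Fin.sum_univ_one, show Finset.Ici (0 : Fin 1) = {0} by decide,
    Finset.sum_singleton]
  simp only [Fin.val_zero, Fin.val_one, pow_zero, pow_one, one_smul,
    neg_smul, add_zero]
  exact congrArg₂ (· - ·) (sub_eq_add_neg _ _).symm rfl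

/-- Cartan's formula for the exterior derivative of a 2-form. -/
theorem extD_two_apply [CompleteSpace E] {θ : ∀ x : M, Alt E 2 x}
    {X Y Z : ∀ x : M, Tan E x} {x : M}
    (hθ : DifferentiableAt ℝ (chartForm θ x) (extChartAt 𝓘(ℝ, E) x x))
    (hX : MDifferentiableAt 𝓘(ℝ, E) (𝓘(ℝ, E).prod 𝓘(ℝ, E))
      (fun x ↦ (TotalSpace.mk' E x (X x) : TangentBundle 𝓘(ℝ, E) M)) x)
    (hY : MDifferentiableAt 𝓘(ℝ, E) (𝓘(ℝ, E).prod 𝓘(ℝ, E))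
      (fun x ↦ (TotalSpace.mk' E x (Y x) : TangentBundle 𝓘(ℝ, E) M)) x)
    (hZ : MDifferentiableAt 𝓘(ℝ, E) (𝓘(ℝ, E).prod 𝓘(ℝ, E))
      (fun x ↦ (TotalSpace.mk' E x (Z x) : TangentBundle 𝓘(ℝ, E) M)) x) :
    extD θ x ![X x, Y x, Z x] =
      dFun (fun y ↦ θ y ![Y y, Z y]) x (X x) - dFun (fun y ↦ θ y ![X y, Z y]) x (Y x)
        + dFun (fun y ↦ θ y ![X y, Y y]) x (Z x)
        - θ x ![mlieBracket 𝓘(ℝ, E) X Y x, Z x] + θ x ![mlieBracket 𝓘(ℝ, E) X Z x, Y x]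
        - θ x ![mlieBracket 𝓘(ℝ, E) Y Z x, X x] := by
  have key := extD_apply_vectorField (V := ![X, Y, Z]) hθ (by
    intro i
    fin_cases i
    · exact hX
    · exact hY
    · exact hZ)
  have e : (fun i ↦ (![X, Y, Z] : Fin 3 → ∀ x : M, Tan E x) i x) = ![X x, Y x, Z x] := by
    funext i
    fin_cases i <;> rfl
  rw [e] at key
  rw [key]
  rw [Fin.sum_univ_three, Fin.sum_univ_two, show Finset.Ici (0 : Fin 2) = {0, 1} by decide,
    show Finset.Ici (1 : Fin 2) = {1} by decide, Finset.sum_pair (by decide),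
    Finset.sum_singleton]
  have pair {y : M} (c : Fin 2 → Tan E y) : c = ![c 0, c 1] := by
    funext j
    fin_cases j <;> rfl
  have t0 : (fun y ↦ θ y fun j ↦ (![X, Y, Z] : Fin 3 → ∀ x : M, Tan E x)
      ((0 : Fin 3).succAbove j) y) = fun y ↦ θ y ![Y y, Z y] :=
    funext fun y ↦ congrArg (θ y) (pair _)
  have t1 : (fun y ↦ θ y fun j ↦ (![X, Y, Z] : Fin 3 → ∀ x : M, Tan E x)
      ((1 : Fin 3).succAbove j) y) = fun y ↦ θ y ![X y, Z y] :=
    funext fun y ↦ congrArg (θ y) (pair _)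
  have t2 : (fun y ↦ θ y fun j ↦ (![X, Y, Z] : Fin 3 → ∀ x : M, Tan E x)
      ((2 : Fin 3).succAbove j) y) = fun y ↦ θ y ![X y, Y y] :=
    funext fun y ↦ congrArg (θ y) (pair _)
  rw [t0, t1, t2]
  simp only [Fin.val_zero, Fin.val_one, Fin.val_two, pow_zero, pow_one, one_smul, neg_smul,
    add_zero, zero_add, Nat.reduceAdd, even_two.neg_one_pow]
  have b01 : θ x (Matrix.vecCons (mlieBracket 𝓘(ℝ, E)
      ((![X, Y, Z] : Fin 3 → ∀ x : M, Tan E x) (Fin.castSucc 0))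
      ((![X, Y, Z] : Fin 3 → ∀ x : M, Tan E x) (Fin.succ 0)) x)
      ((0 : Fin 2).removeNth ((Fin.castSucc 0 : Fin 3).removeNth
        ![X x, Y x, Z x]))) =
      θ x ![mlieBracket 𝓘(ℝ, E) X Y x, Z x] := congrArg (θ x) (pair _)
  have b02 : θ x (Matrix.vecCons (mlieBracket 𝓘(ℝ, E)
      ((![X, Y, Z] : Fin 3 → ∀ x : M, Tan E x) (Fin.castSucc 0))
      ((![X, Y, Z] : Fin 3 → ∀ x : M, Tan E x) (Fin.succ 1)) x)
      ((1 : Fin 2).removeNth ((Fin.castSucc 0 : Fin 3).removeNth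
        ![X x, Y x, Z x]))) =
      θ x ![mlieBracket 𝓘(ℝ, E) X Z x, Y x] := congrArg (θ x) (pair _)
  have b12 : θ x (Matrix.vecCons (mlieBracket 𝓘(ℝ, E)
      ((![X, Y, Z] : Fin 3 → ∀ x : M, Tan E x) (Fin.castSucc 1))
      ((![X, Y, Z] : Fin 3 → ∀ x : M, Tan E x) (Fin.succ 1)) x)
      ((1 : Fin 2).removeNth ((Fin.castSucc 1 : Fin 3).removeNth
        ![X x, Y x, Z x]))) =
      θ x ![mlieBracket 𝓘(ℝ, E) Y Z x, X x] := congrArg (θ x) (pair _)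
  rw [b01, b02, b12]
  simp only [Matrix.cons_val_zero, Matrix.cons_val_one, Matrix.cons_val_two, Matrix.tail_cons,
    Matrix.head_cons]
  ring

theorem extD_congr {k : ℕ} {θ θ' : ∀ x : M, Alt E k x} {x : M}
    (h : ∀ᶠ y in 𝓝 x, θ y = θ' y) : extD θ x = extD θ' x := by
  have h' : chartForm θ x =ᶠ[𝓝 (extChartAt 𝓘(ℝ, E) x x)] chartForm θ' x := by
    have hc := continuousAt_extChartAt_symm (I := 𝓘(ℝ, E)) x
    rw [ContinuousAt, extChartAt_to_inv] at hc
    filter_upwards [hc.eventually h] with y hy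
    rw [chartForm, chartForm, hy]
  rw [extD, extD, h'.extDeriv_eq]

end CartanFormula

/-! ### Smoothness criteria for maps and bundle sections. -/

section SmoothMaps

open Filter Module
open scoped Topology

variable {EB : Type*} [NormedAddCommGroup EB] [NormedSpace ℝ EB]
  {B : Type*} [TopologicalSpace B] [ChartedSpace EB B]

/-- In finite dimensions an injective linear map has a linear left inverse that is automatically
continuous, hence smooth. -/
theorem contMDiffAt_of_injective {W V : Type*} [NormedAddCommGroup W] [NormedSpace ℝ W]
    [FiniteDimensional ℝ W] [NormedAddCommGroup V] [NormedSpace ℝ V] [FiniteDimensional ℝ V]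
    (ι : W →ₗ[ℝ] V) (hι : Function.Injective ι) {f : B → W} {x : B}
    (h : ContMDiffAt 𝓘(ℝ, EB) 𝓘(ℝ, V) ∞ (fun y ↦ ι (f y)) x) :
    ContMDiffAt 𝓘(ℝ, EB) 𝓘(ℝ, W) ∞ f x := by
  obtain ⟨r, hr⟩ := LinearMap.exists_leftInverse_of_injective ι (LinearMap.ker_eq_bot.2 hι)
  have e : f = fun y ↦ LinearMap.toContinuousLinearMap r (ι (f y)) := by
    funext y
    exact (LinearMap.congr_fun hr (f y)).symm
  rw [e]
  exact (LinearMap.toContinuousLinearMap r).contDiff.contMDiff.contMDiffAt.comp x h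

theorem contMDiffAt_clm_of_apply {V W : Type*} [NormedAddCommGroup V] [NormedSpace ℝ V]
    [FiniteDimensional ℝ V] [NormedAddCommGroup W] [NormedSpace ℝ W] {f : B → V →L[ℝ] W} {x : B}
    (h : ∀ v, ContMDiffAt 𝓘(ℝ, EB) 𝓘(ℝ, W) ∞ (fun y ↦ f y v) x) :
    ContMDiffAt 𝓘(ℝ, EB) 𝓘(ℝ, V →L[ℝ] W) ∞ f x := by
  let d := finrank ℝ V
  have hd : d = finrank ℝ (Fin d → ℝ) := (finrank_fin_fun ℝ).symm
  let e₁ := ContinuousLinearEquiv.ofFinrankEq hd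
  let e₂ := (e₁.arrowCongr (1 : W ≃L[ℝ] W)).trans (ContinuousLinearEquiv.piRing (Fin d))
  have e : f = fun y ↦ e₂.symm (e₂ (f y)) := by
    funext y
    simp
  rw [e]
  refine e₂.symm.contDiff.contMDiff.contMDiffAt.comp x ?_
  exact contMDiffAt_pi_space.2 fun i ↦ h _

instance finiteDimensional_continuousAlternatingMap {V : Type*} [NormedAddCommGroup V]
    [NormedSpace ℝ V] [FiniteDimensional ℝ V] (k : ℕ) : FiniteDimensional ℝ (V [⋀^Fin k]→L[ℝ] ℝ) :=
  Module.Finite.of_injective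
    (ContinuousMultilinearMap.toMultilinearMapLinear.comp
      (ContinuousAlternatingMap.toContinuousMultilinearMapLinear (R := ℝ) (A := ℝ) (M := V) (N := ℝ)
        (ι := Fin k)))
    (fun f g h ↦ by
      ext v
      exact congrArg (fun m : MultilinearMap ℝ (fun _ : Fin k ↦ V) ℝ ↦ m v) h)

/-- An alternating form is determined by its values on tuples of basis vectors, so the space of
forms embeds linearly in a finite power of `ℝ`. -/
theorem contMDiffAt_alternating_of_apply {V : Type*} [NormedAddCommGroup V] [NormedSpace ℝ V]
    [FiniteDimensional ℝ V] {k : ℕ} {f : B → V [⋀^Fin k]→L[ℝ] ℝ} {x : B}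
    (h : ∀ v, ContMDiffAt 𝓘(ℝ, EB) 𝓘(ℝ, ℝ) ∞ (fun y ↦ f y v) x) :
    ContMDiffAt 𝓘(ℝ, EB) 𝓘(ℝ, V [⋀^Fin k]→L[ℝ] ℝ) ∞ f x := by
  let b := finBasis ℝ V
  let ι : (V [⋀^Fin k]→L[ℝ] ℝ) →ₗ[ℝ] ((Fin k → Fin (finrank ℝ V)) → ℝ) :=
    { toFun := fun g s ↦ g (fun i ↦ b (s i))
      map_add' := fun _ _ ↦ rfl
      map_smul' := fun _ _ ↦ rfl }
  refine contMDiffAt_of_injective ι (fun g g' hg ↦ ?_) (contMDiffAt_pi_space.2 fun s ↦ h _)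
  have := Basis.ext_multilinear (f := g.toMultilinearMap) (g := g'.toMultilinearMap) (fun _ ↦ b)
    fun s ↦ congrFun hg s
  ext v
  exact congrArg (fun m : MultilinearMap ℝ (fun _ : Fin k ↦ V) ℝ ↦ m v) this

variable {F₁ : Type*} [NormedAddCommGroup F₁] [NormedSpace ℝ F₁] {E₁ : B → Type*}
  [∀ x, AddCommGroup (E₁ x)] [∀ x, Module ℝ (E₁ x)] [TopologicalSpace (TotalSpace F₁ E₁)]
  [∀ x, TopologicalSpace (E₁ x)] [FiberBundle F₁ E₁] [VectorBundle ℝ F₁ E₁]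
  {F₂ : Type*} [NormedAddCommGroup F₂] [NormedSpace ℝ F₂] {E₂ : B → Type*}
  [∀ x, AddCommGroup (E₂ x)] [∀ x, Module ℝ (E₂ x)] [TopologicalSpace (TotalSpace F₂ E₂)]
  [∀ x, TopologicalSpace (E₂ x)] [FiberBundle F₂ E₂] [VectorBundle ℝ F₂ E₂]
  [∀ x, IsTopologicalAddGroup (E₂ x)] [∀ x, ContinuousSMul ℝ (E₂ x)]

/-- A section of a bundle of homomorphisms is smooth if it maps the sections that are constant
in a trivialization to smooth sections. -/
theorem contMDiffAt_hom_of_apply [FiniteDimensional ℝ F₁] {T : ∀ x, E₁ x →L[ℝ] E₂ x} {x₀ : B}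
    (h : ∀ v : F₁, ContMDiffAt 𝓘(ℝ, EB) (𝓘(ℝ, EB).prod 𝓘(ℝ, F₂)) ∞
      (fun x ↦ TotalSpace.mk' F₂ x (T x ((trivializationAt F₁ E₁ x₀).symmL ℝ x v))) x₀) :
    ContMDiffAt 𝓘(ℝ, EB) (𝓘(ℝ, EB).prod 𝓘(ℝ, F₁ →L[ℝ] F₂)) ∞
      (fun x ↦ TotalSpace.mk' (F₁ →L[ℝ] F₂) (E := fun x ↦ E₁ x →L[ℝ] E₂ x) x (T x)) x₀ := by
  rw [contMDiffAt_hom_bundle]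
  refine ⟨contMDiffAt_id, contMDiffAt_clm_of_apply fun v ↦ ?_⟩
  refine ((contMDiffAt_section x₀).1 (h v)).congr_of_eventuallyEq ?_
  filter_upwards [(trivializationAt F₂ E₂ x₀).open_baseSet.mem_nhds
    (mem_baseSet_trivializationAt F₂ E₂ x₀)] with y hy
  change (trivializationAt F₂ E₂ x₀).continuousLinearMapAt ℝ y _ = _
  exact (trivializationAt F₂ E₂ x₀).continuousLinearMapAt_apply_of_mem ℝ hy _

/-- A section is smooth if its image under a smooth invertible homomorphism is. -/
theorem contMDiffAt_section_of_hom [FiniteDimensional ℝ F₁] {T : ∀ x, E₁ x →L[ℝ] E₂ x}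
    {s : ∀ x, E₁ x} {x₀ : B} (hT₀ : (T x₀).IsInvertible)
    (hT : ContMDiffAt 𝓘(ℝ, EB) (𝓘(ℝ, EB).prod 𝓘(ℝ, F₁ →L[ℝ] F₂)) ∞
      (fun x ↦ TotalSpace.mk' (F₁ →L[ℝ] F₂) (E := fun x ↦ E₁ x →L[ℝ] E₂ x) x (T x)) x₀)
    (h : ContMDiffAt 𝓘(ℝ, EB) (𝓘(ℝ, EB).prod 𝓘(ℝ, F₂)) ∞
      (fun x ↦ TotalSpace.mk' F₂ x (T x (s x))) x₀) :
    ContMDiffAt 𝓘(ℝ, EB) (𝓘(ℝ, EB).prod 𝓘(ℝ, F₁)) ∞ (fun x ↦ TotalSpace.mk' F₁ x (s x)) x₀ := by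
  have : CompleteSpace F₁ := FiniteDimensional.complete ℝ F₁
  rw [contMDiffAt_hom_bundle] at hT
  replace hT := hT.2
  rw [contMDiffAt_section] at h ⊢
  have m1 := mem_baseSet_trivializationAt F₁ E₁ x₀
  have m2 := mem_baseSet_trivializationAt F₂ E₂ x₀
  obtain ⟨e, he⟩ := hT₀
  let e' : F₁ ≃L[ℝ] F₂ := ((trivializationAt F₁ E₁ x₀).continuousLinearEquivAt ℝ x₀ m1).symm.trans
    (e.trans ((trivializationAt F₂ E₂ x₀).continuousLinearEquivAt ℝ x₀ m2))
  have he' : ContinuousLinearMap.inCoordinates F₁ E₁ F₂ E₂ x₀ x₀ x₀ x₀ (T x₀) = e' := by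
    rw [ContinuousLinearMap.inCoordinates_eq m1 m2, ← he]
    rfl
  -- Inversion is smooth at an invertible operator. Near `x₀` the section is therefore this smooth
  -- inverse applied to the smooth section `T s`, in coordinates.
  have hinv : ContMDiffAt 𝓘(ℝ, EB) 𝓘(ℝ, F₂ →L[ℝ] F₁) ∞ (fun x ↦
      (ContinuousLinearMap.inCoordinates F₁ E₁ F₂ E₂ x₀ x x₀ x (T x)).inverse) x₀ := by
    have : ContDiffAt ℝ ∞ ContinuousLinearMap.inverse
        (ContinuousLinearMap.inCoordinates F₁ E₁ F₂ E₂ x₀ x₀ x₀ x₀ (T x₀)) := by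
      rw [he']
      exact contDiffAt_map_inverse e'
    exact this.contMDiffAt.comp x₀ hT
  refine (hinv.clm_apply h).congr_of_eventuallyEq ?_
  -- Invertibility is assumed only at `x₀`. It persists nearby because invertible operators form an
  -- open set.
  have hev : ∀ᶠ x in 𝓝 x₀, (ContinuousLinearMap.inCoordinates F₁ E₁ F₂ E₂ x₀ x x₀ x
      (T x)).IsInvertible := by
    refine hT.continuousAt.eventually ?_
    change ∀ᶠ L in 𝓝 (ContinuousLinearMap.inCoordinates F₁ E₁ F₂ E₂ x₀ x₀ x₀ x₀ (T x₀)), _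
    rw [he']
    exact ContinuousLinearEquiv.nhds e'
  filter_upwards [hev, (trivializationAt F₁ E₁ x₀).open_baseSet.mem_nhds m1,
    (trivializationAt F₂ E₂ x₀).open_baseSet.mem_nhds m2] with y hy hy1 hy2
  have key : ContinuousLinearMap.inCoordinates F₁ E₁ F₂ E₂ x₀ y x₀ y (T y)
      ((trivializationAt F₁ E₁ x₀) ⟨y, s y⟩).2 = ((trivializationAt F₂ E₂ x₀) ⟨y, T y (s y)⟩).2 := by
    rw [ContinuousLinearMap.inCoordinates_eq hy1 hy2]
    change ((trivializationAt F₂ E₂ x₀) ⟨y, T y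
      (((trivializationAt F₁ E₁ x₀).continuousLinearEquivAt ℝ y hy1).symm
        ((trivializationAt F₁ E₁ x₀).continuousLinearEquivAt ℝ y hy1 (s y)))⟩).2 = _
    rw [ContinuousLinearEquiv.symm_apply_apply]
  change _ = (ContinuousLinearMap.inCoordinates F₁ E₁ F₂ E₂ x₀ y x₀ y (T y)).inverse
    ((trivializationAt F₂ E₂ x₀) ⟨y, T y (s y)⟩).2
  rw [← key, hy.inverse_apply_self]

theorem contMDiffAt_symmL [ContMDiffVectorBundle ∞ F₁ E₁ 𝓘(ℝ, EB)] (x₀ : B) (v : F₁) {x : B}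
    (hx : x ∈ (trivializationAt F₁ E₁ x₀).baseSet) :
    ContMDiffAt 𝓘(ℝ, EB) (𝓘(ℝ, EB).prod 𝓘(ℝ, F₁)) ∞
      (fun x ↦ TotalSpace.mk' F₁ x ((trivializationAt F₁ E₁ x₀).symmL ℝ x v)) x := by
  rw [(trivializationAt F₁ E₁ x₀).contMDiffAt_section_iff hx]
  refine (contMDiffAt_const (c := v)).congr_of_eventuallyEq ?_
  filter_upwards [(trivializationAt F₁ E₁ x₀).open_baseSet.mem_nhds hx] with y hy
  simp [hy]

theorem contMDiffAt_prod_section {s : ∀ x, E₁ x × E₂ x} {x₀ : B} :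
    ContMDiffAt 𝓘(ℝ, EB) (𝓘(ℝ, EB).prod 𝓘(ℝ, F₁ × F₂)) ∞
      (fun x ↦ TotalSpace.mk' (F₁ × F₂) (E := fun x ↦ E₁ x × E₂ x) x (s x)) x₀ ↔
    ContMDiffAt 𝓘(ℝ, EB) (𝓘(ℝ, EB).prod 𝓘(ℝ, F₁)) ∞ (fun x ↦ TotalSpace.mk' F₁ x (s x).1) x₀ ∧
    ContMDiffAt 𝓘(ℝ, EB) (𝓘(ℝ, EB).prod 𝓘(ℝ, F₂)) ∞
      (fun x ↦ TotalSpace.mk' F₂ x (s x).2) x₀ := by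
  rw [contMDiffAt_section, contMDiffAt_section, contMDiffAt_section]
  exact contMDiffAt_prod_module_iff _

theorem contMDiffAt_trivial_section {f : B → ℝ} {x₀ : B} :
    ContMDiffAt 𝓘(ℝ, EB) (𝓘(ℝ, EB).prod 𝓘(ℝ, ℝ)) ∞
      (fun x ↦ TotalSpace.mk' ℝ (E := Bundle.Trivial B ℝ) x (f x)) x₀ ↔
    ContMDiffAt 𝓘(ℝ, EB) 𝓘(ℝ, ℝ) ∞ f x₀ := by
  rw [contMDiffAt_section]
  rfl

end SmoothMaps

/-! ### Pointwise smoothness of fields and its test on local sections. -/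

section SmoothFields

open Filter
open scoped Topology

variable {E : Type*} [NormedAddCommGroup E] [NormedSpace ℝ E]
variable {M : Type*} [TopologicalSpace M] [ChartedSpace E M] [IsManifold 𝓘(ℝ, E) ∞ M]

/-- `X` is a smooth vector field at `x`. -/
def SmoothVectorAt (X : ∀ x : M, Tan E x) (x : M) : Prop :=
  ContMDiffAt 𝓘(ℝ, E) (𝓘(ℝ, E).prod 𝓘(ℝ, E)) ∞
    (fun x ↦ (TotalSpace.mk' E x (X x) : TangentBundle 𝓘(ℝ, E) M)) x

/-- `ξ` is a smooth section of `T^*M` at `x`. -/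
def SmoothCovectorAt (ξ : ∀ x : M, Cot E x) (x : M) : Prop :=
  ContMDiffAt 𝓘(ℝ, E) (𝓘(ℝ, E).prod 𝓘(ℝ, E →L[ℝ] ℝ)) ∞
    (fun x ↦ TotalSpace.mk' (E →L[ℝ] ℝ) (E := fun x : M ↦ Cot E x) x (ξ x)) x

/-- `A` is a smooth section of `TM ⊕ T^*M` at `x`. -/
def SmoothGenAt (A : ∀ x : M, GTan E x) (x : M) : Prop :=
  SmoothVectorAt (fun x ↦ (A x).1) x ∧ SmoothCovectorAt (fun x ↦ (A x).2) x

/-- `f` is a smooth function at `x`. -/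
def SmoothFunAt (f : M → ℝ) (x : M) : Prop := ContMDiffAt 𝓘(ℝ, E) 𝓘(ℝ, ℝ) ∞ f x

theorem smoothVectorOn_iff {X : ∀ x : M, Tan E x} {U : Set M} (hU : IsOpen U) :
    SmoothVectorOn X U ↔ ∀ x ∈ U, SmoothVectorAt X x :=
  ⟨fun h x hx ↦ (h x hx).contMDiffAt (hU.mem_nhds hx), fun h x hx ↦ (h x hx).contMDiffWithinAt⟩

theorem smoothCovectorOn_iff {ξ : ∀ x : M, Cot E x} {U : Set M} (hU : IsOpen U) :
    SmoothCovectorOn ξ U ↔ ∀ x ∈ U, SmoothCovectorAt ξ x :=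
  ⟨fun h x hx ↦ (h x hx).contMDiffAt (hU.mem_nhds hx), fun h x hx ↦ (h x hx).contMDiffWithinAt⟩

theorem smoothGenOn_iff {A : ∀ x : M, GTan E x} {U : Set M} (hU : IsOpen U) :
    SmoothGenOn A U ↔ ∀ x ∈ U, SmoothGenAt A x := by
  rw [SmoothGenOn, smoothVectorOn_iff hU, smoothCovectorOn_iff hU]
  exact ⟨fun h x hx ↦ ⟨h.1 x hx, h.2 x hx⟩, fun h ↦ ⟨fun x hx ↦ (h x hx).1, fun x hx ↦ (h x hx).2⟩⟩

theorem SmoothVectorAt.mdifferentiableAt {X : ∀ x : M, Tan E x} {x : M} (h : SmoothVectorAt X x) :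
    MDifferentiableAt 𝓘(ℝ, E) (𝓘(ℝ, E).prod 𝓘(ℝ, E))
      (fun x ↦ (TotalSpace.mk' E x (X x) : TangentBundle 𝓘(ℝ, E) M)) x :=
  ContMDiffAt.mdifferentiableAt h (by simp)

theorem SmoothFunAt.mdifferentiableAt {f : M → ℝ} {x : M} (h : SmoothFunAt (E := E) f x) :
    MDifferentiableAt 𝓘(ℝ, E) 𝓘(ℝ, ℝ) f x :=
  ContMDiffAt.mdifferentiableAt h (by simp)

theorem SmoothVectorAt.add {X Y : ∀ x : M, Tan E x} {x : M} (hX : SmoothVectorAt X x)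
    (hY : SmoothVectorAt Y x) : SmoothVectorAt (fun y ↦ X y + Y y) x := ContMDiffAt.add_section hX hY

theorem SmoothVectorAt.sub {X Y : ∀ x : M, Tan E x} {x : M} (hX : SmoothVectorAt X x)
    (hY : SmoothVectorAt Y x) : SmoothVectorAt (fun y ↦ X y - Y y) x := ContMDiffAt.sub_section hX hY

theorem SmoothVectorAt.neg {X : ∀ x : M, Tan E x} {x : M} (hX : SmoothVectorAt X x) :
    SmoothVectorAt (fun y ↦ -X y) x := ContMDiffAt.neg_section hX

theorem SmoothVectorAt.const_smul {X : ∀ x : M, Tan E x} {x : M} (hX : SmoothVectorAt X x)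
    (c : ℝ) : SmoothVectorAt (fun y ↦ c • X y) x := ContMDiffAt.const_smul_section hX

theorem smoothVectorAt_zero (x : M) : SmoothVectorAt (E := E) (fun _ ↦ 0) x :=
  (contMDiff_zeroSection (IB := 𝓘(ℝ, E)) (n := ∞) ℝ (fun x : M ↦ Tan E x)).contMDiffAt

theorem SmoothCovectorAt.add {ξ η : ∀ x : M, Cot E x} {x : M} (hξ : SmoothCovectorAt ξ x)
    (hη : SmoothCovectorAt η x) : SmoothCovectorAt (fun y ↦ ξ y + η y) x :=
  ContMDiffAt.add_section hξ hη

theorem SmoothCovectorAt.sub {ξ η : ∀ x : M, Cot E x} {x : M} (hξ : SmoothCovectorAt ξ x)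
    (hη : SmoothCovectorAt η x) : SmoothCovectorAt (fun y ↦ ξ y - η y) x :=
  ContMDiffAt.sub_section hξ hη

theorem SmoothCovectorAt.neg {ξ : ∀ x : M, Cot E x} {x : M} (hξ : SmoothCovectorAt ξ x) :
    SmoothCovectorAt (fun y ↦ -ξ y) x := ContMDiffAt.neg_section hξ

theorem SmoothCovectorAt.const_smul {ξ : ∀ x : M, Cot E x} {x : M} (hξ : SmoothCovectorAt ξ x)
    (c : ℝ) : SmoothCovectorAt (fun y ↦ c • ξ y) x := ContMDiffAt.const_smul_section hξ

theorem smoothCovectorAt_zero (x : M) : SmoothCovectorAt (E := E) (fun _ ↦ 0) x :=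
  (contMDiff_zeroSection (IB := 𝓘(ℝ, E)) (n := ∞) ℝ (fun x : M ↦ Cot E x)).contMDiffAt

theorem SmoothCovectorAt.apply {ξ : ∀ x : M, Cot E x} {X : ∀ x : M, Tan E x} {x : M}
    (hξ : SmoothCovectorAt ξ x) (hX : SmoothVectorAt X x) :
    SmoothFunAt (E := E) (fun y ↦ ξ y (X y)) x :=
  contMDiffAt_trivial_section.1 (ContMDiffAt.clm_bundle_apply (E₂ := Bundle.Trivial M ℝ) hξ hX)

theorem SmoothBilin.apply {g : ∀ x : M, Tan E x →L[ℝ] Tan E x →L[ℝ] ℝ} (hg : SmoothBilin g)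
    {X : ∀ x : M, Tan E x} {x : M} (hX : SmoothVectorAt X x) :
    SmoothCovectorAt (fun y ↦ g y (X y)) x :=
  ContMDiffAt.clm_bundle_apply (E₂ := fun x : M ↦ Cot E x) (hg x) hX

theorem SmoothEnd.apply {J : ∀ x : M, Tan E x →L[ℝ] Tan E x} (hJ : SmoothEnd J)
    {X : ∀ x : M, Tan E x} {x : M} (hX : SmoothVectorAt X x) :
    SmoothVectorAt (fun y ↦ J y (X y)) x :=
  ContMDiffAt.clm_bundle_apply (E₂ := fun x : M ↦ Tan E x) (hJ x) hX

theorem smoothGenAt_iff {A : ∀ x : M, GTan E x} {x : M} : SmoothGenAt A x ↔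
    ContMDiffAt 𝓘(ℝ, E) (𝓘(ℝ, E).prod 𝓘(ℝ, E × (E →L[ℝ] ℝ))) ∞
      (fun x ↦ TotalSpace.mk' (E × (E →L[ℝ] ℝ)) (E := fun x : M ↦ GTan E x) x (A x)) x :=
  (contMDiffAt_prod_section (E₁ := fun x : M ↦ Tan E x) (E₂ := fun x : M ↦ Cot E x)).symm

theorem SmoothGenEnd.apply {I : ∀ x : M, GTan E x →L[ℝ] GTan E x} (hI : SmoothGenEnd I)
    {A : ∀ x : M, GTan E x} {x : M} (hA : SmoothGenAt A x) :
    SmoothGenAt (fun y ↦ I y (A y)) x :=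
  smoothGenAt_iff.2 (ContMDiffAt.clm_bundle_apply (E₁ := fun x : M ↦ GTan E x)
    (E₂ := fun x : M ↦ GTan E x) (hI x) (smoothGenAt_iff.1 hA))

/-- The vector field with constant coordinates `v` in the chart around `x₀`. -/
def constField (x₀ : M) (v : E) (x : M) : Tan E x :=
  (trivializationAt E (fun x : M ↦ Tan E x) x₀).symmL ℝ x v

theorem smoothVectorAt_constField (x₀ : M) (v : E) : ∀ᶠ y in 𝓝 x₀,
    SmoothVectorAt (constField (E := E) x₀ v) y := by
  filter_upwards [(trivializationAt E (fun x : M ↦ Tan E x) x₀).open_baseSet.mem_nhds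
    (mem_baseSet_trivializationAt E (fun x : M ↦ Tan E x) x₀)] with y hy
  exact contMDiffAt_symmL x₀ v hy

/-- Every tangent vector extends to a vector field that is smooth near the base point. -/
theorem exists_smoothVector_extension (x₀ : M) (v : Tan E x₀) : ∃ X : ∀ x : M, Tan E x,
    (∀ᶠ y in 𝓝 x₀, SmoothVectorAt X y) ∧ X x₀ = v := by
  refine ⟨constField (E := E) x₀
    ((trivializationAt E (fun x : M ↦ Tan E x) x₀).continuousLinearMapAt ℝ x₀ v),
    smoothVectorAt_constField x₀ _, ?_⟩
  exact (trivializationAt E (fun x : M ↦ Tan E x) x₀).symmL_continuousLinearMapAt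
    (mem_baseSet_trivializationAt E (fun x : M ↦ Tan E x) x₀) v

variable [FiniteDimensional ℝ E]

/-- The fields with constant coordinates are smooth near their base point and already suffice as
test fields. The same argument gives the versions for endomorphisms below. -/
theorem smoothBilin_of_apply {g : ∀ x : M, Tan E x →L[ℝ] Tan E x →L[ℝ] ℝ}
    (h : ∀ (x : M) (Y : ∀ x : M, Tan E x), (∀ᶠ y in 𝓝 x, SmoothVectorAt Y y) →
      SmoothCovectorAt (fun y ↦ g y (Y y)) x) : SmoothBilin g := fun x ↦
  contMDiffAt_hom_of_apply (E₁ := fun x : M ↦ Tan E x) (E₂ := fun x : M ↦ Cot E x) fun v ↦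
    h x _ (smoothVectorAt_constField x v)

theorem smoothEnd_of_apply {J : ∀ x : M, Tan E x →L[ℝ] Tan E x}
    (h : ∀ (x : M) (Y : ∀ x : M, Tan E x), (∀ᶠ y in 𝓝 x, SmoothVectorAt Y y) →
      SmoothVectorAt (fun y ↦ J y (Y y)) x) : SmoothEnd J := fun x ↦
  contMDiffAt_hom_of_apply (E₁ := fun x : M ↦ Tan E x) (E₂ := fun x : M ↦ Tan E x) fun v ↦
    h x _ (smoothVectorAt_constField x v)

theorem smoothGenEnd_of_apply {I : ∀ x : M, GTan E x →L[ℝ] GTan E x}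
    (h : ∀ (x : M) (A : ∀ x : M, GTan E x), (∀ᶠ y in 𝓝 x, SmoothGenAt A y) →
      SmoothGenAt (fun y ↦ I y (A y)) x) : SmoothGenEnd I := fun x ↦
  contMDiffAt_hom_of_apply (E₁ := fun x : M ↦ GTan E x) (E₂ := fun x : M ↦ GTan E x) fun v ↦ by
    refine smoothGenAt_iff.1 (h x _ ?_)
    filter_upwards [(trivializationAt (E × (E →L[ℝ] ℝ)) (fun x : M ↦ GTan E x) x).open_baseSet.mem_nhds
      (mem_baseSet_trivializationAt (E × (E →L[ℝ] ℝ)) (fun x : M ↦ GTan E x) x)] with y hy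
    exact smoothGenAt_iff.2 (contMDiffAt_symmL (E₁ := fun x : M ↦ GTan E x) x v hy)

/-- Raising an index with a metric preserves smoothness. -/
theorem SmoothBilin.smoothVectorAt {g : ∀ x : M, Tan E x →L[ℝ] Tan E x →L[ℝ] ℝ}
    (hg : SmoothBilin g) {x : M} (hx : (g x).IsInvertible) {X : ∀ x : M, Tan E x}
    (h : SmoothCovectorAt (fun y ↦ g y (X y)) x) : SmoothVectorAt X x :=
  contMDiffAt_section_of_hom (E₁ := fun x : M ↦ Tan E x) (E₂ := fun x : M ↦ Cot E x) hx (hg x) h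

/-- A covector field is smooth if its image under a smooth invertible map `T^*M → TM` is. -/
theorem smoothCovectorAt_of_hom {P : ∀ x : M, Cot E x →L[ℝ] Tan E x} {x : M}
    (hx : (P x).IsInvertible)
    (hP : ∀ ξ : ∀ x : M, Cot E x, (∀ᶠ y in 𝓝 x, SmoothCovectorAt ξ y) →
      SmoothVectorAt (fun y ↦ P y (ξ y)) x) {ξ : ∀ x : M, Cot E x}
    (h : SmoothVectorAt (fun y ↦ P y (ξ y)) x) : SmoothCovectorAt ξ x := by
  refine contMDiffAt_section_of_hom (E₁ := fun x : M ↦ Cot E x) (E₂ := fun x : M ↦ Tan E x) hx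
    (contMDiffAt_hom_of_apply (E₁ := fun x : M ↦ Cot E x) (E₂ := fun x : M ↦ Tan E x) fun v ↦
      hP _ ?_) h
  filter_upwards [(trivializationAt (E →L[ℝ] ℝ) (fun x : M ↦ Cot E x) x).open_baseSet.mem_nhds
    (mem_baseSet_trivializationAt (E →L[ℝ] ℝ) (fun x : M ↦ Cot E x) x)] with y hy
  exact contMDiffAt_symmL (E₁ := fun x : M ↦ Cot E x) x v hy

end SmoothFields

/-! ### Smooth forms, tested on fields with constant coordinates. -/

section SmoothForms

open Filter
open scoped Topology

variable {E : Type*} [NormedAddCommGroup E] [NormedSpace ℝ E]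
variable {M : Type*} [TopologicalSpace M] [ChartedSpace E M] [IsManifold 𝓘(ℝ, E) ∞ M]

/-- The tangent bundle is trivialized by chart derivatives. The coefficients of `chartForm` are
therefore the values of the form on these fields. -/
theorem constField_eq (x : M) (v : E) {y : E} (hy : y ∈ (extChartAt 𝓘(ℝ, E) x).target) :
    constField (E := E) x v ((extChartAt 𝓘(ℝ, E) x).symm y) =
      mfderiv 𝓘(ℝ, E) 𝓘(ℝ, E) (extChartAt 𝓘(ℝ, E) x).symm y v := by
  have h := TangentBundle.symmL_trivializationAt (I := 𝓘(ℝ, E)) (x₀ := x)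
    (x := (extChartAt 𝓘(ℝ, E) x).symm y)
    (by rw [← extChartAt_source 𝓘(ℝ, E)]; exact (extChartAt 𝓘(ℝ, E) x).map_target hy)
  rw [ModelWithCorners.range_eq_univ, mfderivWithin_univ,
    (extChartAt 𝓘(ℝ, E) x).right_inv hy] at h
  exact congrArg (fun L : E →L[ℝ] E ↦ L v) h

variable [FiniteDimensional ℝ E]

theorem differentiableAt_chartForm {k : ℕ} {θ : ∀ x : M, Alt E k x} {x : M}
    (h : ∀ v : Fin k → E, SmoothFunAt (E := E) (fun y ↦ θ y fun i ↦ constField (E := E) x (v i) y) x) :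
    DifferentiableAt ℝ (chartForm θ x) (extChartAt 𝓘(ℝ, E) x x) := by
  have key : ContMDiffAt 𝓘(ℝ, E) 𝓘(ℝ, E [⋀^Fin k]→L[ℝ] ℝ) ∞ (chartForm θ x)
      (extChartAt 𝓘(ℝ, E) x x) := by
    refine contMDiffAt_alternating_of_apply fun v ↦ ?_
    have hs : ContMDiffAt 𝓘(ℝ, E) 𝓘(ℝ, E) ∞ (extChartAt 𝓘(ℝ, E) x).symm
        (extChartAt 𝓘(ℝ, E) x x) :=
      (contMDiffOn_extChartAt_symm x).contMDiffAt (extChartAt_target_mem_nhds x)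
    have hv : ContMDiffAt 𝓘(ℝ, E) 𝓘(ℝ, ℝ) ∞
        (fun y ↦ θ y fun i ↦ constField (E := E) x (v i) y)
        ((extChartAt 𝓘(ℝ, E) x).symm (extChartAt 𝓘(ℝ, E) x x)) := by
      rw [extChartAt_to_inv]
      exact h v
    refine (hv.comp _ hs).congr_of_eventuallyEq ?_
    filter_upwards [extChartAt_target_mem_nhds (I := 𝓘(ℝ, E)) x] with y hy
    change θ ((extChartAt 𝓘(ℝ, E) x).symm y) (fun i ↦
      mfderiv 𝓘(ℝ, E) 𝓘(ℝ, E) (extChartAt 𝓘(ℝ, E) x).symm y (v i)) = _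
    refine congrArg _ (funext fun i ↦ ?_)
    exact (constField_eq x (v i) hy).symm
  exact key.contDiffAt.differentiableAt (by simp)

theorem SmoothCovectorAt.differentiableAt_chartForm {ξ : ∀ x : M, Cot E x} {x : M}
    (hξ : SmoothCovectorAt ξ x) :
    DifferentiableAt ℝ (chartForm (toOneForm ξ) x) (extChartAt 𝓘(ℝ, E) x x) :=
  GenPK.differentiableAt_chartForm fun v ↦
    hξ.apply (smoothVectorAt_constField x (v 0)).self_of_nhds

theorem contract₂_add {x : M} (b : Alt E 2 x) (X Y : Tan E x) :
    contract₂ b (X + Y) = contract₂ b X + contract₂ b Y := by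
  ext Z
  have h := b.map_update_add ![0, Z] 0 X Y
  have e (W : Tan E x) : Function.update ![0, Z] 0 W = ![W, Z] := by
    funext i
    fin_cases i <;> rfl
  rw [e, e, e] at h
  rw [add_apply, contract₂_apply, contract₂_apply, contract₂_apply]
  exact h

theorem contract₂_smul {x : M} (b : Alt E 2 x) (c : ℝ) (X : Tan E x) :
    contract₂ b (c • X) = c • contract₂ b X := by
  ext Z
  have h := b.map_update_smul ![0, Z] 0 c X
  have e (W : Tan E x) : Function.update ![0, Z] 0 W = ![W, Z] := by
    funext i
    fin_cases i <;> rfl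
  rw [e, e] at h
  rw [smul_apply, contract₂_apply, contract₂_apply]
  exact h

/-- A 2-form as a field of bilinear forms. -/
def bilinOfForm (b : ∀ x : M, Alt E 2 x) (x : M) : Tan E x →L[ℝ] Tan E x →L[ℝ] ℝ :=
  haveI : FiniteDimensional ℝ (Tan E x) := inferInstanceAs (FiniteDimensional ℝ E)
  haveI : T2Space (Tan E x) := inferInstanceAs (T2Space E)
  LinearMap.toContinuousLinearMap (E := Tan E x)
    { toFun := contract₂ (b x)
      map_add' := contract₂_add (b x)
      map_smul' := contract₂_smul (b x) }

/-- The values lie in a trivial line bundle, so the coordinates of a form only involve moving the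
arguments by the inverse trivialization of the tangent bundle. -/
theorem trivializationAt_alternating_apply {k : ℕ} (x y : M) (θ : Alt E k y) (v : Fin k → E) :
    (trivializationAt (E [⋀^Fin k]→L[ℝ] ℝ) (fun x : M ↦ Alt E k x) x ⟨y, θ⟩).2 v =
      θ fun i ↦ constField (E := E) x (v i) y := by
  change ContinuousAlternatingMap.inCoordinates (E₁ := fun x : M ↦ Tan E x)
    (E₂ := Bundle.Trivial M ℝ) E ℝ
    x y x y θ v = _
  simp only [ContinuousAlternatingMap.inCoordinates]
  change (Bundle.Trivialization.continuousLinearMapAt ℝ (Bundle.Trivial.trivialization M ℝ) y) _ = _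
  rw [Bundle.Trivial.continuousLinearMapAt_trivialization ℝ M ℝ]
  rfl

theorem smoothForm_two_of_apply {b : ∀ x : M, Alt E 2 x}
    (h : ∀ (x : M) (X Y : ∀ x : M, Tan E x), (∀ᶠ y in 𝓝 x, SmoothVectorAt X y) →
      (∀ᶠ y in 𝓝 x, SmoothVectorAt Y y) → SmoothFunAt (E := E) (fun y ↦ b y ![X y, Y y]) x) :
    SmoothForm b := by
  intro x
  rw [contMDiffAt_section]
  refine contMDiffAt_alternating_of_apply fun v ↦ ?_
  refine (h x _ _ (smoothVectorAt_constField x (v 0))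
    (smoothVectorAt_constField x (v 1))).congr_of_eventuallyEq (.of_forall fun y ↦ ?_)
  change _ = b y _
  refine (trivializationAt_alternating_apply x y (b y) v).trans (congrArg _ ?_)
  funext i
  fin_cases i <;> rfl

theorem SmoothForm.contract₂ {b : ∀ x : M, Alt E 2 x} (hb : SmoothForm b) {X : ∀ x : M, Tan E x}
    {x : M} (hX : SmoothVectorAt X x) : SmoothCovectorAt (fun y ↦ contract₂ (b y) (X y)) x := by
  suffices h : SmoothBilin (bilinOfForm b) from h.apply hX
  intro x
  refine contMDiffAt_hom_of_apply (E₁ := fun x : M ↦ Tan E x) (E₂ := fun x : M ↦ Cot E x) fun u ↦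
    contMDiffAt_hom_of_apply (E₁ := fun x : M ↦ Tan E x) (E₂ := Bundle.Trivial M ℝ) fun v ↦
    contMDiffAt_trivial_section.2 ?_
  have h := (contMDiffAt_section x).1 (hb x)
  have h' := (ContinuousAlternatingMap.apply ℝ E ℝ ![u, v]).contDiff.contMDiff.contMDiffAt.comp x h
  refine h'.congr_of_eventuallyEq (.of_forall fun y ↦ ?_)
  refine (contract₂_apply _ _ _).trans
    (Eq.trans (congrArg _ ?_) (trivializationAt_alternating_apply x y (b y) ![u, v]).symm)
  funext i
  fin_cases i <;> rfl

theorem SmoothForm.apply_two {b : ∀ x : M, Alt E 2 x} (hb : SmoothForm b)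
    {X Y : ∀ x : M, Tan E x} {x : M} (hX : SmoothVectorAt X x) (hY : SmoothVectorAt Y x) :
    SmoothFunAt (E := E) (fun y ↦ b y ![X y, Y y]) x := by
  have h := (hb.contract₂ hX).apply hY
  simpa only [contract₂_apply] using h

theorem differentiableAt_chartForm_two {b : ∀ x : M, Alt E 2 x} {x : M}
    (h : ∀ (X Y : ∀ x : M, Tan E x), (∀ᶠ y in 𝓝 x, SmoothVectorAt X y) →
      (∀ᶠ y in 𝓝 x, SmoothVectorAt Y y) → SmoothFunAt (E := E) (fun y ↦ b y ![X y, Y y]) x) :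
    DifferentiableAt ℝ (chartForm b x) (extChartAt 𝓘(ℝ, E) x x) := by
  refine differentiableAt_chartForm fun v ↦ ?_
  have := h _ _ (smoothVectorAt_constField x (v 0)) (smoothVectorAt_constField x (v 1))
  have e : (fun y ↦ b y fun i ↦ constField (E := E) x (v i) y) =
      fun y ↦ b y ![constField (E := E) x (v 0) y, constField (E := E) x (v 1) y] := by
    funext y
    congr 1
    funext i
    fin_cases i <;> rfl
  rw [e]
  exact this

end SmoothForms

/-! ### Formal identities between bracket, metric, Kähler form and Nijenhuis tensor. -/

section HermitianAlgebra

set_option linter.unusedSimpArgs false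

/-- The values at a point of the trilinear expressions attached to a pseudo-Hermitian structure
`(g, j)` and a 3-form `K`, for arguments in a set `V` of vector fields:
`δ X Y Z = X (g(Y, Z))` and `β X Y Z = g([X, Y], Z)`. -/
structure HermitianSymbols (V : Type*) where
  j : V → V
  δ : V → V → V → ℝ
  β : V → V → V → ℝ
  K : V → V → V → ℝ
  δ_symm : ∀ X Y Z, δ X Y Z = δ X Z Y
  δ_j : ∀ X Y Z, δ X (j Y) (j Z) = δ X Y Z
  δ_jj_left : ∀ X Y Z, δ (j (j X)) Y Z = -δ X Y Z
  δ_jj_mid : ∀ X Y Z, δ X (j (j Y)) Z = -δ X Y Z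
  β_skew : ∀ X Y Z, β X Y Z = -β Y X Z
  β_jj_left : ∀ X Y Z, β (j (j X)) Y Z = -β X Y Z
  β_jj_right : ∀ X Y Z, β X Y (j (j Z)) = -β X Y Z
  K_skew₁₂ : ∀ X Y Z, K X Y Z = -K Y X Z
  K_skew₂₃ : ∀ X Y Z, K X Y Z = -K X Z Y
  K_jj : ∀ X Y Z, K (j (j X)) Y Z = -K X Y Z

namespace HermitianSymbols

variable {V : Type*} (D : HermitianSymbols V)

/-- Differentiated form of `g(JY, Z) = -g(Y, JZ)`. -/
theorem δ_j_mid (X Y Z : V) : D.δ X (D.j Y) Z = -D.δ X Y (D.j Z) := by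
  rw [← D.δ_j X Y (D.j Z), D.δ_symm X (D.j Y) (D.j (D.j Z)), D.δ_jj_mid, neg_neg,
    D.δ_symm X Z (D.j Y)]

theorem δ_jj_right (X Y Z : V) : D.δ X Y (D.j (D.j Z)) = -D.δ X Y Z := by
  rw [D.δ_symm, D.δ_jj_mid, D.δ_symm]

theorem β_jj_mid (X Y Z : V) : D.β X (D.j (D.j Y)) Z = -D.β X Y Z := by
  rw [D.β_skew, D.β_jj_left, D.β_skew Y, neg_neg]

theorem K_jj_mid (X Y Z : V) : D.K X (D.j (D.j Y)) Z = -D.K X Y Z := by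
  rw [D.K_skew₁₂, D.K_jj, D.K_skew₁₂ Y, neg_neg]

theorem K_jj_right (X Y Z : V) : D.K X Y (D.j (D.j Z)) = -D.K X Y Z := by
  rw [D.K_skew₂₃, D.K_jj_mid, D.K_skew₂₃ X Z, neg_neg]

theorem δ_j_right (X Y Z : V) : D.δ X Y (D.j Z) = -D.δ X Z (D.j Y) := by
  rw [D.δ_symm, D.δ_j_mid]

/-- Twice the pairing of the twisted Courant bracket of the lifts of `X` and `Y` to the graphs
with signs `σ` and `τ` with the lift of `Z` to the graph with sign `ρ`. -/
def T (σ τ ρ : ℝ) (X Y Z : V) : ℝ :=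
  D.K X Y Z - ρ * D.β X Y Z - τ * (D.δ X Y Z - D.β X Z Y) + σ * (D.δ Y X Z - D.β Y Z X)
    + (τ - σ) / 2 * D.δ Z X Y

theorem T_skew (σ τ ρ : ℝ) (X Y Z : V) : D.T σ τ ρ X Y Z = -D.T τ σ ρ Y X Z := by
  simp only [T, D.K_skew₁₂ Y X, D.β_skew Y X, D.δ_symm Z Y X]
  ring

theorem T_jj_left (σ τ ρ : ℝ) (X Y Z : V) : D.T σ τ ρ (D.j (D.j X)) Y Z = -D.T σ τ ρ X Y Z := by
  simp only [T, D.K_jj, D.β_jj_left, D.β_jj_right, D.δ_jj_left, D.δ_jj_mid, D.δ_jj_right]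
  ring

/-- Invariance of the pairing under the Courant bracket: up to a derivative of pairings, `⟨[A, B],
C⟩ = -⟨B, [A, C]⟩`. Graphs of opposite signs are orthogonal, so only the derivative along `Y` of the
pairing of the lifts of `X` and `Z` survives, and that pairing is a multiple of `g(X, Z)`. -/
theorem T_mixed (σ : ℝ) (X Y Z : V) :
    D.T σ (-σ) σ X Y Z = -D.T σ σ (-σ) X Z Y + σ * D.δ Y X Z := by
  simp only [T, D.K_skew₂₃ X Z Y, D.β_skew Z Y, D.δ_symm X Z Y, D.δ_symm Z X Y]
  ring

/-- The covariant derivative `(∇_Z g)(jX, Y) - g(j ∇_Z X, Y)` of the Kähler form. -/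
def S (Z X Y : V) : ℝ :=
  1 / 2 * (D.δ (D.j X) Z Y - D.δ Y Z (D.j X) + D.β Z (D.j X) Y - D.β Z Y (D.j X)
      - D.β (D.j X) Y Z
    + D.δ X Z (D.j Y) - D.δ (D.j Y) Z X + D.β Z X (D.j Y) - D.β Z (D.j Y) X
      - D.β X (D.j Y) Z)

/-- The exterior derivative of the Kähler form. -/
def dF (X Y Z : V) : ℝ :=
  D.δ X (D.j Y) Z - D.δ Y (D.j X) Z + D.δ Z (D.j X) Y + D.β X Y (D.j Z) - D.β X Z (D.j Y)
    + D.β Y Z (D.j X)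

/-- The Nijenhuis tensor of `j`. -/
def n (X Y Z : V) : ℝ :=
  D.β (D.j X) (D.j Y) Z + D.β (D.j X) Y (D.j Z) + D.β X (D.j Y) (D.j Z) - D.β X Y Z

/-- The body of `S` adds the Koszul expressions for `g(∇_Z (jX), Y)` and `g(∇_Z X, jY)`. Their
derivatives along `Z` cancel by `δ_j_mid`. The result is `(∇_Z F)(X, Y)`, which is skew like `F`. -/
theorem S_skew (X Y Z : V) : D.S Z X Y = -D.S Z Y X := by
  simp only [S, D.β_skew (D.j Y) X, D.β_skew Y]
  ring

/-- Differentiating `j² = -1` shows that `∇_Z j` anticommutes with `j`, so `∇_Z F` has type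
(2,0)+(0,2). -/
theorem S_j (X Y Z : V) : D.S Z (D.j X) Y = D.S Z X (D.j Y) := by
  simp only [S, D.β_jj_left, D.β_jj_mid, D.β_jj_right, D.δ_jj_left, D.δ_jj_right]
  ring

theorem S_jj_right (X Y Z : V) : D.S Z X (D.j (D.j Y)) = -D.S Z X Y := by
  simp only [S, D.δ_j_mid, D.β_jj_mid, D.β_jj_right, D.δ_jj_left, D.δ_jj_right]
  ring

/-- For a torsion-free connection, `dF` is the cyclic sum of `∇F`. -/
theorem dF_eq (X Y Z : V) : D.dF X Y Z = D.S X Y Z + D.S Y Z X + D.S Z X Y := by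
  -- The symmetry rules are instantiated at particular letters so that they are directed: they sort
  -- arguments by letter and leave an identity for `ring`. The same list serves the other expansions
  -- below.
  simp only [dF, S, D.δ_j_mid, D.β_jj_left, D.β_jj_mid, D.β_jj_right, D.δ_jj_left, D.δ_jj_right,
    D.δ_jj_mid, D.δ_symm _ Y X, D.δ_symm _ Z X, D.δ_symm _ Z Y, D.δ_j_right _ Y X, D.δ_j_right _
    Z X, D.δ_j_right _ Z Y, D.β_skew Y X, D.β_skew Y (D.j X), D.β_skew (D.j Y) X, D.β_skew (D.j
    Y) (D.j X), D.β_skew Z X, D.β_skew Z (D.j X), D.β_skew (D.j Z) X, D.β_skew (D.j Z) (D.j X),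
    D.β_skew Z Y, D.β_skew Z (D.j Y), D.β_skew (D.j Z) Y, D.β_skew (D.j Z) (D.j Y)]
  ring

/-- Writing brackets as differences of covariant derivatives gives `N(X, Y) = (∇_{jX} j)Y - (∇_{jY}
j)X - j(∇_X j)Y + j(∇_Y j)X`, paired here with `Z`. -/
theorem n_eq (X Y Z : V) : D.n X Y Z =
    D.S (D.j X) Y Z - D.S (D.j Y) X Z - D.S Y X (D.j Z) + D.S X Y (D.j Z) := by
  simp only [n, S, D.δ_j_mid, D.β_jj_left, D.β_jj_mid, D.β_jj_right, D.δ_jj_left, D.δ_jj_right,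
    D.δ_jj_mid, D.δ_symm _ Y X, D.δ_symm _ Z X, D.δ_symm _ Z Y, D.δ_j_right _ Y X, D.δ_j_right _
    Z X, D.δ_j_right _ Z Y, D.β_skew Y X, D.β_skew Y (D.j X), D.β_skew (D.j Y) X, D.β_skew (D.j
    Y) (D.j X), D.β_skew Z X, D.β_skew Z (D.j X), D.β_skew (D.j Z) X, D.β_skew (D.j Z) (D.j X),
    D.β_skew Z Y, D.β_skew Z (D.j Y), D.β_skew (D.j Z) Y, D.β_skew (D.j Z) (D.j Y)]
  ring

theorem two_mul_S (X Y Z : V) :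
    2 * D.S Z X Y = D.dF Z X Y - D.dF Z (D.j X) (D.j Y) + D.n X Y (D.j Z) := by
  rw [dF_eq, dF_eq, n_eq, S_jj_right, S_jj_right, S_j, S_jj_right, S_j, D.S_skew Z (D.j X), S_j,
    D.S_skew Z X]
  ring

/-- By the Koszul formula, `T σ σ (-σ) X Y Z = K(X, Y, Z) - σ (g(∇_Z X, Y) - g(X, ∇_Z Y))`. In the
combination on the left the covariant derivatives assemble into `∇_Z F`. -/
theorem T_j_add (σ : ℝ) (X Y Z : V) : D.T σ σ (-σ) (D.j X) Y Z + D.T σ σ (-σ) X (D.j Y) Z =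
    D.K (D.j X) Y Z + D.K X (D.j Y) Z - 2 * σ * D.S Z X Y := by
  simp only [T, S, D.δ_j_mid, D.β_jj_left, D.β_jj_mid, D.β_jj_right, D.δ_jj_left, D.δ_jj_right,
    D.δ_jj_mid, D.δ_symm _ Y X, D.δ_symm _ Z X, D.δ_symm _ Z Y, D.δ_j_right _ Y X, D.δ_j_right _
    Z X, D.δ_j_right _ Z Y, D.β_skew Y X, D.β_skew Y (D.j X), D.β_skew (D.j Y) X, D.β_skew (D.j
    Y) (D.j X), D.β_skew Z X, D.β_skew Z (D.j X), D.β_skew (D.j Z) X, D.β_skew (D.j Z) (D.j X),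
    D.β_skew Z Y, D.β_skew Z (D.j Y), D.β_skew (D.j Z) Y, D.β_skew (D.j Z) (D.j Y)]
  ring

/-- The component of the Nijenhuis tensor of a generalized complex structure on lifts to the same
graph. -/
def N (σ : ℝ) (X Y Z : V) : ℝ :=
  D.T σ σ σ (D.j X) (D.j Y) Z + D.T σ σ σ (D.j X) Y (D.j Z) + D.T σ σ σ X (D.j Y) (D.j Z)
    - D.T σ σ σ X Y Z

/-- The terms in `K` are, up to a factor, its (3,0)+(0,3) part. All remaining derivatives collect
into values of `∇F`. -/
theorem N_eq (σ : ℝ) (X Y Z : V) : D.N σ X Y Z =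
    D.K (D.j X) (D.j Y) Z + D.K (D.j X) Y (D.j Z) + D.K X (D.j Y) (D.j Z) - D.K X Y Z
      - 2 * σ * (D.S (D.j X) Y Z + D.S X (D.j Y) Z + D.S (D.j Y) Z X + D.S Y (D.j Z) X
        + D.S (D.j Z) X Y + D.S Z (D.j X) Y) := by
  simp only [N, T, S, D.δ_j_mid, D.β_jj_left, D.β_jj_mid, D.β_jj_right, D.δ_jj_left, D.δ_jj_right,
    D.δ_jj_mid, D.δ_symm _ Y X, D.δ_symm _ Z X, D.δ_symm _ Z Y, D.δ_j_right _ Y X, D.δ_j_right _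
    Z X, D.δ_j_right _ Z Y, D.β_skew Y X, D.β_skew Y (D.j X), D.β_skew (D.j Y) X, D.β_skew (D.j
    Y) (D.j X), D.β_skew Z X, D.β_skew Z (D.j X), D.β_skew (D.j Z) X, D.β_skew (D.j Z) (D.j X),
    D.β_skew Z Y, D.β_skew Z (D.j Y), D.β_skew (D.j Z) Y, D.β_skew (D.j Z) (D.j Y)]
  ring

theorem K_cycle (X Y Z : V) : D.K Y Z X = D.K X Y Z := by
  rw [D.K_skew₂₃, D.K_skew₁₂, neg_neg]

/-- Replacing `X` by `jX` in the hypothesis makes the left side of `T_j_add` vanish. -/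
theorem two_mul_S_of_T {σ : ℝ} (h : ∀ X Y Z, D.T σ σ (-σ) (D.j X) (D.j Y) Z = D.T σ σ (-σ) X Y Z)
    (X Y Z : V) : 2 * σ * D.S Z X Y = D.K (D.j X) Y Z + D.K X (D.j Y) Z := by
  linear_combination h (D.j X) Y Z - D.T_jj_left σ σ (-σ) X (D.j Y) Z + D.T_j_add σ X Y Z

theorem T_of_two_mul_S {σ : ℝ}
    (h : ∀ X Y Z, 2 * σ * D.S Z X Y = D.K (D.j X) Y Z + D.K X (D.j Y) Z) (X Y Z : V) :
    D.T σ σ (-σ) (D.j X) Y Z + D.T σ σ (-σ) X (D.j Y) Z = 0 := by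
  rw [T_j_add, h, sub_self]

/-- The right side is invariant under cyclic permutation. Hence the three pairs of `S`-terms in
`N_eq` all have the same value `P`, which is also the `K`-part there, and `N = P - 3P = -2P`. -/
theorem sum_S_of_two_mul_S {σ : ℝ}
    (h : ∀ X Y Z, 2 * σ * D.S Z X Y = D.K (D.j X) Y Z + D.K X (D.j Y) Z) (X Y Z : V) :
    2 * σ * (D.S (D.j X) Y Z + D.S X (D.j Y) Z) = D.K (D.j X) (D.j Y) Z
      + D.K (D.j X) Y (D.j Z) + D.K X (D.j Y) (D.j Z) - D.K X Y Z := by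
  rw [mul_add, h, h, K_jj]
  linear_combination D.K_cycle (D.j X) (D.j Y) Z + D.K_cycle (D.j X) Y (D.j Z)
    + D.K_cycle X (D.j Y) (D.j Z) - D.K_cycle X Y Z

theorem dF_of_two_mul_S {σ : ℝ} (hσ : σ * σ = 1)
    (h : ∀ X Y Z, 2 * σ * D.S Z X Y = D.K (D.j X) Y Z + D.K X (D.j Y) Z) (X Y Z : V) :
    D.dF X Y Z = σ * (D.K (D.j X) Y Z + D.K X (D.j Y) Z + D.K X Y (D.j Z)) := by
  have e : D.dF X Y Z = σ * (σ * D.dF X Y Z) := by rw [← mul_assoc, hσ, one_mul]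
  rw [e]
  congr 1
  rw [dF_eq]
  have h1 := h Y Z X
  have h2 := h Z X Y
  have h3 := h X Y Z
  rw [D.K_cycle X (D.j Y), D.K_cycle X Y] at h1
  rw [← D.K_cycle (D.j Z) X, ← D.K_cycle Z (D.j X)] at h2
  linear_combination (h1 + h2 + h3) / 2

/-- The integrability conditions for lifts imply that `j` is integrable and `-dF(j·, j·, j·) = σ K`. -/
theorem integrable_of_T_of_N {σ : ℝ} (hσ : σ * σ = 1)
    (hT : ∀ X Y Z, D.T σ σ (-σ) (D.j X) (D.j Y) Z = D.T σ σ (-σ) X Y Z)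
    (hN : ∀ X Y Z, D.N σ X Y Z = 0) (X Y Z : V) :
    D.n X Y Z = 0 ∧ -D.dF (D.j X) (D.j Y) (D.j Z) = σ * D.K X Y Z := by
  have h := D.two_mul_S_of_T hT
  have h1 := D.sum_S_of_two_mul_S h X Y Z
  have h2 := D.sum_S_of_two_mul_S h Y Z X
  have h3 := D.sum_S_of_two_mul_S h Z X Y
  have h4 := hN X Y Z
  rw [N_eq] at h4
  -- `N = -2P` with `P` the left side, whence the factor `-1/2`. Thus `K` has type (2,1)+(1,2).
  have h5 : D.K (D.j X) (D.j Y) Z + D.K (D.j X) Y (D.j Z) + D.K X (D.j Y) (D.j Z)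
      - D.K X Y Z = 0 := by
    linear_combination -1 / 2 * (h4 + h1 + h2 + h3 + D.K_cycle (D.j X) (D.j Y) Z
      + D.K_cycle (D.j X) Y (D.j Z) + D.K_cycle X (D.j Y) (D.j Z) - D.K_cycle X Y Z
      - D.K_cycle (D.j Z) (D.j X) Y - D.K_cycle (D.j Z) X (D.j Y) - D.K_cycle Z (D.j X) (D.j Y)
      + D.K_cycle Z X Y)
  refine ⟨?_, ?_⟩
  -- Substituting the formula for `∇F` into `n_eq` leaves a multiple of the expression that vanishes
  -- by `h5`.
  · have h6 : σ * (2 * D.n X Y Z) = 0 := by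
      rw [n_eq]
      linear_combination h Y Z (D.j X) - h X Z (D.j Y) - h X (D.j Z) Y + h Y (D.j Z) X + 2 * h5
        - D.K_jj_mid X Z Y + D.K_skew₂₃ X Z Y + D.K_cycle (D.j X) (D.j Y) Z
        + D.K_cycle (D.j X) Y (D.j Z) + D.K_cycle X (D.j Y) (D.j Z)
        + D.K_cycle X Y (D.j (D.j Z)) + D.K_jj_right X Y Z
        - D.K_skew₂₃ (D.j X) Z (D.j Y) - D.K_skew₂₃ X (D.j Z) (D.j Y)
        - D.K_skew₂₃ (D.j X) (D.j Z) Y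
    have h7 : D.n X Y Z = σ * (σ * (2 * D.n X Y Z)) / 2 := by
      rw [← mul_assoc, hσ]
      ring
    rw [h7, h6]
    simp
  · rw [dF_of_two_mul_S D hσ h, K_jj, K_jj_mid, K_jj_right]
    linear_combination σ * h5

theorem dF_neg (X Y Z : V) : D.dF (D.j (D.j X)) (D.j (D.j Y)) (D.j (D.j Z)) = -D.dF X Y Z := by
  simp only [dF, D.β_jj_left, D.β_jj_mid, D.β_jj_right, D.δ_jj_left, D.δ_jj_mid, D.δ_jj_right]
  ring

/-- If `j` is integrable and `-dF(j·, j·, j·) = σ K`, the integrability conditions for lifts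
hold. -/
theorem T_and_N_of_integrable {σ : ℝ} (hσ : σ * σ = 1) (hn : ∀ X Y Z, D.n X Y Z = 0)
    (hF : ∀ X Y Z, -D.dF (D.j X) (D.j Y) (D.j Z) = σ * D.K X Y Z) :
    (∀ X Y Z, D.T σ σ (-σ) (D.j X) Y Z + D.T σ σ (-σ) X (D.j Y) Z = 0) ∧
      ∀ X Y Z, D.N σ X Y Z = 0 := by
  have hF' (X Y Z : V) : D.dF X Y Z = σ * D.K (D.j X) (D.j Y) (D.j Z) := by
    rw [← hF, dF_neg, neg_neg]
  have hS (X Y Z : V) : 2 * D.S Z X Y = D.dF Z X Y - D.dF Z (D.j X) (D.j Y) := by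
    rw [two_mul_S, hn, add_zero]
  -- The cyclic sum of `hS` is `2 dF` on the left, hence `dF` equals the cyclic sum of `dF(Z, jX,
  -- jY)`: the Kähler form of an integrable `j` has no (3,0)+(0,3) derivative. Read through `hF'`,
  -- this is a condition on `K`; the final multiplication by `σ` cancels the sign.
  have hK (X Y Z : V) : D.K (D.j X) (D.j Y) (D.j Z) =
      D.K (D.j X) Y Z + D.K X (D.j Y) Z + D.K X Y (D.j Z) := by
    have h1 := hS X Y Z
    have h2 := hS Y Z X
    have h3 := hS Z X Y
    have h4 := D.dF_eq X Y Z
    rw [hF', hF', K_jj_mid, K_jj_right, neg_neg] at h1 h2 h3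
    rw [hF'] at h4
    have h5 := congrArg (σ * ·) (show σ * D.K (D.j X) (D.j Y) (D.j Z) =
      σ * (D.K (D.j X) Y Z + D.K X (D.j Y) Z + D.K X Y (D.j Z)) by
        linear_combination -2 * h4 - h1 - h2 - h3 + σ * (D.K_cycle (D.j Z) (D.j X) (D.j Y)
          - D.K_cycle (D.j X) (D.j Y) (D.j Z) - D.K_cycle (D.j Z) X Y + D.K_cycle X (D.j Y) Z))
    simpa only [← mul_assoc, hσ, one_mul] using h5
  -- By `hS` and `hF'`, `2σ S` is `K(jX, jY, jZ) - K(X, Y, jZ)`; `hK` rewrites the first term.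
  have h (X Y Z : V) : 2 * σ * D.S Z X Y = D.K (D.j X) Y Z + D.K X (D.j Y) Z := by
    have h1 := hS X Y Z
    rw [hF', hF', K_jj_mid, K_jj_right, neg_neg] at h1
    linear_combination σ * h1 + hσ * (D.K (D.j X) (D.j Y) (D.j Z) - D.K X Y (D.j Z)) + hK X Y Z
      + σ * σ * (-D.K_cycle (D.j Z) (D.j X) (D.j Y) + D.K_cycle (D.j Z) X Y)
  refine ⟨D.T_of_two_mul_S h, fun X Y Z ↦ ?_⟩
  have h1 := D.sum_S_of_two_mul_S h X Y Z
  have h2 := D.sum_S_of_two_mul_S h Y Z X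
  have h3 := D.sum_S_of_two_mul_S h Z X Y
  have h5 : D.K (D.j X) (D.j Y) Z + D.K (D.j X) Y (D.j Z) + D.K X (D.j Y) (D.j Z)
      - D.K X Y Z = 0 := by
    have h4 := hK (D.j X) (D.j Y) (D.j Z)
    simp only [K_jj, K_jj_mid, K_jj_right] at h4
    linear_combination h4
  rw [N_eq]
  linear_combination -2 * h5 - h1 - h2 - h3 - (D.K_cycle (D.j X) (D.j Y) Z
      + D.K_cycle (D.j X) Y (D.j Z) + D.K_cycle X (D.j Y) (D.j Z) - D.K_cycle X Y Z
      - D.K_cycle (D.j Z) (D.j X) Y - D.K_cycle (D.j Z) X (D.j Y) - D.K_cycle Z (D.j X) (D.j Y)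
      + D.K_cycle Z X Y)

end HermitianSymbols

end HermitianAlgebra

/-! ### Locality, skewness and additivity of the twisted Courant bracket. -/

section CourantCalculus

open Filter VectorField
open scoped Topology

variable {E : Type*} [NormedAddCommGroup E] [NormedSpace ℝ E]
variable {M : Type*} [TopologicalSpace M] [ChartedSpace E M] [IsManifold 𝓘(ℝ, E) ∞ M]

theorem dFun_add {f h : M → ℝ} {x : M} (hf : SmoothFunAt (E := E) f x)
    (hh : SmoothFunAt (E := E) h x) (v : Tan E x) :
    dFun (fun y ↦ f y + h y) x v = dFun f x v + dFun h x v :=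
  congrArg (fun L : E →L[ℝ] ℝ ↦ L v) (mfderiv_add hf.mdifferentiableAt hh.mdifferentiableAt)

theorem dFun_sub {f h : M → ℝ} {x : M} (hf : SmoothFunAt (E := E) f x)
    (hh : SmoothFunAt (E := E) h x) (v : Tan E x) :
    dFun (fun y ↦ f y - h y) x v = dFun f x v - dFun h x v :=
  congrArg (fun L : E →L[ℝ] ℝ ↦ L v) (mfderiv_sub hf.mdifferentiableAt hh.mdifferentiableAt)

theorem dFun_const_mul {f : M → ℝ} {x : M} (hf : SmoothFunAt (E := E) f x) (c : ℝ)
    (v : Tan E x) : dFun (fun y ↦ c * f y) x v = c * dFun f x v :=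
  congrArg (fun L : E →L[ℝ] ℝ ↦ L v) (const_smul_mfderiv hf.mdifferentiableAt c)

theorem dFun_neg (f : M → ℝ) (x : M) (v : Tan E x) :
    dFun (fun y ↦ -f y) x v = -dFun f x v :=
  congrArg (fun L : E →L[ℝ] ℝ ↦ L v) (mfderiv_neg (f := f) (x := x))

theorem dFun_congr {f h : M → ℝ} {x : M} (e : ∀ᶠ y in 𝓝 x, f y = h y) :
    dFun (E := E) f x = dFun h x := Filter.EventuallyEq.mfderiv_eq e

section Bracket

variable [CompleteSpace E]

theorem lieBracket_add_left {X X' : ∀ x : M, Tan E x} (Y : ∀ x : M, Tan E x) {x : M}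
    (hX : SmoothVectorAt X x) (hX' : SmoothVectorAt X' x) :
    mlieBracket 𝓘(ℝ, E) (fun y ↦ X y + X' y) Y x
      = mlieBracket 𝓘(ℝ, E) X Y x + mlieBracket 𝓘(ℝ, E) X' Y x :=
  mlieBracket_add_left hX.mdifferentiableAt hX'.mdifferentiableAt

theorem lieBracket_neg_left {X : ∀ x : M, Tan E x} (Y : ∀ x : M, Tan E x) {x : M}
    (hX : SmoothVectorAt X x) :
    mlieBracket 𝓘(ℝ, E) (fun y ↦ -X y) Y x = -mlieBracket 𝓘(ℝ, E) X Y x := by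
  have h := mlieBracket_const_smul_left (I := 𝓘(ℝ, E)) (W := Y) (c := (-1 : ℝ))
    hX.mdifferentiableAt
  refine Eq.trans (congrArg (fun X ↦ mlieBracket 𝓘(ℝ, E) X Y x) (funext fun y ↦ ?_))
    (h.trans (neg_one_smul ℝ (mlieBracket 𝓘(ℝ, E) X Y x : E)))
  exact (neg_one_smul ℝ (X y : E)).symm

end Bracket

variable [FiniteDimensional ℝ E]

/-- In `i_X dη + d(η(X))` evaluated on `Z`, the derivatives of `η(X)` along `Z` cancel. -/
theorem lieOneForm_apply {X Z : ∀ x : M, Tan E x} {η : ∀ x : M, Cot E x} {x : M}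
    (hX : SmoothVectorAt X x) (hη : SmoothCovectorAt η x) (hZ : SmoothVectorAt Z x) :
    lieOneForm X η x (Z x) =
      dFun (fun y ↦ η y (Z y)) x (X x) - η x (mlieBracket 𝓘(ℝ, E) X Z x) := by
  haveI : CompleteSpace E := FiniteDimensional.complete ℝ E
  rw [lieOneForm, add_apply, contract₂_apply,
    extD_toOneForm_apply hη.differentiableAt_chartForm hX.mdifferentiableAt hZ.mdifferentiableAt]
  ring

theorem courant_snd_apply (H : ∀ x : M, Alt E 3 x) {A B : ∀ x : M, GTan E x}
    {Z : ∀ x : M, Tan E x} {x : M} (hA : SmoothGenAt A x) (hB : SmoothGenAt B x)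
    (hZ : SmoothVectorAt Z x) :
    (courant H A B x).2 (Z x) =
      dFun (fun y ↦ (B y).2 (Z y)) x (A x).1
        - (B x).2 (mlieBracket 𝓘(ℝ, E) (fun y ↦ (A y).1) Z x)
        - (dFun (fun y ↦ (A y).2 (Z y)) x (B x).1
          - (A x).2 (mlieBracket 𝓘(ℝ, E) (fun y ↦ (B y).1) Z x))
        - 1 / 2 * (dFun (fun y ↦ (B y).2 (A y).1) x (Z x)
          - dFun (fun y ↦ (A y).2 (B y).1) x (Z x))
        + H x ![(A x).1, (B x).1, Z x] := by
  rw [courant, add_apply, sub_apply, sub_apply, lieOneForm_apply hA.1 hB.2 hZ,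
    lieOneForm_apply hB.1 hA.2 hZ, contract₃_apply, smul_apply, sub_apply, smul_eq_mul]

/-- The bracket depends only on germs. This is needed because the eigenbundle condition gives
equalities of sections only on an open set. -/
theorem courant_congr (H : ∀ x : M, Alt E 3 x) {A A' B B' : ∀ x : M, GTan E x} {x : M}
    (hA : ∀ᶠ y in 𝓝 x, A y = A' y) (hB : ∀ᶠ y in 𝓝 x, B y = B' y) :
    courant H A B x = courant H A' B' x := by
  have lie {X X' : ∀ x : M, Tan E x} {η η' : ∀ x : M, Cot E x}
      (hX : ∀ᶠ y in 𝓝 x, X y = X' y) (hη : ∀ᶠ y in 𝓝 x, η y = η' y) :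
      lieOneForm X η x = lieOneForm X' η' x := by
    rw [lieOneForm, lieOneForm, extD_congr (θ' := toOneForm η')
      (by filter_upwards [hη] with y hy; rw [toOneForm, hy, toOneForm]),
      dFun_congr (h := fun y ↦ η' y (X' y)) (by filter_upwards [hX, hη] with y h1 h2; rw [h1, h2]),
      hX.self_of_nhds]
  have hA1 : ∀ᶠ y in 𝓝 x, (A y).1 = (A' y).1 := hA.mono fun y h ↦ by rw [h]
  have hA2 : ∀ᶠ y in 𝓝 x, (A y).2 = (A' y).2 := hA.mono fun y h ↦ by rw [h]
  have hB1 : ∀ᶠ y in 𝓝 x, (B y).1 = (B' y).1 := hB.mono fun y h ↦ by rw [h]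
  have hB2 : ∀ᶠ y in 𝓝 x, (B y).2 = (B' y).2 := hB.mono fun y h ↦ by rw [h]
  have e1 : dFun (E := E) (fun y ↦ (B y).2 (A y).1) x = dFun (fun y ↦ (B' y).2 (A' y).1) x :=
    dFun_congr (by filter_upwards [hA, hB] with y h1 h2; rw [h1, h2])
  have e2 : dFun (E := E) (fun y ↦ (A y).2 (B y).1) x = dFun (fun y ↦ (A' y).2 (B' y).1) x :=
    dFun_congr (by filter_upwards [hA, hB] with y h1 h2; rw [h1, h2])
  have e3 := Filter.EventuallyEq.mlieBracket_vectorField_eq (I := 𝓘(ℝ, E)) (V₁ := fun y ↦ (A y).1)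
    (V := fun y ↦ (A' y).1) (W₁ := fun y ↦ (B y).1) (W := fun y ↦ (B' y).1) hA1 hB1
  rw [courant, courant, lie hA1 hB2, lie hB1 hA2, e1, e2, e3, hA1.self_of_nhds, hB1.self_of_nhds]

theorem alternating_swap₁₂ {V : Type*} [AddCommGroup V] [Module ℝ V] [TopologicalSpace V]
    (K : V [⋀^Fin 3]→L[ℝ] ℝ) (X Y Z : V) : K ![X, Y, Z] = -K ![Y, X, Z] := by
  refine Eq.trans (congrArg K (funext fun i ↦ ?_))
    (K.toAlternatingMap.map_swap ![Y, X, Z] (show (0 : Fin 3) ≠ 1 by decide))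
  fin_cases i <;> rfl

theorem alternating_swap₂₃ {V : Type*} [AddCommGroup V] [Module ℝ V] [TopologicalSpace V]
    (K : V [⋀^Fin 3]→L[ℝ] ℝ) (X Y Z : V) : K ![X, Y, Z] = -K ![X, Z, Y] := by
  refine Eq.trans (congrArg K (funext fun i ↦ ?_))
    (K.toAlternatingMap.map_swap ![X, Z, Y] (show (1 : Fin 3) ≠ 2 by decide))
  fin_cases i <;> rfl

theorem alternating_swap {V : Type*} [AddCommGroup V] [Module ℝ V] [TopologicalSpace V]
    (θ : V [⋀^Fin 2]→L[ℝ] ℝ) (X Y : V) : θ ![X, Y] = -θ ![Y, X] := by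
  refine Eq.trans (congrArg θ (funext fun i ↦ ?_))
    (θ.toAlternatingMap.map_swap ![Y, X] (show (0 : Fin 2) ≠ 1 by decide))
  fin_cases i <;> rfl

theorem alternating_add_left {V : Type*} [AddCommGroup V] [Module ℝ V] [TopologicalSpace V]
    (K : V [⋀^Fin 3]→L[ℝ] ℝ) (X X' Y Z : V) :
    K ![X + X', Y, Z] = K ![X, Y, Z] + K ![X', Y, Z] :=
  K.vecCons_add ![Y, Z] X X'

theorem alternating_neg_left {V : Type*} [AddCommGroup V] [Module ℝ V] [TopologicalSpace V]
    (K : V [⋀^Fin 3]→L[ℝ] ℝ) (X Y Z : V) : K ![-X, Y, Z] = -K ![X, Y, Z] := by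
  simpa using K.vecCons_smul ![Y, Z] (-1) X

theorem courant_swap (H : ∀ x : M, Alt E 3 x) {A B : ∀ x : M, GTan E x} (x : M) :
    courant H A B x = -courant H B A x := by
  refine Prod.ext mlieBracket_swap_apply ?_
  have h : contract₃ (H x) (A x).1 (B x).1 = -contract₃ (H x) (B x).1 (A x).1 := by
    ext Z
    rw [neg_apply, contract₃_apply, contract₃_apply, alternating_swap₁₂]
  change _ = -(_ : Cot E x)
  simp only [courant]
  rw [h]
  module

theorem SmoothGenAt.add {A B : ∀ x : M, GTan E x} {x : M} (hA : SmoothGenAt A x)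
    (hB : SmoothGenAt B x) : SmoothGenAt (fun y ↦ A y + B y) x :=
  ⟨hA.1.add hB.1, hA.2.add hB.2⟩

theorem SmoothGenAt.neg {A : ∀ x : M, GTan E x} {x : M} (hA : SmoothGenAt A x) :
    SmoothGenAt (fun y ↦ -A y) x := ⟨hA.1.neg, hA.2.neg⟩

theorem courant_add_left (H : ∀ x : M, Alt E 3 x) {A A' B : ∀ x : M, GTan E x} {x : M}
    (hA : SmoothGenAt A x) (hA' : SmoothGenAt A' x) (hB : SmoothGenAt B x) :
    courant H (fun y ↦ A y + A' y) B x = courant H A B x + courant H A' B x := by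
  haveI : CompleteSpace E := FiniteDimensional.complete ℝ E
  refine Prod.ext (lieBracket_add_left _ hA.1 hA'.1) (ContinuousLinearMap.ext fun v ↦ ?_)
  -- The formula for the covector part differentiates functions involving the test field, so the
  -- test vector must be extended to a field.
  obtain ⟨Z, hZ, rfl⟩ := exists_smoothVector_extension x v
  have hZ := hZ.self_of_nhds
  rw [Prod.snd_add, add_apply, courant_snd_apply H (hA.add hA') hB hZ,
    courant_snd_apply H hA hB hZ, courant_snd_apply H hA' hB hZ]
  have e1 : dFun (fun y ↦ (A y + A' y).2 (Z y)) x (B x).1 = _ :=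
    dFun_add (hA.2.apply hZ) (hA'.2.apply hZ) _
  have e2 : dFun (fun y ↦ (A y + A' y).2 (B y).1) x (Z x) = _ :=
    dFun_add (hA.2.apply hB.1) (hA'.2.apply hB.1) _
  have e3 : dFun (fun y ↦ (B y).2 (A y + A' y).1) x (Z x) = _ :=
    (congrArg (fun f ↦ dFun f x (Z x)) (funext fun y ↦ map_add (B y).2 _ _)).trans
      (dFun_add (hB.2.apply hA.1) (hB.2.apply hA'.1) _)
  have e4 : mlieBracket 𝓘(ℝ, E) (fun y ↦ (A y + A' y).1) Z x = _ :=
    lieBracket_add_left Z hA.1 hA'.1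
  have e5 := alternating_add_left (H x) (A x).1 (A' x).1 (B x).1 (Z x)
  rw [e1, e2, e3, e4, Prod.fst_add, Prod.snd_add, e5, add_apply, map_add, map_add]
  ring

theorem courant_neg_left (H : ∀ x : M, Alt E 3 x) {A B : ∀ x : M, GTan E x} {x : M}
    (hA : SmoothGenAt A x) (hB : SmoothGenAt B x) :
    courant H (fun y ↦ -A y) B x = -courant H A B x := by
  haveI : CompleteSpace E := FiniteDimensional.complete ℝ E
  refine Prod.ext (lieBracket_neg_left _ hA.1) (ContinuousLinearMap.ext fun v ↦ ?_)
  obtain ⟨Z, hZ, rfl⟩ := exists_smoothVector_extension x v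
  have hZ := hZ.self_of_nhds
  rw [Prod.snd_neg, neg_apply, courant_snd_apply H hA.neg hB hZ, courant_snd_apply H hA hB hZ]
  have e1 : dFun (fun y ↦ (-A y).2 (Z y)) x (B x).1 = _ :=
    dFun_neg (fun y ↦ (A y).2 (Z y)) _ _
  have e2 : dFun (fun y ↦ (-A y).2 (B y).1) x (Z x) = _ :=
    dFun_neg (fun y ↦ (A y).2 (B y).1) _ _
  have e3 : dFun (fun y ↦ (B y).2 (-A y).1) x (Z x) = _ :=
    (congrArg (fun f ↦ dFun f x (Z x)) (funext fun y ↦ map_neg (B y).2 _)).trans (dFun_neg _ _ _)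
  have e4 : mlieBracket 𝓘(ℝ, E) (fun y ↦ (-A y).1) Z x = _ := lieBracket_neg_left Z hA.1
  have e5 := alternating_neg_left (H x) (A x).1 (B x).1 (Z x)
  rw [e1, e2, e3, e4, Prod.fst_neg, Prod.snd_neg, e5, neg_apply, map_neg, map_neg]
  ring

theorem courant_neg_right (H : ∀ x : M, Alt E 3 x) {A B : ∀ x : M, GTan E x} {x : M}
    (hA : SmoothGenAt A x) (hB : SmoothGenAt B x) :
    courant H A (fun y ↦ -B y) x = -courant H A B x := by
  rw [courant_swap, courant_neg_left H hB hA, ← courant_swap]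

end CourantCalculus

/-! ### Nijenhuis expressions on `TM ⊕ T^*M`, and brackets of lifts to graphs. -/

section Lifts

open Filter VectorField
open scoped Topology

variable {E : Type*} [NormedAddCommGroup E] [NormedSpace ℝ E]
variable {M : Type*} [TopologicalSpace M] [ChartedSpace E M] [IsManifold 𝓘(ℝ, E) ∞ M]

theorem SmoothFunAt.const_mul {f : M → ℝ} {x : M} (hf : SmoothFunAt (E := E) f x) (c : ℝ) :
    SmoothFunAt (E := E) (fun y ↦ c * f y) x :=
  (contDiff_const.mul contDiff_id : ContDiff ℝ ∞ fun t : ℝ ↦ c * t).contMDiff.contMDiffAt.comp x hf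

theorem pairing_symm {x : M} (A B : GTan E x) : pairing A B = pairing B A := by
  rw [pairing, pairing, add_comm]

theorem pairing_add_left {x : M} (A A' B : GTan E x) :
    pairing (A + A') B = pairing A B + pairing A' B := by
  simp only [pairing, Prod.fst_add, Prod.snd_add, add_apply, map_add]
  ring

theorem pairing_neg_left {x : M} (A B : GTan E x) : pairing (-A) B = -pairing A B := by
  simp only [pairing, Prod.fst_neg, Prod.snd_neg, neg_apply, map_neg]
  ring

theorem pairing_sub_left {x : M} (A A' B : GTan E x) :
    pairing (A - A') B = pairing A B - pairing A' B := by
  rw [sub_eq_add_neg, pairing_add_left, pairing_neg_left, sub_eq_add_neg]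

theorem pairing_smul_left {x : M} (c : ℝ) (A B : GTan E x) :
    pairing (c • A) B = c * pairing A B := by
  simp only [pairing, Prod.smul_fst, Prod.smul_snd, smul_apply, map_smul, smul_eq_mul]
  ring

theorem pairing_add_right {x : M} (A B B' : GTan E x) :
    pairing A (B + B') = pairing A B + pairing A B' := by
  rw [pairing_symm, pairing_add_left, pairing_symm B, pairing_symm B']

theorem pairing_neg_right {x : M} (A B : GTan E x) : pairing A (-B) = -pairing A B := by
  rw [pairing_symm, pairing_neg_left, pairing_symm B]

theorem pairing_smul_right {x : M} (c : ℝ) (A B : GTan E x) :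
    pairing A (c • B) = c * pairing A B := by
  rw [pairing_symm, pairing_smul_left, pairing_symm B]

/-- Testing against vectors kills the covector part; testing against covectors kills the vector
part, since they separate points. -/
theorem eq_zero_of_pairing {x : M} {A : GTan E x} (h : ∀ B, pairing A B = 0) : A = 0 := by
  have h2 : A.2 = 0 := by
    ext v
    have := h (v, 0)
    simpa [pairing] using this
  have h1 (ξ : Cot E x) : ξ A.1 = 0 := by
    have := h (0, ξ)
    rw [pairing, map_zero, zero_add] at this
    linarith
  exact Prod.ext (NormedSpace.eq_zero_of_forall_dual_eq_zero (E := E) ℝ h1) h2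

theorem pairing_skew {x : M} {I : GTan E x →L[ℝ] GTan E x} (sq : ∀ A, I (I A) = -A)
    (orth : ∀ A B, pairing (I A) (I B) = pairing A B) (A B : GTan E x) :
    pairing (I A) B = -pairing A (I B) := by
  have h := orth A (I B)
  rw [sq, pairing_neg_right] at h
  linarith

variable [FiniteDimensional ℝ E]

/-- The Nijenhuis tensor of an endomorphism of `TM ⊕ T^*M` for the twisted Courant bracket. -/
def genNijenhuis (H : ∀ x : M, Alt E 3 x) (I : ∀ x : M, GTan E x →L[ℝ] GTan E x)
    (A B : ∀ x : M, GTan E x) (x : M) : GTan E x :=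
  courant H (fun y ↦ I y (A y)) (fun y ↦ I y (B y)) x
    - I x (courant H (fun y ↦ I y (A y)) B x) - I x (courant H A (fun y ↦ I y (B y)) x)
    - courant H A B x

/-- For real `A`, the section `A - i I A` lies in the `+i`-eigenbundle. The eigenbundle equation for
the bracket of two such sections is exactly this vanishing. -/
theorem IsGenComplex.genNijenhuis_eq_zero {H : ∀ x : M, Alt E 3 x}
    {I : ∀ x : M, GTan E x →L[ℝ] GTan E x} (hI : IsGenComplex H I) {A B : ∀ x : M, GTan E x}
    {x : M} (hA : ∀ᶠ y in 𝓝 x, SmoothGenAt A y) (hB : ∀ᶠ y in 𝓝 x, SmoothGenAt B y) :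
    genNijenhuis H I A B x = 0 := by
  obtain ⟨U, hU, hUo, hx⟩ := eventually_nhds_iff.1 (hA.and hB)
  have smooth {C : ∀ x : M, GTan E x} (hC : ∀ y ∈ U, SmoothGenAt C y) :
      CSection.SmoothOn ⟨C, fun y ↦ -I y (C y)⟩ U :=
    ⟨(smoothGenOn_iff hUo).2 hC, (smoothGenOn_iff hUo).2 fun y hy ↦ (hI.smooth.apply (hC y hy)).neg⟩
  have plus (C : ∀ x : M, GTan E x) : CSection.InPlusI I ⟨C, fun y ↦ -I y (C y)⟩ U :=
    fun y _ ↦ ⟨(neg_neg (I y (C y))).symm, by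
      change I y (-I y (C y)) = C y
      rw [(I y).map_neg, hI.sq, neg_neg]⟩
  have key := (hI.involutive U hUo _ _ (smooth fun y hy ↦ (hU y hy).1)
    (smooth fun y hy ↦ (hU y hy).2) (plus A) (plus B) x hx).2
  have hA := hA.self_of_nhds
  have hB := hB.self_of_nhds
  have hIA := hI.smooth.apply hA
  have hIB := hI.smooth.apply hB
  simp only [CSection.courant] at key
  rw [courant_neg_right H hA hIB, courant_neg_left H hIA hB, courant_neg_left H hIA hIB.neg,
    courant_neg_right H hIA hIB, neg_neg] at key
  rw [(I x).map_add, (I x).map_neg, (I x).map_neg] at key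
  refine Eq.trans ?_ (sub_eq_zero.2 key)
  rw [genNijenhuis]
  abel

/-- Conversely, every section of the `+i`-eigenbundle is `A - i I A` with `A` its real part. One of
the two real eigenbundle equations is the hypothesis; the other follows from `I² = -1`. -/
theorem involutive_of_genNijenhuis {H : ∀ x : M, Alt E 3 x}
    {I : ∀ x : M, GTan E x →L[ℝ] GTan E x} (smooth : SmoothGenEnd I)
    (sq : ∀ (x : M) (A : GTan E x), I x (I x A) = -A)
    (h : ∀ (A B : ∀ x : M, GTan E x) (x : M), (∀ᶠ y in 𝓝 x, SmoothGenAt A y) →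
      (∀ᶠ y in 𝓝 x, SmoothGenAt B y) → genNijenhuis H I A B x = 0)
    (U : Set M) (hU : IsOpen U) (A B : CSection E M) (hA : A.SmoothOn U) (hB : B.SmoothOn U)
    (hA' : A.InPlusI I U) (hB' : B.InPlusI I U) : (A.courant H B).InPlusI I U := by
  intro x hx
  have near {P : M → Prop} (h : ∀ y ∈ U, P y) : ∀ᶠ y in 𝓝 x, P y := by
    filter_upwards [hU.mem_nhds hx] with y hy using h y hy
  have sA := near ((smoothGenOn_iff hU).1 hA.1)
  have sB := near ((smoothGenOn_iff hU).1 hB.1)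
  have key := h A.re B.re x sA sB
  have eA : ∀ᶠ y in 𝓝 x, A.im y = -I y (A.re y) := near fun y hy ↦ by rw [(hA' y hy).1, neg_neg]
  have eB : ∀ᶠ y in 𝓝 x, B.im y = -I y (B.re y) := near fun y hy ↦ by rw [(hB' y hy).1, neg_neg]
  have rA : ∀ᶠ y in 𝓝 x, A.re y = A.re y := .of_forall fun _ ↦ rfl
  have rB : ∀ᶠ y in 𝓝 x, B.re y = B.re y := .of_forall fun _ ↦ rfl
  have sA := sA.self_of_nhds
  have sB := sB.self_of_nhds
  have sIA := smooth.apply sA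
  have sIB := smooth.apply sB
  have im : I x ((A.courant H B).im x) = (A.courant H B).re x := by
    simp only [CSection.courant]
    rw [courant_congr H eA eB, courant_congr H rA eB, courant_congr H eA rB,
      courant_neg_right H sA sIB, courant_neg_left H sIA sB, courant_neg_left H sIA sIB.neg,
      courant_neg_right H sIA sIB, neg_neg, (I x).map_add, (I x).map_neg,
      (I x).map_neg]
    rw [genNijenhuis] at key
    refine sub_eq_zero.1 (Eq.trans ?_ key)
    abel
  refine ⟨?_, im⟩
  rw [← im, sq]

/-- `I` is skew for the pairing, so the outer `I` can be moved onto `C`, leaving only pairings of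
brackets. -/
theorem two_mul_pairing_genNijenhuis (H : ∀ x : M, Alt E 3 x)
    {I : ∀ x : M, GTan E x →L[ℝ] GTan E x}
    (sq : ∀ (x : M) (A : GTan E x), I x (I x A) = -A)
    (orth : ∀ (x : M) (A B : GTan E x), pairing (I x A) (I x B) = pairing A B)
    (A B : ∀ x : M, GTan E x) (x : M) (C : GTan E x) :
    2 * pairing (genNijenhuis H I A B x) C =
      2 * pairing (courant H (fun y ↦ I y (A y)) (fun y ↦ I y (B y)) x) C
        + 2 * pairing (courant H (fun y ↦ I y (A y)) B x) (I x C)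
        + 2 * pairing (courant H A (fun y ↦ I y (B y)) x) (I x C)
        - 2 * pairing (courant H A B x) C := by
  rw [genNijenhuis, pairing_sub_left, pairing_sub_left, pairing_sub_left,
    pairing_skew (sq x) (orth x), pairing_skew (sq x) (orth x)]
  ring

/-- The lift `X + i_X b - σ g(X, ·)` of a tangent vector. -/
def lift (g : ∀ x : M, Tan E x →L[ℝ] Tan E x →L[ℝ] ℝ) (b : ∀ x : M, Alt E 2 x) (σ : ℝ) (x : M)
    (X : Tan E x) : GTan E x := (X, contract₂ (b x) X - σ • g x X)

theorem lift_snd_apply (g : ∀ x : M, Tan E x →L[ℝ] Tan E x →L[ℝ] ℝ) (b : ∀ x : M, Alt E 2 x)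
    (σ : ℝ) (x : M) (X Y : Tan E x) : (lift g b σ x X).2 Y = b x ![X, Y] - σ * g x X Y := by
  rw [lift, sub_apply, contract₂_apply, smul_apply, smul_eq_mul]

theorem SmoothGenAt.lift {g : ∀ x : M, Tan E x →L[ℝ] Tan E x →L[ℝ] ℝ} {b : ∀ x : M, Alt E 2 x}
    (hg : SmoothBilin g) (hb : SmoothForm b) (σ : ℝ) {X : ∀ x : M, Tan E x} {x : M}
    (hX : SmoothVectorAt X x) : SmoothGenAt (fun y ↦ lift g b σ y (X y)) x :=
  ⟨hX, (hb.contract₂ hX).sub ((hg.apply hX).const_smul σ)⟩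

/-- The `b`-terms add up to `db` by Cartan's formula, so `b` merely shifts `H`. The metric terms
keep the signs of the three graphs, and the last one comes from the `½ d` correction in the bracket.
-/
theorem two_mul_pairing_courant_lift (H : ∀ x : M, Alt E 3 x)
    {g : ∀ x : M, Tan E x →L[ℝ] Tan E x →L[ℝ] ℝ} (hg : SmoothBilin g)
    (symm : ∀ (x : M) (X Y : Tan E x), g x X Y = g x Y X)
    {b : ∀ x : M, Alt E 2 x} (hb : SmoothForm b) (σ τ ρ : ℝ) {X Y Z : ∀ x : M, Tan E x} {x : M}
    (hX : SmoothVectorAt X x) (hY : SmoothVectorAt Y x) (hZ : SmoothVectorAt Z x) :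
    2 * pairing (courant H (fun y ↦ lift g b σ y (X y)) (fun y ↦ lift g b τ y (Y y)) x)
      (lift g b ρ x (Z x)) =
    (H x + extD b x) ![X x, Y x, Z x] - ρ * g x (mlieBracket 𝓘(ℝ, E) X Y x) (Z x)
      - τ * (dFun (fun y ↦ g y (Y y) (Z y)) x (X x) - g x (mlieBracket 𝓘(ℝ, E) X Z x) (Y x))
      + σ * (dFun (fun y ↦ g y (X y) (Z y)) x (Y x) - g x (mlieBracket 𝓘(ℝ, E) Y Z x) (X x))
      + (τ - σ) / 2 * dFun (fun y ↦ g y (X y) (Y y)) x (Z x) := by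
  haveI : CompleteSpace E := FiniteDimensional.complete ℝ E
  have e (τ : ℝ) {X Y Z : ∀ x : M, Tan E x} (hX : SmoothVectorAt X x) (hY : SmoothVectorAt Y x) :
      dFun (fun y ↦ (GenPK.lift g b τ y (X y)).2 (Y y)) x (Z x) =
        dFun (fun y ↦ b y ![X y, Y y]) x (Z x) - τ * dFun (fun y ↦ g y (X y) (Y y)) x (Z x) := by
    rw [← dFun_const_mul ((hg.apply hX).apply hY)]
    simp only [lift_snd_apply]
    exact dFun_sub (hb.apply_two hX hY) (((hg.apply hX).apply hY).const_mul τ) _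
  have sX := SmoothGenAt.lift hg hb σ hX
  have sY := SmoothGenAt.lift hg hb τ hY
  have swap : dFun (fun y ↦ b y ![Y y, X y]) x (Z x) = -dFun (fun y ↦ b y ![X y, Y y]) x (Z x) := by
    rw [← dFun_neg]
    simp only [← alternating_swap]
  have h1 := courant_snd_apply H sX sY hZ
  have h2 := extD_two_apply (θ := b) (x := x) (differentiableAt_chartForm_two fun X Y hX hY ↦
    hb.apply_two hX.self_of_nhds hY.self_of_nhds) hX.mdifferentiableAt hY.mdifferentiableAt
    hZ.mdifferentiableAt
  change _ = dFun (fun y ↦ (lift g b τ y (Y y)).2 (Z y)) x (X x)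
    - (lift g b τ x (Y x)).2 (mlieBracket 𝓘(ℝ, E) X Z x)
    - (dFun (fun y ↦ (lift g b σ y (X y)).2 (Z y)) x (Y x)
      - (lift g b σ x (X x)).2 (mlieBracket 𝓘(ℝ, E) Y Z x))
    - 1 / 2 * (dFun (fun y ↦ (lift g b τ y (Y y)).2 (X y)) x (Z x)
      - dFun (fun y ↦ (lift g b σ y (X y)).2 (Y y)) x (Z x)) + H x ![X x, Y x, Z x] at h1
  rw [e τ hY hZ, e σ hX hZ] at h1
  rw [e τ hY hX, e σ hX hY, swap, lift_snd_apply, lift_snd_apply] at h1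
  change 2 * (1 / 2 * ((courant H (fun y ↦ lift g b σ y (X y)) (fun y ↦ lift g b τ y (Y y)) x).2 (Z x)
    + (lift g b ρ x (Z x)).2 (mlieBracket 𝓘(ℝ, E) X Y x))) = _
  rw [h1, lift_snd_apply, ContinuousAlternatingMap.add_apply, h2]
  linear_combination alternating_swap (b x) (Z x) (mlieBracket 𝓘(ℝ, E) X Y x)
    - alternating_swap (b x) (Y x) (mlieBracket 𝓘(ℝ, E) X Z x)
    + alternating_swap (b x) (X x) (mlieBracket 𝓘(ℝ, E) Y Z x)
    - ρ * symm x (Z x) (mlieBracket 𝓘(ℝ, E) X Y x)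
    + τ * symm x (Y x) (mlieBracket 𝓘(ℝ, E) X Z x)
    - σ * symm x (X x) (mlieBracket 𝓘(ℝ, E) Y Z x)
    + τ / 2 * congrArg (fun f ↦ dFun f x (Z x)) (funext fun y ↦ symm y (Y y) (X y))

end Lifts

namespace HermitianSymbols

variable {V : Type*} (D : HermitianSymbols V)

theorem T_jj_mid (σ τ ρ : ℝ) (X Y Z : V) : D.T σ τ ρ X (D.j (D.j Y)) Z = -D.T σ τ ρ X Y Z := by
  rw [T_skew, T_jj_left, ← T_skew]

end HermitianSymbols

/-! ### Germs of vector fields as a model of the formal symbols. -/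

section LocalFields

open Filter VectorField
open scoped Topology

variable {E : Type*} [NormedAddCommGroup E] [NormedSpace ℝ E]
variable {M : Type*} [TopologicalSpace M] [ChartedSpace E M] [IsManifold 𝓘(ℝ, E) ∞ M]

variable (E) in
/-- Vector fields that are smooth near `x`. -/
def LocalField (x : M) : Type _ :=
  {X : ∀ y : M, Tan E y // ∀ᶠ y in 𝓝 x, SmoothVectorAt X y}

/-- The image of a local vector field under a smooth endomorphism. -/
def LocalField.map {J : ∀ x : M, Tan E x →L[ℝ] Tan E x} (hJ : SmoothEnd J) {x : M}
    (X : LocalField E x) : LocalField E x :=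
  ⟨fun y ↦ J y (X.1 y), X.2.mono fun _ h ↦ hJ.apply h⟩

theorem LocalField.smoothVectorAt {x : M} (X : LocalField E x) : SmoothVectorAt X.1 x :=
  X.2.self_of_nhds

theorem LocalField.map_map {J : ∀ x : M, Tan E x →L[ℝ] Tan E x} (hJ : SmoothEnd J)
    (sq : ∀ (x : M) (X : Tan E x), J x (J x X) = -X) {x : M} (X : LocalField E x) :
    ((X.map hJ).map hJ).1 = fun y ↦ -X.1 y := funext fun y ↦ sq y (X.1 y)

theorem LocalField.exists_eq {x : M} (v : Tan E x) : ∃ X : LocalField E x, X.1 x = v :=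
  let ⟨X, h, e⟩ := exists_smoothVector_extension x v
  ⟨⟨X, h⟩, e⟩

variable [CompleteSpace E]

/-- The trilinear expressions at `x` attached to a pseudo-Hermitian structure. -/
def hermitianSymbols (g : ∀ x : M, Tan E x →L[ℝ] Tan E x →L[ℝ] ℝ)
    (symm : ∀ (x : M) (X Y : Tan E x), g x X Y = g x Y X)
    {J : ∀ x : M, Tan E x →L[ℝ] Tan E x} (hJ : SmoothEnd J)
    (sq : ∀ (x : M) (X : Tan E x), J x (J x X) = -X)
    (compat : ∀ (x : M) (X Y : Tan E x), g x (J x X) (J x Y) = g x X Y) {x : M} (K : Alt E 3 x) :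
    HermitianSymbols (LocalField E x) where
  j := LocalField.map hJ
  δ X Y Z := dFun (fun y ↦ g y (Y.1 y) (Z.1 y)) x (X.1 x)
  β X Y Z := g x (mlieBracket 𝓘(ℝ, E) X.1 Y.1 x) (Z.1 x)
  K X Y Z := K ![X.1 x, Y.1 x, Z.1 x]
  δ_symm X Y Z := by simp only [symm _ (Y.1 _)]
  δ_j X Y Z := congrArg (fun f ↦ dFun f x (X.1 x)) (funext fun y ↦ compat y _ _)
  δ_jj_left X Y Z := by rw [LocalField.map_map hJ sq, map_neg]
  δ_jj_mid X Y Z := by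
    rw [LocalField.map_map hJ sq, ← dFun_neg]
    simp only [map_neg, neg_apply]
  β_skew X Y Z := by rw [mlieBracket_swap_apply, map_neg, neg_apply]
  β_jj_left X Y Z := by
    rw [LocalField.map_map hJ sq, lieBracket_neg_left _ X.smoothVectorAt, map_neg, neg_apply]
  β_jj_right X Y Z := by rw [LocalField.map_map hJ sq, map_neg]
  K_skew₁₂ X Y Z := alternating_swap₁₂ K _ _ _
  K_skew₂₃ X Y Z := alternating_swap₂₃ K _ _ _
  K_jj X Y Z := by rw [LocalField.map_map hJ sq]; exact alternating_neg_left K _ _ _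

section Symbols

variable {g : ∀ x : M, Tan E x →L[ℝ] Tan E x →L[ℝ] ℝ}
    {symm : ∀ (x : M) (X Y : Tan E x), g x X Y = g x Y X}
    {J : ∀ x : M, Tan E x →L[ℝ] Tan E x} {hJ : SmoothEnd J}
    {sq : ∀ (x : M) (X : Tan E x), J x (J x X) = -X}
    {compat : ∀ (x : M) (X Y : Tan E x), g x (J x X) (J x Y) = g x X Y} {x : M}

theorem skew_of_compat (sq : ∀ (x : M) (X : Tan E x), J x (J x X) = -X)
    (compat : ∀ (x : M) (X Y : Tan E x), g x (J x X) (J x Y) = g x X Y) (x : M) (X Y : Tan E x) :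
    g x (J x X) Y = -g x X (J x Y) := by
  rw [← compat x X (J x Y), sq, map_neg, neg_neg]

theorem hermitianSymbols_n (K : Alt E 3 x) (X Y Z : LocalField E x) :
    (hermitianSymbols g symm hJ sq compat K).n X Y Z = g x (nijenhuis J X.1 Y.1 x) (Z.1 x) := by
  rw [nijenhuis, map_sub, map_sub, map_sub, sub_apply, sub_apply, sub_apply,
    skew_of_compat sq compat, skew_of_compat sq compat, sub_neg_eq_add, sub_neg_eq_add]
  rfl

/-- Cartan's formula for `F(X, Y) = g(JX, Y)`, with `J` moved off the brackets by skewness. -/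
theorem hermitianSymbols_dF [FiniteDimensional ℝ E] (hg : SmoothBilin g) (K : Alt E 3 x) {F : ∀ x : M, Alt E 2 x}
    (hF : ∀ (x : M) (X Y : Tan E x), F x ![X, Y] = g x (J x X) Y) (X Y Z : LocalField E x) :
    (hermitianSymbols g symm hJ sq compat K).dF X Y Z = extD F x ![X.1 x, Y.1 x, Z.1 x] := by
  rw [extD_two_apply (differentiableAt_chartForm_two fun X Y hX hY ↦ by
    simp only [hF]
    exact (hg.apply (hJ.apply hX.self_of_nhds)).apply hY.self_of_nhds)
    X.smoothVectorAt.mdifferentiableAt Y.smoothVectorAt.mdifferentiableAt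
    Z.smoothVectorAt.mdifferentiableAt]
  simp only [hF]
  rw [skew_of_compat sq compat x (mlieBracket _ _ _ _), skew_of_compat sq compat x (mlieBracket _ _ _ _),
    skew_of_compat sq compat x (mlieBracket _ _ _ _), ]
  simp only [HermitianSymbols.dF, hermitianSymbols, LocalField.map]
  ring

theorem hermitianSymbols_T [FiniteDimensional ℝ E] (H : ∀ x : M, Alt E 3 x) (hg : SmoothBilin g)
    {b : ∀ x : M, Alt E 2 x} (hb : SmoothForm b) (σ τ ρ : ℝ) (X Y Z : LocalField E x) :
    (hermitianSymbols g symm hJ sq compat (H x + extD b x)).T σ τ ρ X Y Z =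
      2 * pairing (courant H (fun y ↦ lift g b σ y (X.1 y)) (fun y ↦ lift g b τ y (Y.1 y)) x)
        (lift g b ρ x (Z.1 x)) :=
  (two_mul_pairing_courant_lift H hg symm hb σ τ ρ X.smoothVectorAt Y.smoothVectorAt
    Z.smoothVectorAt).symm

end Symbols

/-! ### Components of the Nijenhuis expression along the two graphs. -/

section Components

variable [FiniteDimensional ℝ E]

theorem courant_smul_left (H : ∀ x : M, Alt E 3 x) {A B : ∀ x : M, GTan E x} {x : M}
    (hA : SmoothGenAt A x) (hB : SmoothGenAt B x) {c : ℝ} (hc : c = 1 ∨ c = -1) :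
    courant H (fun y ↦ c • A y) B x = c • courant H A B x := by
  rcases hc with rfl | rfl
  · exact (congrArg (fun A ↦ courant H A B x) (funext fun y ↦ one_smul ℝ (A y))).trans
      (one_smul ℝ _).symm
  · exact (congrArg (fun A ↦ courant H A B x) (funext fun y ↦ neg_one_smul ℝ (A y))).trans
      ((courant_neg_left H hA hB).trans (neg_one_smul ℝ _).symm)

theorem courant_smul_right (H : ∀ x : M, Alt E 3 x) {A B : ∀ x : M, GTan E x} {x : M}
    (hA : SmoothGenAt A x) (hB : SmoothGenAt B x) {c : ℝ} (hc : c = 1 ∨ c = -1) :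
    courant H A (fun y ↦ c • B y) x = c • courant H A B x := by
  rw [courant_swap, courant_smul_left H hB hA hc, courant_swap H (A := A)]
  exact (smul_neg c (courant H B A x)).symm

theorem SmoothGenAt.const_smul {A : ∀ x : M, GTan E x} {x : M} (hA : SmoothGenAt A x) (c : ℝ) :
    SmoothGenAt (fun y ↦ c • A y) x := ⟨hA.1.const_smul c, hA.2.const_smul c⟩

variable {g : ∀ x : M, Tan E x →L[ℝ] Tan E x →L[ℝ] ℝ}
    {symm : ∀ (x : M) (X Y : Tan E x), g x X Y = g x Y X}
    {b : ∀ x : M, Alt E 2 x}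
    {J : ∀ x : M, Tan E x →L[ℝ] Tan E x} {hJ : SmoothEnd J}
    {sq : ∀ (x : M) (X : Tan E x), J x (J x X) = -X}
    {compat : ∀ (x : M) (X Y : Tan E x), g x (J x X) (J x Y) = g x X Y}
    {J' : ∀ x : M, Tan E x →L[ℝ] Tan E x} {hJ' : SmoothEnd J'}
    {J'' : ∀ x : M, Tan E x →L[ℝ] Tan E x} {hJ'' : SmoothEnd J''}
    (H : ∀ x : M, Alt E 3 x)
    {I : ∀ x : M, GTan E x →L[ℝ] GTan E x} {x : M}

/-- The constants let one statement cover `I₁` and `I₂`, which differ only by a sign on one graph.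
`T` itself does not involve `j`, so the symbols of `J` may be evaluated on fields moved by `J'` and
`J''`. -/
theorem two_mul_pairing_genNijenhuis_lift (hg : SmoothBilin g) (hb : SmoothForm b)
    (hI : ∀ (x : M) (A : GTan E x), I x (I x A) = -A)
    (orth : ∀ (x : M) (A B : GTan E x), pairing (I x A) (I x B) = pairing A B)
    {σ τ ρ c c' c'' : ℝ} (hc : c = 1 ∨ c = -1) (hc' : c' = 1 ∨ c' = -1)
    (h : ∀ (x : M) (X : Tan E x), I x (lift g b σ x X) = c • lift g b σ x (J x X))
    (h' : ∀ (x : M) (X : Tan E x), I x (lift g b τ x X) = c' • lift g b τ x (J' x X))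
    (h'' : ∀ (x : M) (X : Tan E x), I x (lift g b ρ x X) = c'' • lift g b ρ x (J'' x X))
    (X Y Z : LocalField E x) :
    2 * pairing (genNijenhuis H I (fun y ↦ lift g b σ y (X.1 y)) (fun y ↦ lift g b τ y (Y.1 y)) x)
        (lift g b ρ x (Z.1 x)) =
      c * c' * (hermitianSymbols g symm hJ sq compat (H x + extD b x)).T σ τ ρ
          (X.map hJ) (Y.map hJ') Z
        + c * c'' * (hermitianSymbols g symm hJ sq compat (H x + extD b x)).T σ τ ρ
          (X.map hJ) Y (Z.map hJ'')
        + c' * c'' * (hermitianSymbols g symm hJ sq compat (H x + extD b x)).T σ τ ρ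
          X (Y.map hJ') (Z.map hJ'')
        - (hermitianSymbols g symm hJ sq compat (H x + extD b x)).T σ τ ρ X Y Z := by
  have sm (σ : ℝ) (X : LocalField E x) : SmoothGenAt (fun y ↦ lift g b σ y (X.1 y)) x :=
    .lift hg hb σ X.smoothVectorAt
  rw [two_mul_pairing_genNijenhuis H hI orth]
  simp only [h, h', h'']
  have e1 := courant_smul_left H (sm σ (X.map hJ)) ((sm τ (Y.map hJ')).const_smul c') hc
  have e2 := courant_smul_right H (sm σ (X.map hJ)) (sm τ (Y.map hJ')) hc'
  have e3 := courant_smul_left H (sm σ (X.map hJ)) (sm τ Y) hc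
  have e4 := courant_smul_right H (sm σ X) (sm τ (Y.map hJ')) hc'
  simp only [LocalField.map] at e1 e2 e3 e4
  rw [e1, e2, e3, e4]
  simp only [pairing_smul_left, pairing_smul_right, hermitianSymbols_T H hg hb]
  simp only [LocalField.map]
  ring

theorem genNijenhuis_swap {A B : ∀ x : M, GTan E x} :
    genNijenhuis H I A B x = -genNijenhuis H I B A x := by
  rw [genNijenhuis, genNijenhuis, courant_swap, courant_swap H (A := fun y ↦ I y (A y)) (B := B),
    courant_swap H (A := A) (B := fun y ↦ I y (B y)), courant_swap H (A := A) (B := B),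
    (I x).map_neg, (I x).map_neg]
  abel

theorem genNijenhuis_add_left (hsm : SmoothGenEnd I) {A A' B : ∀ x : M, GTan E x}
    (hA : SmoothGenAt A x) (hA' : SmoothGenAt A' x) (hB : SmoothGenAt B x) :
    genNijenhuis H I (fun y ↦ A y + A' y) B x =
      genNijenhuis H I A B x + genNijenhuis H I A' B x := by
  have e : (fun y ↦ I y (A y + A' y)) = fun y ↦ I y (A y) + I y (A' y) :=
    funext fun y ↦ (I y).map_add _ _
  rw [genNijenhuis, genNijenhuis, genNijenhuis, e]
  rw [courant_add_left H (hsm.apply hA) (hsm.apply hA') (hsm.apply hB),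
    courant_add_left H (hsm.apply hA) (hsm.apply hA') hB,
    courant_add_left H hA hA' (hsm.apply hB), courant_add_left H hA hA' hB,
    (I x).map_add, (I x).map_add]
  abel

theorem genNijenhuis_add_right (hsm : SmoothGenEnd I) {A B B' : ∀ x : M, GTan E x}
    (hA : SmoothGenAt A x) (hB : SmoothGenAt B x) (hB' : SmoothGenAt B' x) :
    genNijenhuis H I A (fun y ↦ B y + B' y) x =
      genNijenhuis H I A B x + genNijenhuis H I A B' x := by
  rw [genNijenhuis_swap, genNijenhuis_add_left H hsm hB hB' hA, neg_add, ← genNijenhuis_swap,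
    ← genNijenhuis_swap]

/-- On the graphs with signs `σ` and `-σ`, an endomorphism acts by `c J` and `c' J'`; the
components of its Nijenhuis tensor vanish if those of the graph with sign `σ` do. -/
theorem pairing_genNijenhuis_lift_eq_zero (hg : SmoothBilin g) (hb : SmoothForm b)
    (hI : ∀ (x : M) (A : GTan E x), I x (I x A) = -A)
    (orth : ∀ (x : M) (A B : GTan E x), pairing (I x A) (I x B) = pairing A B)
    {σ c c' : ℝ} (hc : c = 1 ∨ c = -1) (hc' : c' = 1 ∨ c' = -1)
    (h : ∀ (x : M) (X : Tan E x), I x (lift g b σ x X) = c • lift g b σ x (J x X))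
    (h' : ∀ (x : M) (X : Tan E x), I x (lift g b (-σ) x X) = c' • lift g b (-σ) x (J' x X))
    {D : HermitianSymbols (LocalField E x)}
    (hD : D = hermitianSymbols g symm hJ sq compat (H x + extD b x))
    (hT : ∀ X Y Z, D.T σ σ (-σ) (D.j X) Y Z + D.T σ σ (-σ) X (D.j Y) Z = 0)
    (hN : ∀ X Y Z, D.N σ X Y Z = 0) (hJ' : SmoothEnd J') (X Y Z : LocalField E x) :
    pairing (genNijenhuis H I (fun y ↦ lift g b σ y (X.1 y)) (fun y ↦ lift g b σ y (Y.1 y)) x)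
        (lift g b σ x (Z.1 x)) = 0 ∧
      pairing (genNijenhuis H I (fun y ↦ lift g b σ y (X.1 y)) (fun y ↦ lift g b σ y (Y.1 y)) x)
        (lift g b (-σ) x (Z.1 x)) = 0 ∧
      pairing (genNijenhuis H I (fun y ↦ lift g b σ y (X.1 y)) (fun y ↦ lift g b (-σ) y (Y.1 y)) x)
        (lift g b σ x (Z.1 x)) = 0 := by
  have cc : c * c = 1 := by rcases hc with rfl | rfl <;> norm_num
  have hT' (X Y Z) : D.T σ σ (-σ) (D.j X) (D.j Y) Z = D.T σ σ (-σ) X Y Z := by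
    linear_combination hT X (D.j Y) Z - D.T_jj_mid σ σ (-σ) X Y Z
  refine ⟨?_, ?_, ?_⟩
  · have key := two_mul_pairing_genNijenhuis_lift (symm := symm) (hJ := hJ) (sq := sq)
      (compat := compat) (hJ' := hJ) (hJ'' := hJ) H hg hb hI orth hc hc h h h X Y Z
    rw [← hD] at key
    have e := hN X Y Z
    have hj : ∀ X, LocalField.map hJ X = D.j X := by rw [hD]; exact fun _ ↦ rfl
    simp only [hj, cc, one_mul] at key
    rw [HermitianSymbols.N] at e
    linarith
  · have key := two_mul_pairing_genNijenhuis_lift (symm := symm) (hJ := hJ) (sq := sq)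
      (compat := compat) (hJ' := hJ) (hJ'' := hJ') H hg hb hI orth hc hc h h h' X Y Z
    rw [← hD] at key
    have hj : ∀ X, LocalField.map hJ X = D.j X := by rw [hD]; exact fun _ ↦ rfl
    simp only [hj, cc, one_mul] at key
    -- The outer two terms cancel by `hT'` and the inner two by `hT`, whatever the signs and
    -- whatever field `J'` produces from `Z`.
    linear_combination key / 2 + hT' X Y Z / 2 + c * c' * hT X Y (Z.map hJ') / 2
  · have key := two_mul_pairing_genNijenhuis_lift (symm := symm) (hJ := hJ) (sq := sq)
      (compat := compat) (hJ' := hJ') (hJ'' := hJ) H hg hb hI orth hc hc' h h' h X Y Z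
    rw [← hD] at key
    have hj : ∀ X, LocalField.map hJ X = D.j X := by rw [hD]; exact fun _ ↦ rfl
    simp only [hj, cc, one_mul] at key
    -- This moves the field on the opposite graph to the last slot, where `hT` and `hT'` apply. The
    -- derivatives of `g` it creates cancel in pairs by `e1` and `e2`.
    simp only [HermitianSymbols.T_mixed] at key
    have e1 := D.δ_j Y X Z
    have e2 := D.δ_j_mid (Y.map hJ') X Z
    linear_combination key / 2 + σ * e1 / 2 + σ * c * c' * e2 / 2
      - c * c' / 2 * hT X Z (Y.map hJ') - hT' X Z Y / 2

end Components

end LocalFields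

/-! ### Integrability and the `d^c` equation in terms of symbols. -/

section Integrability

open Filter VectorField
open scoped Topology

variable {E : Type*} [NormedAddCommGroup E] [NormedSpace ℝ E]
variable {M : Type*} [TopologicalSpace M] [ChartedSpace E M] [IsManifold 𝓘(ℝ, E) ∞ M]

theorem alternating_neg {V : Type*} [AddCommGroup V] [Module ℝ V] [TopologicalSpace V]
    (K : V [⋀^Fin 3]→L[ℝ] ℝ) (X Y Z : V) : K ![-X, -Y, -Z] = -K ![X, Y, Z] := by
  rw [alternating_neg_left, alternating_swap₁₂, alternating_neg_left, alternating_swap₂₃,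
    alternating_swap₁₂, alternating_neg_left, alternating_swap₁₂ K Z, alternating_swap₂₃ K Y,
    alternating_swap₁₂ K Y]
  ring

theorem alternating_ext {V : Type*} [AddCommGroup V] [Module ℝ V] [TopologicalSpace V]
    {K K' : V [⋀^Fin 3]→L[ℝ] ℝ} (h : ∀ X Y Z, K ![X, Y, Z] = K' ![X, Y, Z]) : K = K' := by
  ext v
  have e : v = ![v 0, v 1, v 2] := by
    funext i
    fin_cases i <;> rfl
  rw [e]
  exact h _ _ _

theorem alternating_two_ext {V : Type*} [AddCommGroup V] [Module ℝ V] [TopologicalSpace V]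
    {K K' : V [⋀^Fin 2]→L[ℝ] ℝ} (h : ∀ X Y, K ![X, Y] = K' ![X, Y]) : K = K' := by
  ext v
  have e : v = ![v 0, v 1] := by
    funext i
    fin_cases i <;> rfl
  rw [e]
  exact h _ _

/-- The inner `J` fixes `F`; the outer `-J` contributes `(-1)³`. -/
theorem dc_apply {J : ∀ x : M, Tan E x →L[ℝ] Tan E x} {F : ∀ x : M, Alt E 2 x}
    (hF : ∀ (x : M) (X Y : Tan E x), F x ![J x X, J x Y] = F x ![X, Y]) (x : M)
    (X Y Z : Tan E x) : dc J F x ![X, Y, Z] = -extD F x ![J x X, J x Y, J x Z] := by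
  have e : actJ J F = F := by
    funext y
    refine alternating_two_ext (V := Tan E y) fun X Y ↦ ?_
    rw [← hF y X Y]
    refine congrArg (F y) (funext fun i ↦ ?_)
    fin_cases i <;> rfl
  rw [dc, e, ← alternating_neg (V := Tan E x)]
  refine congrArg (extD F x) (funext fun i ↦ ?_)
  fin_cases i <;> rfl

variable [FiniteDimensional ℝ E] [CompleteSpace E]

section Components

variable {g : ∀ x : M, Tan E x →L[ℝ] Tan E x →L[ℝ] ℝ} (hg : IsPseudoRiemannian g)
    {J : ∀ x : M, Tan E x →L[ℝ] Tan E x} (hJ : SmoothEnd J)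
    (sq : ∀ (x : M) (X : Tan E x), J x (J x X) = -X)
    (compat : ∀ (x : M) (X Y : Tan E x), g x (J x X) (J x Y) = g x X Y)

/-- The metric is nondegenerate and every tangent vector at `x` is the value of a local field. `K`
plays no role in `n` and is carried along only to name the symbols. -/
theorem nijenhuis_eq_zero_iff {x : M} (K : Alt E 3 x) :
    (∀ X Y : LocalField E x, nijenhuis J X.1 Y.1 x = 0) ↔
      ∀ X Y Z, (hermitianSymbols g hg.symm hJ sq compat K).n X Y Z = 0 := by
  refine ⟨fun h X Y Z ↦ ?_, fun h X Y ↦ hg.nondeg x _ fun v ↦ ?_⟩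
  · rw [hermitianSymbols_n, h, map_zero, zero_apply]
  · obtain ⟨Z, rfl⟩ := LocalField.exists_eq v
    rw [← hermitianSymbols_n (hJ := hJ) (symm := hg.symm) (compat := compat) (sq := sq) K, h]

theorem dc_eq_iff {F : ∀ x : M, Alt E 2 x}
    (hF : ∀ (x : M) (X Y : Tan E x), F x ![X, Y] = g x (J x X) Y) {x : M} (K : Alt E 3 x) (σ : ℝ) :
    dc J F x = σ • K ↔ ∀ X Y Z : LocalField E x,
      -(hermitianSymbols g hg.symm hJ sq compat K).dF (X.map hJ) (Y.map hJ) (Z.map hJ)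
        = σ * K ![X.1 x, Y.1 x, Z.1 x] := by
  have e (X Y Z : LocalField E x) :
      -(hermitianSymbols g hg.symm hJ sq compat K).dF (X.map hJ) (Y.map hJ) (Z.map hJ) =
        dc J F x ![X.1 x, Y.1 x, Z.1 x] := by
    rw [hermitianSymbols_dF hg.smooth K hF, dc_apply fun x X Y ↦ by rw [hF, hF, compat]]
    rfl
  refine ⟨fun h X Y Z ↦ by rw [e, h]; rfl, fun h ↦ alternating_ext (V := Tan E x) fun X Y Z ↦ ?_⟩
  obtain ⟨X, rfl⟩ := LocalField.exists_eq X
  obtain ⟨Y, rfl⟩ := LocalField.exists_eq Y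
  obtain ⟨Z, rfl⟩ := LocalField.exists_eq Z
  rw [← e, h]
  rfl

theorem isComplexStructure_of_nijenhuis (hJ : SmoothEnd J)
    (sq : ∀ (x : M) (X : Tan E x), J x (J x X) = -X)
    (h : ∀ (x : M) (X Y : LocalField E x), nijenhuis J X.1 Y.1 x = 0) : IsComplexStructure J where
  smooth := hJ
  sq := sq
  integrable U hU X Y hX hY x hx :=
    h x ⟨X, by filter_upwards [hU.mem_nhds hx] with y hy using (smoothVectorOn_iff hU).1 hX y hy⟩
      ⟨Y, by filter_upwards [hU.mem_nhds hx] with y hy using (smoothVectorOn_iff hU).1 hY y hy⟩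

theorem IsComplexStructure.nijenhuis_eq_zero (h : IsComplexStructure J) {x : M}
    (X Y : LocalField E x) : nijenhuis J X.1 Y.1 x = 0 := by
  obtain ⟨U, hU, hUo, hx⟩ := eventually_nhds_iff.1 (X.2.and Y.2)
  exact h.integrable U hUo X.1 Y.1 ((smoothVectorOn_iff hUo).2 fun y hy ↦ (hU y hy).1)
    ((smoothVectorOn_iff hUo).2 fun y hy ↦ (hU y hy).2) x hx

end Components

/-- If the generalized complex structures `I₁` and `I₂` satisfy `I₂ = -σ I₁` on the sections `A`
and `B` and `I₂ = σ I₁` on `C`, then `⟨[I₁ A, I₁ B], C⟩ = ⟨[A, B], C⟩`. -/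
theorem pairing_courant_of_isGenComplex {H : ∀ x : M, Alt E 3 x}
    {I₁ I₂ : ∀ x : M, GTan E x →L[ℝ] GTan E x} (h₁ : IsGenComplex H I₁) (h₂ : IsGenComplex H I₂)
    {σ : ℝ} (hσ : σ = 1 ∨ σ = -1) {A B : ∀ x : M, GTan E x} {x : M} {C : GTan E x}
    (hA : ∀ᶠ y in 𝓝 x, SmoothGenAt A y) (hB : ∀ᶠ y in 𝓝 x, SmoothGenAt B y)
    (eA : ∀ y, I₂ y (A y) = -σ • I₁ y (A y)) (eB : ∀ y, I₂ y (B y) = -σ • I₁ y (B y))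
    (eC : I₂ x C = σ • I₁ x C) :
    pairing (courant H (fun y ↦ I₁ y (A y)) (fun y ↦ I₁ y (B y)) x) C =
      pairing (courant H A B x) C := by
  have k1 := two_mul_pairing_genNijenhuis H h₁.sq h₁.orthogonal A B x C
  have k2 := two_mul_pairing_genNijenhuis H h₂.sq h₂.orthogonal A B x C
  rw [h₁.genNijenhuis_eq_zero hA hB] at k1
  rw [h₂.genNijenhuis_eq_zero hA hB] at k2
  have sA := hA.self_of_nhds
  have sB := hB.self_of_nhds
  have sIA := h₁.smooth.apply sA
  have sIB := h₁.smooth.apply sB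
  have hσ' : -σ = 1 ∨ -σ = -1 := by rcases hσ with rfl | rfl <;> norm_num
  have z : pairing (0 : GTan E x) C = 0 := by simp [pairing]
  simp only [eA, eB, eC] at k2
  rw [courant_smul_left H sIA (sIB.const_smul (-σ)) hσ', courant_smul_right H sIA sIB hσ',
    courant_smul_left H sIA sB hσ', courant_smul_right H sA sIB hσ', z] at k2
  rw [z] at k1
  simp only [pairing_smul_left, pairing_smul_right] at k2
  -- Passing from `I₁` to `I₂` leaves the outer terms unchanged, since `(-σ)² = 1`, and flips the
  -- terms with `I C`, since `(-σ)σ = -1`. Adding the two identities removes the latter.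
  rcases hσ with rfl | rfl <;> linarith

end Integrability

/-! ### From generalized pseudo-Kähler structures to quadruples. -/

section FromGenComplex

open Filter VectorField
open scoped Topology

variable {E : Type*} [NormedAddCommGroup E] [NormedSpace ℝ E] [FiniteDimensional ℝ E]
variable {M : Type*} [TopologicalSpace M] [ChartedSpace E M] [IsManifold 𝓘(ℝ, E) ∞ M]

/-- The condition on the component `(σ, σ, -σ)` comes from comparing `I₁` with `I₂`, the one on `(σ,
σ, σ)` from `I₁` alone. The formal symbols turn both into integrability and the `d^c` equation. -/
theorem integrable_of_isGenComplex [CompleteSpace E] {H : ∀ x : M, Alt E 3 x}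
    {I₁ I₂ : ∀ x : M, GTan E x →L[ℝ] GTan E x} (h₁ : IsGenComplex H I₁) (h₂ : IsGenComplex H I₂)
    {σ : ℝ} (hσ : σ = 1 ∨ σ = -1) {g : ∀ x : M, Tan E x →L[ℝ] Tan E x →L[ℝ] ℝ}
    (hg : IsPseudoRiemannian g) {b : ∀ x : M, Alt E 2 x} (hb : SmoothForm b)
    {J : ∀ x : M, Tan E x →L[ℝ] Tan E x} (hJ : SmoothEnd J)
    (sq : ∀ (x : M) (X : Tan E x), J x (J x X) = -X)
    (compat : ∀ (x : M) (X Y : Tan E x), g x (J x X) (J x Y) = g x X Y)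
    (e₁ : ∀ (x : M) (X : Tan E x), I₁ x (lift g b σ x X) = lift g b σ x (J x X))
    (e₂ : ∀ (x : M) (X : Tan E x), I₂ x (lift g b σ x X) = -σ • lift g b σ x (J x X))
    (e₂' : ∀ (x : M) (X : Tan E x), I₂ x (lift g b (-σ) x X) = σ • I₁ x (lift g b (-σ) x X)) :
    (∀ (x : M) (X Y : LocalField E x), nijenhuis J X.1 Y.1 x = 0) ∧
      ∀ F : ∀ x : M, Alt E 2 x, (∀ (x : M) (X Y : Tan E x), F x ![X, Y] = g x (J x X) Y) →
        ∀ x, dc J F x = σ • (H x + extD b x) := by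
  have hσσ : σ * σ = 1 := by rcases hσ with rfl | rfl <;> norm_num
  have sm (σ : ℝ) {x : M} (X : LocalField E x) :
      ∀ᶠ y in 𝓝 x, SmoothGenAt (fun y ↦ lift g b σ y (X.1 y)) y :=
    X.2.mono fun _ h ↦ .lift hg.smooth hb σ h
  have key (x : M) (X Y Z : LocalField E x) :=
    (hermitianSymbols g hg.symm hJ sq compat (H x + extD b x)).integrable_of_T_of_N hσσ
    (fun X Y Z ↦ by
      rw [hermitianSymbols_T H hg.smooth hb, hermitianSymbols_T H hg.smooth hb]
      have := pairing_courant_of_isGenComplex h₁ h₂ hσ (sm σ X) (sm σ Y)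
        (fun y ↦ by rw [e₁, e₂]) (fun y ↦ by rw [e₁, e₂]) (e₂' x (Z.1 x))
      simp only [e₁] at this
      rw [← this]
      rfl)
    (fun X Y Z ↦ by
      have := two_mul_pairing_genNijenhuis_lift (symm := hg.symm) (hJ := hJ) (sq := sq)
        (compat := compat) (hJ' := hJ) (hJ'' := hJ) H hg.smooth hb h₁.sq h₁.orthogonal
        (Or.inl rfl) (Or.inl rfl) (fun x X ↦ (e₁ x X).trans (one_smul ℝ _).symm)
        (fun x X ↦ (e₁ x X).trans (one_smul ℝ _).symm)
        (fun x X ↦ (e₁ x X).trans (one_smul ℝ _).symm) X Y Z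
      rw [h₁.genNijenhuis_eq_zero (sm σ X) (sm σ Y)] at this
      have z : pairing (0 : GTan E x) (lift g b σ x (Z.1 x)) = 0 := by simp [pairing]
      rw [z] at this
      simp only [mul_one, one_mul, mul_zero] at this
      exact this.symm) X Y Z
  refine ⟨fun x ↦ (nijenhuis_eq_zero_iff hg hJ sq compat (H x + extD b x)).2
    fun X Y Z ↦ (key x X Y Z).1, fun F hF x ↦ ?_⟩
  exact (dc_eq_iff hg hJ sq compat hF (H x + extD b x) σ).2 fun X Y Z ↦ (key x X Y Z).2

theorem isInvertible_of_injective {F F' : Type*} [NormedAddCommGroup F] [NormedSpace ℝ F]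
    [FiniteDimensional ℝ F] [NormedAddCommGroup F'] [NormedSpace ℝ F'] [FiniteDimensional ℝ F']
    (e : Module.finrank ℝ F = Module.finrank ℝ F') {P : F →L[ℝ] F'} (h : Function.Injective P) :
    P.IsInvertible :=
  ⟨(LinearMap.linearEquivOfInjective (P : F →ₗ[ℝ] F') h e).toContinuousLinearEquiv, rfl⟩

variable (E) in
theorem finrank_continuousDual : Module.finrank ℝ (E →L[ℝ] ℝ) = Module.finrank ℝ E := by
  rw [← LinearEquiv.finrank_eq (LinearMap.toContinuousLinearMap (𝕜 := ℝ) (E := E) (F' := ℝ)),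
    Subspace.dual_finrank_eq]

/-- The `b`-terms cancel by skewness. In particular graphs of opposite signs are orthogonal, and the
pairing on a single graph is `-σ g`. -/
theorem two_mul_pairing_lift (g : ∀ x : M, Tan E x →L[ℝ] Tan E x →L[ℝ] ℝ)
    (symm : ∀ (x : M) (X Y : Tan E x), g x X Y = g x Y X) (b : ∀ x : M, Alt E 2 x) (σ τ : ℝ)
    (x : M) (X Y : Tan E x) :
    2 * pairing (lift g b σ x X) (lift g b τ x Y) = -(σ + τ) * g x X Y := by
  rw [pairing]
  change 2 * (1 / 2 * ((lift g b σ x X).2 Y + (lift g b τ x Y).2 X)) = _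
  rw [lift_snd_apply, lift_snd_apply, symm x Y, alternating_swap (b x) Y]
  ring

namespace PseudoBihermitian

variable {H : ∀ x : M, Alt E 3 x} (Q : PseudoBihermitian H)

theorem liftPlus_eq (x : M) (X : Tan E x) : Q.liftPlus x X = lift Q.g Q.b 1 x X :=
  Prod.ext rfl <| by
    change contract₂ (Q.b x) X - Q.g x X = contract₂ (Q.b x) X - (1 : ℝ) • Q.g x X
    rw [one_smul]

theorem liftMinus_eq (x : M) (X : Tan E x) : Q.liftMinus x X = lift Q.g Q.b (-1) x X :=
  Prod.ext rfl <| by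
    change contract₂ (Q.b x) X + Q.g x X = contract₂ (Q.b x) X - (-1 : ℝ) • Q.g x X
    ext Y
    rw [add_apply, sub_apply, smul_apply, smul_eq_mul]
    ring

end PseudoBihermitian

namespace GenPseudoKahler

variable {H : ∀ x : M, Alt E 3 x} (S : GenPseudoKahler H)

/-- The involution `I₁ I₂`. -/
def G (x : M) : GTan E x →L[ℝ] GTan E x := S.I₁ x ∘L S.I₂ x

theorem G_apply (x : M) (A : GTan E x) : S.G x A = S.I₁ x (S.I₂ x A) := rfl

theorem mem_eigenG {c : ℝ} {x : M} {A : GTan E x} :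
    A ∈ eigenG S.I₁ S.I₂ c x ↔ S.G x A = c • A := Module.End.mem_eigenspace_iff

theorem G_G (x : M) (A : GTan E x) : S.G x (S.G x A) = A := by
  rw [G_apply, G_apply, ← S.comm, S.genComplex₁.sq, S.genComplex₂.sq, neg_neg]

theorem G_comm (x : M) (A : GTan E x) : S.G x (S.I₁ x A) = S.I₁ x (S.G x A) := by
  exact congrArg (S.I₁ x) (S.comm x A).symm

theorem pairing_G (x : M) (A B : GTan E x) : pairing (S.G x A) B = pairing A (S.G x B) := by
  rw [G_apply, G_apply, pairing_skew (S.genComplex₁.sq x) (S.genComplex₁.orthogonal x),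
    pairing_skew (S.genComplex₂.sq x) (S.genComplex₂.orthogonal x), neg_neg, S.comm]

theorem smoothGenAt_G {A : ∀ x : M, GTan E x} {x : M} (hA : SmoothGenAt A x) :
    SmoothGenAt (fun y ↦ S.G y (A y)) x :=
  S.genComplex₁.smooth.apply (S.genComplex₂.smooth.apply hA)

/-- Apply `I₁` to `I₁ I₂ A = c A`. -/
theorem I₂_eq {c : ℝ} (hc : c * c = 1) {x : M} {A : GTan E x} (hA : S.G x A = c • A) :
    S.I₂ x A = -c • S.I₁ x A := by
  have h := congrArg (S.I₁ x) hA
  rw [G_apply, S.genComplex₁.sq, (S.I₁ x).map_smul] at h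
  exact (neg_eq_iff_eq_neg.1 h).trans (neg_smul c (S.I₁ x A)).symm

theorem transversal {c : ℝ} (hc : c = 1 ∨ c = -1) (x : M) :
    IsCompl (eigenG S.I₁ S.I₂ c x) (cotSub x) := by
  rcases hc with rfl | rfl
  exacts [S.transversal_plus x, S.transversal_minus x]

theorem eq_zero_of_mem {c : ℝ} (hc : c = 1 ∨ c = -1) {x : M} {ξ : Cot E x}
    (h : S.G x (0, ξ) = c • (0, ξ)) : ξ = 0 := by
  have := Submodule.disjoint_def.1 (S.transversal hc x).disjoint (0, ξ) (S.mem_eigenG.2 h) ⟨ξ, rfl⟩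
  exact congrArg Prod.snd this

theorem exists_mem {c : ℝ} (hc : c = 1 ∨ c = -1) (x : M) (X : Tan E x) :
    ∃ ξ : Cot E x, S.G x (X, ξ) = c • (X, ξ) := by
  obtain ⟨A, hA, B, ⟨η, rfl⟩, h⟩ := Submodule.mem_sup.1
    (show ((X, 0) : GTan E x) ∈ eigenG S.I₁ S.I₂ c x ⊔ cotSub x by
      rw [(S.transversal hc x).sup_eq_top]; trivial)
  refine ⟨A.2, ?_⟩
  have h1 : A.1 = X := by
    have := congrArg Prod.fst h
    simpa using this
  rw [← h1]
  exact S.mem_eigenG.1 hA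

/-- The component `TM → TM` of `I₁ I₂`. -/
def GTT (x : M) : Tan E x →L[ℝ] Tan E x :=
  ContinuousLinearMap.fst ℝ (Tan E x) (Cot E x) ∘L S.G x ∘L
    ContinuousLinearMap.inl ℝ (Tan E x) (Cot E x)

/-- The component `T^*M → TM` of `I₁ I₂`. -/
def GCT (x : M) : Cot E x →L[ℝ] Tan E x :=
  ContinuousLinearMap.fst ℝ (Tan E x) (Cot E x) ∘L S.G x ∘L
    ContinuousLinearMap.inr ℝ (Tan E x) (Cot E x)

theorem G_fst (x : M) (X : Tan E x) (ξ : Cot E x) :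
    (S.G x (X, ξ)).1 = S.GTT x X + S.GCT x ξ := by
  have e : ((X, ξ) : GTan E x) = (X, 0) + (0, ξ) := by simp
  rw [e, (S.G x).map_add]
  rfl

/-- If `G` sends the covector `ξ` to a covector `η`, then `ξ ± η` are covectors in `L^±`, hence zero
by transversality. -/
theorem GCT_injective (x : M) : Function.Injective (S.GCT x) := by
  refine (injective_iff_map_eq_zero (S.GCT x)).2 fun ξ h ↦ ?_
  have h0 : (S.G x (0, ξ)).1 = 0 := h
  obtain ⟨η, hη⟩ : ∃ η, S.G x (0, ξ) = (0, η) := ⟨_, Prod.ext h0 rfl⟩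
  have hη' : S.G x (0, η) = (0, ξ) := by rw [← hη, G_G]
  have h1 : ξ + η = 0 := S.eq_zero_of_mem (Or.inl rfl) (x := x) (by
    rw [one_smul, ← zero_add (0 : Tan E x), ← Prod.mk_add_mk, (S.G x).map_add, hη, hη', add_comm])
  have h2 : ξ - η = 0 := S.eq_zero_of_mem (Or.inr rfl) (x := x) (by
    rw [← sub_zero (0 : Tan E x), ← Prod.mk_sub_mk, (S.G x).map_sub, hη, hη']
    exact ((neg_one_smul ℝ _).trans (neg_sub _ _)).symm)
  have h3 : (2 : ℝ) • ξ = 0 := by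
    rw [two_smul]
    nth_rewrite 2 [sub_eq_zero.1 h2]
    exact h1
  exact (smul_eq_zero.1 h3).resolve_left two_ne_zero

theorem GCT_isInvertible (x : M) : (S.GCT x).IsInvertible :=
  isInvertible_of_injective (F := E →L[ℝ] ℝ) (F' := E) (finrank_continuousDual E) (P := S.GCT x)
    (S.GCT_injective x)

/-- The metric of a generalized pseudo-Kähler structure. -/
def metric (x : M) : Tan E x →L[ℝ] Cot E x := -(S.GCT x).inverse

theorem GCT_metric (x : M) (X : Tan E x) : S.GCT x (S.metric x X) = -X := by
  change S.GCT x (-(S.GCT x).inverse X) = -X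
  rw [(S.GCT x).map_neg, (S.GCT_isInvertible x).self_apply_inverse]

theorem metric_GCT (x : M) (ξ : Cot E x) : S.metric x (S.GCT x ξ) = -ξ := by
  rw [metric, neg_apply, (S.GCT_isInvertible x).inverse_apply_self]

/-- Some `ξ` puts `(X, ξ)` in the eigenspace. The `TM`-component of the eigenvalue equation reads
`GTT X + GCT ξ = c X`, and solving it for `ξ` gives this covector and dictates the definitions of
`metric` and `bForm`. -/
theorem G_graph {c : ℝ} (hc : c = 1 ∨ c = -1) (x : M) (X : Tan E x) :
    S.G x (X, S.metric x (S.GTT x X) - c • S.metric x X) =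
      c • (X, S.metric x (S.GTT x X) - c • S.metric x X) := by
  obtain ⟨ξ, hξ⟩ := S.exists_mem hc x X
  have h := congrArg Prod.fst hξ
  rw [G_fst] at h
  have e : S.metric x (S.GTT x X) - c • S.metric x X = ξ := by
    have h' : S.GTT x X = c • X - S.GCT x ξ := eq_sub_of_add_eq h
    rw [h', (S.metric x).map_sub, (S.metric x).map_smul, metric_GCT]
    abel
  rw [e, hξ]

/-- `L^+` and `L^-` are orthogonal because `G` is self-adjoint. On the diagonal the metric terms
cancel, so `b` is alternating; skewness of `b` then leaves the symmetry of `g`. -/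
theorem pairing_graph (x : M) (X Y : Tan E x) :
    S.metric x (S.GTT x X) Y - S.metric x X Y + S.metric x (S.GTT x Y) X + S.metric x Y X = 0 := by
  have h := S.pairing_G x (X, S.metric x (S.GTT x X) - (1 : ℝ) • S.metric x X)
    (Y, S.metric x (S.GTT x Y) - (-1 : ℝ) • S.metric x Y)
  rw [S.G_graph (Or.inl rfl), S.G_graph (Or.inr rfl), pairing_smul_left, pairing_smul_right] at h
  simp only [pairing, sub_apply, smul_apply, smul_eq_mul] at h
  linarith

theorem metric_GTT_self (x : M) (X : Tan E x) : S.metric x (S.GTT x X) X = 0 := by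
  have := S.pairing_graph x X X
  linarith

/-- The 2-form of a generalized pseudo-Kähler structure. -/
def bForm (x : M) : Alt E 2 x := altOfBilin (V := E) (S.metric x ∘L S.GTT x) (S.metric_GTT_self x)

theorem bForm_apply (x : M) (X Y : Tan E x) : S.bForm x ![X, Y] = S.metric x (S.GTT x X) Y := rfl

theorem contract₂_bForm (x : M) (X : Tan E x) : contract₂ (S.bForm x) X = S.metric x (S.GTT x X) := by
  ext Y
  rw [contract₂_apply, bForm_apply]

theorem metric_symm (x : M) (X Y : Tan E x) : S.metric x X Y = S.metric x Y X := by
  have h := S.pairing_graph x X Y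
  have h2 := alternating_swap (S.bForm x) X Y
  rw [bForm_apply, bForm_apply] at h2
  linarith

theorem isPseudoRiemannian : IsPseudoRiemannian S.metric where
  smooth := by
    refine smoothBilin_of_apply fun x Y hY ↦ ?_
    -- The metric is the negative inverse of the smooth invertible map `GCT`, so applying `GCT` to
    -- it returns `-Y`.
    refine smoothCovectorAt_of_hom (P := S.GCT) (S.GCT_isInvertible x) (fun ξ hξ ↦ ?_) ?_
    · exact (S.smoothGenAt_G (A := fun y ↦ (0, ξ y)) ⟨smoothVectorAt_zero x, hξ.self_of_nhds⟩).1
    · simp only [GCT_metric]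
      exact hY.self_of_nhds.neg
  symm := S.metric_symm
  nondeg x X h := by
    have h0 : S.metric x X = 0 := by ext Y; exact h Y
    have := S.GCT_metric x X
    rw [h0, map_zero] at this
    exact neg_eq_zero.1 this.symm

theorem smoothForm_bForm : SmoothForm S.bForm := smoothForm_two_of_apply fun x X Y hX hY ↦ by
  simp only [bForm_apply]
  exact (S.isPseudoRiemannian.smooth.apply (S.smoothGenAt_G (A := fun y ↦ (X y, 0))
    ⟨hX.self_of_nhds, smoothCovectorAt_zero x⟩).1).apply hY.self_of_nhds

theorem G_lift {c : ℝ} (hc : c = 1 ∨ c = -1) (x : M) (X : Tan E x) :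
    S.G x (lift S.metric S.bForm c x X) = c • lift S.metric S.bForm c x X := by
  rw [lift, contract₂_bForm, S.G_graph hc]

/-- An eigenvector and the lift of its `TM`-part differ by a covector in the same eigenspace, which
is zero by transversality. -/
theorem eq_lift {c : ℝ} (hc : c = 1 ∨ c = -1) {x : M} {A : GTan E x} (hA : S.G x A = c • A) :
    A = lift S.metric S.bForm c x A.1 := by
  have h := S.eq_zero_of_mem hc (x := x) (ξ := A.2 - (lift S.metric S.bForm c x A.1).2) (by
    have e : ((0, A.2 - (lift S.metric S.bForm c x A.1).2) : GTan E x) =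
        A - lift S.metric S.bForm c x A.1 := Prod.ext (sub_self A.1).symm rfl
    rw [e, (S.G x).map_sub, hA, S.G_lift hc]
    exact (smul_sub c _ _).symm)
  exact Prod.ext rfl (sub_eq_zero.1 h)

/-- The endomorphism of `TM` corresponding to `I₁` on the graph with sign `c`. -/
def J (c : ℝ) (x : M) : Tan E x →L[ℝ] Tan E x :=
  ContinuousLinearMap.fst ℝ (Tan E x) (Cot E x) ∘L S.I₁ x ∘L
    ContinuousLinearMap.prod (ContinuousLinearMap.id ℝ (Tan E x))
      (S.metric x ∘L S.GTT x - c • S.metric x)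

theorem J_apply (c : ℝ) (x : M) (X : Tan E x) :
    S.J c x X = (S.I₁ x (lift S.metric S.bForm c x X)).1 := by
  rw [lift, contract₂_bForm]
  rfl

theorem I₁_lift {c : ℝ} (hc : c = 1 ∨ c = -1) (x : M) (X : Tan E x) :
    S.I₁ x (lift S.metric S.bForm c x X) = lift S.metric S.bForm c x (S.J c x X) := by
  rw [J_apply]
  refine S.eq_lift hc ?_
  rw [G_comm, S.G_lift hc, (S.I₁ x).map_smul]

theorem J_J {c : ℝ} (hc : c = 1 ∨ c = -1) (x : M) (X : Tan E x) : S.J c x (S.J c x X) = -X := by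
  rw [J_apply, ← S.I₁_lift hc, S.genComplex₁.sq]
  rfl

theorem smoothEnd_J (c : ℝ) : SmoothEnd (S.J c) := smoothEnd_of_apply fun x X hX ↦ by
  simp only [J_apply]
  exact (S.genComplex₁.smooth.apply (SmoothGenAt.lift S.isPseudoRiemannian.smooth
    S.smoothForm_bForm c hX.self_of_nhds)).1

/-- Orthogonality of `I₁` restricted to the graph, where the pairing is `-c g`. -/
theorem J_compat {c : ℝ} (hc : c = 1 ∨ c = -1) (x : M) (X Y : Tan E x) :
    S.metric x (S.J c x X) (S.J c x Y) = S.metric x X Y := by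
  have h := S.genComplex₁.orthogonal x (lift S.metric S.bForm c x X) (lift S.metric S.bForm c x Y)
  rw [S.I₁_lift hc, S.I₁_lift hc] at h
  have h1 := two_mul_pairing_lift S.metric S.metric_symm S.bForm c c x X Y
  have h2 := two_mul_pairing_lift S.metric S.metric_symm S.bForm c c x (S.J c x X) (S.J c x Y)
  rw [h, h1] at h2
  rcases hc with rfl | rfl <;> linarith

theorem integrable_J {c : ℝ} (hc : c = 1 ∨ c = -1) :
    (∀ (x : M) (X Y : LocalField E x), nijenhuis (S.J c) X.1 Y.1 x = 0) ∧
      ∀ F : ∀ x : M, Alt E 2 x,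
        (∀ (x : M) (X Y : Tan E x), F x ![X, Y] = S.metric x (S.J c x X) Y) →
          ∀ x, dc (S.J c) F x = c • (H x + extD S.bForm x) := by
  haveI : CompleteSpace E := FiniteDimensional.complete ℝ E
  have cc : c * c = 1 := by rcases hc with rfl | rfl <;> norm_num
  have hc' : -c = 1 ∨ -c = -1 := by rcases hc with rfl | rfl <;> norm_num
  refine integrable_of_isGenComplex S.genComplex₁ S.genComplex₂ hc S.isPseudoRiemannian
    S.smoothForm_bForm (S.smoothEnd_J c) (S.J_J hc) (S.J_compat hc) (S.I₁_lift hc)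
    (fun x X ↦ ?_) (fun x X ↦ ?_)
  · rw [S.I₂_eq cc (S.G_lift hc x X), S.I₁_lift hc]
  · rw [S.I₂_eq (by linarith) (S.G_lift hc' x X), neg_neg]

theorem isHermitian_J {c : ℝ} (hc : c = 1 ∨ c = -1) : IsHermitian S.metric (S.J c) where
  complex := isComplexStructure_of_nijenhuis (S.smoothEnd_J c) (S.J_J hc) (S.integrable_J hc).1
  compatible := S.J_compat hc

/-- The quadruple `(g, J₊, J₋, b)` of a generalized pseudo-Kähler structure. -/
def toPseudoBihermitian : PseudoBihermitian H where
  g := S.metric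
  Jp := S.J 1
  Jm := S.J (-1)
  b := S.bForm
  metric := S.isPseudoRiemannian
  hermitian_plus := S.isHermitian_J (Or.inl rfl)
  hermitian_minus := S.isHermitian_J (Or.inr rfl)
  smooth_b := S.smoothForm_bForm
  dc_plus x := by
    rw [(S.integrable_J (Or.inl rfl)).2 _ fun x X Y ↦ rfl]
    exact one_smul ℝ _
  dc_minus x := by
    have h := (S.integrable_J (Or.inr rfl)).2
      (kahlerForm S.isPseudoRiemannian (S.isHermitian_J (Or.inr rfl))) (fun x X Y ↦ rfl) x
    rw [h]
    exact (congrArg Neg.neg (neg_one_smul ℝ (H x + extD S.bForm x))).trans (neg_neg _)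

theorem isAssociated_toPseudoBihermitian : IsAssociated S S.toPseudoBihermitian := by
  have ep := S.toPseudoBihermitian.liftPlus_eq
  have em := S.toPseudoBihermitian.liftMinus_eq
  constructor
  · intro x A
    simp only [ep]
    refine S.mem_eigenG.trans ⟨fun h ↦ ⟨A.1, S.eq_lift (Or.inl rfl) h⟩, ?_⟩
    rintro ⟨X, rfl⟩
    exact S.G_lift (Or.inl rfl) x X
  · intro x A
    simp only [em]
    refine S.mem_eigenG.trans ⟨fun h ↦ ⟨A.1, S.eq_lift (Or.inr rfl) h⟩, ?_⟩
    rintro ⟨X, rfl⟩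
    exact S.G_lift (Or.inr rfl) x X
  · intro x X
    rw [ep, ep]
    exact S.I₁_lift (Or.inl rfl) x X
  · intro x X
    rw [em, em]
    exact S.I₁_lift (Or.inr rfl) x X

end GenPseudoKahler

end FromGenComplex

/-! ### From quadruples to generalized pseudo-Kähler structures, and uniqueness. -/

section ToGenComplex

open Filter VectorField
open scoped Topology

variable {E : Type*} [NormedAddCommGroup E] [NormedSpace ℝ E] [FiniteDimensional ℝ E]
variable {M : Type*} [TopologicalSpace M] [ChartedSpace E M] [IsManifold 𝓘(ℝ, E) ∞ M]

theorem HermitianSymbols.conditions {H : ∀ x : M, Alt E 3 x} [CompleteSpace E] {g : ∀ x : M, Tan E x →L[ℝ] Tan E x →L[ℝ] ℝ}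
    (hg : IsPseudoRiemannian g) {b : ∀ x : M, Alt E 2 x}
    {J : ∀ x : M, Tan E x →L[ℝ] Tan E x} (hJ : IsHermitian g J) {σ : ℝ} (hσ : σ = 1 ∨ σ = -1) {x : M}
    (hF : dc J (kahlerForm hg hJ) x = σ • (H x + extD b x))
    {D : HermitianSymbols (LocalField E x)}
    (hD : D = hermitianSymbols g hg.symm hJ.complex.smooth hJ.complex.sq hJ.compatible
      (H x + extD b x)) :
    (∀ X Y Z, D.T σ σ (-σ) (D.j X) Y Z + D.T σ σ (-σ) X (D.j Y) Z = 0) ∧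
      ∀ X Y Z, D.N σ X Y Z = 0 := by
  have hσσ : σ * σ = 1 := by rcases hσ with rfl | rfl <;> norm_num
  subst hD
  exact HermitianSymbols.T_and_N_of_integrable _ hσσ
    ((nijenhuis_eq_zero_iff hg _ _ _ _).1 fun X Y ↦ hJ.complex.nijenhuis_eq_zero X Y)
    ((dc_eq_iff hg _ _ _ (fun _ _ _ ↦ rfl) (H x + extD b x) σ).1 hF)

namespace PseudoBihermitian

variable {H : ∀ x : M, Alt E 3 x} (Q : PseudoBihermitian H)

/-- The lift `X + i_X b - σ g(X, ·)` as a linear map. -/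
def liftL (σ : ℝ) (x : M) : Tan E x →L[ℝ] GTan E x :=
  (ContinuousLinearMap.id ℝ (Tan E x)).prod (bilinOfForm Q.b x - σ • Q.g x)

theorem g_injective (x : M) : Function.Injective (Q.g x) :=
  (injective_iff_map_eq_zero (Q.g x)).2 fun X h ↦ Q.metric.nondeg x X fun Y ↦ by
    rw [h, zero_apply]

theorem g_isInvertible (x : M) : (Q.g x).IsInvertible :=
  isInvertible_of_injective (F := E) (F' := E →L[ℝ] ℝ) (finrank_continuousDual E).symm (P := Q.g x)
    (Q.g_injective x)

/-- The component of an element of `TM ⊕ T^*M` along the graph with sign `σ`. -/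
def proj (σ : ℝ) (x : M) : GTan E x →L[ℝ] Tan E x :=
  (1 / 2 : ℝ) • (ContinuousLinearMap.fst ℝ (Tan E x) (Cot E x)
    - σ • ((Q.g x).inverse ∘L (ContinuousLinearMap.snd ℝ (Tan E x) (Cot E x)
      - bilinOfForm Q.b x ∘L ContinuousLinearMap.fst ℝ (Tan E x) (Cot E x))))

theorem proj_apply (σ : ℝ) (x : M) (A : GTan E x) : Q.proj σ x A =
    (1 / 2 : ℝ) • (A.1 - σ • (Q.g x).inverse (A.2 - contract₂ (Q.b x) A.1)) := rfl

theorem g_inverse (x : M) (ξ : Cot E x) : Q.g x ((Q.g x).inverse ξ) = ξ :=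
  (Q.g_isInvertible x).self_apply_inverse ξ

theorem inverse_g (x : M) (X : Tan E x) : (Q.g x).inverse (Q.g x X) = X :=
  (Q.g_isInvertible x).inverse_apply_self X

/-- The two components `X`, `Y` solve `X + Y = A.1` and `g(X - Y) = -(A.2 - b(A.1))`; this is where
the formula for `proj` comes from. -/
theorem lift_proj_add (x : M) (A : GTan E x) :
    lift Q.g Q.b 1 x (Q.proj 1 x A) + lift Q.g Q.b (-1) x (Q.proj (-1) x A) = A := by
  have h1 : Q.proj 1 x A + Q.proj (-1) x A = A.1 := by
    rw [proj_apply, proj_apply]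
    module
  have h2 : Q.proj 1 x A - Q.proj (-1) x A =
      -(Q.g x).inverse (A.2 - contract₂ (Q.b x) A.1) := by
    rw [proj_apply, proj_apply]
    module
  refine Prod.ext h1 ?_
  have e : (lift Q.g Q.b 1 x (Q.proj 1 x A) + lift Q.g Q.b (-1) x (Q.proj (-1) x A)).2 =
      contract₂ (Q.b x) (Q.proj 1 x A + Q.proj (-1) x A)
        - Q.g x (Q.proj 1 x A - Q.proj (-1) x A) := by
    rw [contract₂_add, (Q.g x).map_sub]
    simp only [lift, Prod.snd_add]
    module
  rw [e, h1, h2, (Q.g x).map_neg, g_inverse]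
  module

theorem inverse_lift (σ : ℝ) (x : M) (X : Tan E x) :
    (Q.g x).inverse ((lift Q.g Q.b σ x X).2 - contract₂ (Q.b x) (lift Q.g Q.b σ x X).1) =
      -(σ • X) := by
  have h : (lift Q.g Q.b σ x X).2 - contract₂ (Q.b x) (lift Q.g Q.b σ x X).1 =
      -(σ • Q.g x X) := by
    change contract₂ (Q.b x) X - σ • Q.g x X - contract₂ (Q.b x) X = _
    abel
  rw [h, ← (Q.g x).map_smul, ← (Q.g x).map_neg, inverse_g]

theorem proj_lift {σ : ℝ} (hσ : σ = 1 ∨ σ = -1) (x : M) (X : Tan E x) :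
    Q.proj σ x (lift Q.g Q.b σ x X) = X := by
  rw [proj_apply, inverse_lift]
  change (1 / 2 : ℝ) • (X - σ • -(σ • X)) = X
  rcases hσ with rfl | rfl <;> module

theorem proj_neg_lift {σ : ℝ} (hσ : σ = 1 ∨ σ = -1) (x : M) (X : Tan E x) :
    Q.proj (-σ) x (lift Q.g Q.b σ x X) = 0 := by
  rw [proj_apply, inverse_lift]
  change (1 / 2 : ℝ) • (X - -σ • -(σ • X)) = 0
  rcases hσ with rfl | rfl <;> module

theorem smoothVectorAt_proj (σ : ℝ) {A : ∀ x : M, GTan E x} {x : M} (hA : SmoothGenAt A x) :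
    SmoothVectorAt (fun y ↦ Q.proj σ y (A y)) x := by
  have h : SmoothVectorAt (fun y ↦ (Q.g y).inverse ((A y).2 - contract₂ (Q.b y) (A y).1)) x := by
    refine Q.metric.smooth.smoothVectorAt (Q.g_isInvertible x) ?_
    simp only [g_inverse]
    exact hA.2.sub (Q.smooth_b.contract₂ hA.1)
  exact (hA.1.sub (h.const_smul σ)).const_smul (1 / 2)

/-- The endomorphism of `TM ⊕ T^*M` acting by `c J₊` and `c' J₋` on the graphs of `b ∓ g`. -/
def endo (c c' : ℝ) (x : M) : GTan E x →L[ℝ] GTan E x :=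
  c • (Q.liftL 1 x ∘L Q.Jp x ∘L Q.proj 1 x) + c' • (Q.liftL (-1) x ∘L Q.Jm x ∘L Q.proj (-1) x)

theorem endo_apply (c c' : ℝ) (x : M) (A : GTan E x) : Q.endo c c' x A =
    c • lift Q.g Q.b 1 x (Q.Jp x (Q.proj 1 x A))
      + c' • lift Q.g Q.b (-1) x (Q.Jm x (Q.proj (-1) x A)) := rfl

theorem lift_zero (σ : ℝ) (x : M) : lift Q.g Q.b σ x 0 = 0 := (Q.liftL σ x).map_zero

theorem lift_neg (σ : ℝ) (x : M) (X : Tan E x) : lift Q.g Q.b σ x (-X) = -lift Q.g Q.b σ x X :=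
  (Q.liftL σ x).map_neg X

theorem endo_lift_plus (c c' : ℝ) (x : M) (X : Tan E x) :
    Q.endo c c' x (lift Q.g Q.b 1 x X) = c • lift Q.g Q.b 1 x (Q.Jp x X) := by
  rw [endo_apply, Q.proj_lift (Or.inl rfl), Q.proj_neg_lift (Or.inl rfl), map_zero, lift_zero,
    smul_zero, add_zero]

theorem endo_lift_minus (c c' : ℝ) (x : M) (X : Tan E x) :
    Q.endo c c' x (lift Q.g Q.b (-1) x X) = c' • lift Q.g Q.b (-1) x (Q.Jm x X) := by
  have h := Q.proj_neg_lift (σ := -1) (Or.inr rfl) x X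
  rw [neg_neg] at h
  rw [endo_apply, Q.proj_lift (Or.inr rfl), h, map_zero, lift_zero, smul_zero, zero_add]

theorem exists_lift (x : M) (A : GTan E x) :
    ∃ X Y, A = lift Q.g Q.b 1 x X + lift Q.g Q.b (-1) x Y := ⟨_, _, (Q.lift_proj_add x A).symm⟩

theorem smoothGenEnd_endo (c c' : ℝ) : SmoothGenEnd (Q.endo c c') :=
  smoothGenEnd_of_apply fun x A hA ↦ by
    have hA := hA.self_of_nhds
    exact ((SmoothGenAt.lift Q.metric.smooth Q.smooth_b 1
      (Q.hermitian_plus.complex.smooth.apply (Q.smoothVectorAt_proj 1 hA))).const_smul c).add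
      ((SmoothGenAt.lift Q.metric.smooth Q.smooth_b (-1)
      (Q.hermitian_minus.complex.smooth.apply (Q.smoothVectorAt_proj (-1) hA))).const_smul c')

theorem pairing_lift (σ τ : ℝ) (x : M) (X Y : Tan E x) :
    pairing (lift Q.g Q.b σ x X) (lift Q.g Q.b τ x Y) = -(σ + τ) / 2 * Q.g x X Y := by
  linear_combination (two_mul_pairing_lift Q.g Q.metric.symm Q.b σ τ x X Y) / 2

theorem endo_endo {c c' : ℝ} (hc : c = 1 ∨ c = -1) (hc' : c' = 1 ∨ c' = -1) (x : M)
    (A : GTan E x) : Q.endo c c' x (Q.endo c c' x A) = -A := by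
  obtain ⟨X, Y, rfl⟩ := Q.exists_lift x A
  rw [(Q.endo c c' x).map_add, endo_lift_plus, endo_lift_minus, (Q.endo c c' x).map_add,
    (Q.endo c c' x).map_smul, (Q.endo c c' x).map_smul, endo_lift_plus, endo_lift_minus,
    Q.hermitian_plus.complex.sq, Q.hermitian_minus.complex.sq, lift_neg, lift_neg]
  rcases hc with rfl | rfl <;> rcases hc' with rfl | rfl <;> module

theorem pairing_endo {c c' : ℝ} (hc : c = 1 ∨ c = -1) (hc' : c' = 1 ∨ c' = -1) (x : M)
    (A B : GTan E x) : pairing (Q.endo c c' x A) (Q.endo c c' x B) = pairing A B := by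
  obtain ⟨X, Y, rfl⟩ := Q.exists_lift x A
  obtain ⟨X', Y', rfl⟩ := Q.exists_lift x B
  have hcc : c * c = 1 := by rcases hc with rfl | rfl <;> norm_num
  have hcc' : c' * c' = 1 := by rcases hc' with rfl | rfl <;> norm_num
  rw [(Q.endo c c' x).map_add, (Q.endo c c' x).map_add, endo_lift_plus, endo_lift_minus,
    endo_lift_plus, endo_lift_minus]
  simp only [pairing_add_left, pairing_add_right, pairing_smul_left, pairing_smul_right,
    pairing_lift,
    Q.hermitian_plus.compatible, Q.hermitian_minus.compatible]
  linear_combination -hcc * Q.g x X X' + hcc' * Q.g x Y Y'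

/-- Splitting all three arguments along the graphs gives eight components. Six vanish by
`pairing_genNijenhuis_lift_eq_zero` for the two signs, and the other two by skewness. -/
theorem isGenComplex_endo {c c' : ℝ} (hc : c = 1 ∨ c = -1) (hc' : c' = 1 ∨ c' = -1) :
    IsGenComplex H (Q.endo c c') where
  smooth := Q.smoothGenEnd_endo c c'
  sq := Q.endo_endo hc hc'
  orthogonal := Q.pairing_endo hc hc'
  involutive := by
    haveI : CompleteSpace E := FiniteDimensional.complete ℝ E
    refine involutive_of_genNijenhuis (Q.smoothGenEnd_endo c c') (Q.endo_endo hc hc')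
      fun A B x hA hB ↦ eq_zero_of_pairing fun C ↦ ?_
    obtain ⟨Z, Z', rfl⟩ := Q.exists_lift x C
    obtain ⟨Z, rfl⟩ := LocalField.exists_eq Z
    obtain ⟨Z', rfl⟩ := LocalField.exists_eq Z'
    -- `A` and `B` are differentiated by the bracket, so they are decomposed as germs of sections.
    -- For `C`, decomposing the value at `x` was enough.
    have split {A : ∀ x : M, GTan E x} (hA : ∀ᶠ y in 𝓝 x, SmoothGenAt A y) :
        ∃ X Y : LocalField E x, A = fun y ↦ lift Q.g Q.b 1 y (X.1 y) + lift Q.g Q.b (-1) y (Y.1 y) :=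
      ⟨⟨fun y ↦ Q.proj 1 y (A y), hA.mono fun _ h ↦ Q.smoothVectorAt_proj 1 h⟩,
        ⟨fun y ↦ Q.proj (-1) y (A y), hA.mono fun _ h ↦ Q.smoothVectorAt_proj (-1) h⟩,
        funext fun y ↦ (Q.lift_proj_add y (A y)).symm⟩
    obtain ⟨X, X', rfl⟩ := split hA
    obtain ⟨Y, Y', rfl⟩ := split hB
    have sm (σ : ℝ) (X : LocalField E x) : SmoothGenAt (fun y ↦ lift Q.g Q.b σ y (X.1 y)) x :=
      .lift Q.metric.smooth Q.smooth_b σ X.smoothVectorAt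
    obtain ⟨T₁, N₁⟩ := HermitianSymbols.conditions Q.metric Q.hermitian_plus (Or.inl rfl)
      (x := x) (by rw [Q.dc_plus x]; exact (one_smul ℝ _).symm) rfl
    obtain ⟨T₂, N₂⟩ := HermitianSymbols.conditions Q.metric Q.hermitian_minus (Or.inr rfl)
      (x := x) (by
        rw [← Q.dc_minus x]
        exact (neg_neg _).symm.trans (neg_one_smul ℝ _).symm) rfl
    have plus := pairing_genNijenhuis_lift_eq_zero H Q.metric.smooth Q.smooth_b
      (Q.endo_endo hc hc') (Q.pairing_endo hc hc') hc hc' (Q.endo_lift_plus c c')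
      (Q.endo_lift_minus c c') rfl T₁ N₁ Q.hermitian_minus.complex.smooth
    have minus := pairing_genNijenhuis_lift_eq_zero H Q.metric.smooth Q.smooth_b
      (Q.endo_endo hc hc') (Q.pairing_endo hc hc') hc' hc (Q.endo_lift_minus c c')
      (J' := Q.Jp) (by rw [neg_neg]; exact Q.endo_lift_plus c c') rfl T₂ N₂
      Q.hermitian_plus.complex.smooth
    simp only [neg_neg] at minus
    have hs := Q.smoothGenEnd_endo c c'
    rw [genNijenhuis_add_left H hs (sm _ _) (sm _ _) ((sm _ _).add (sm _ _)),
      genNijenhuis_add_right H hs (sm _ _) (sm _ _) (sm _ _),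
      genNijenhuis_add_right H hs (sm _ _) (sm _ _) (sm _ _)]
    have swap (A B : ∀ x : M, GTan E x) (C : GTan E x)
        (h : pairing (genNijenhuis H (Q.endo c c') A B x) C = 0) :
        pairing (genNijenhuis H (Q.endo c c') B A x) C = 0 := by
      rw [genNijenhuis_swap, pairing_neg_left, h, neg_zero]
    simp only [pairing_add_left, pairing_add_right]
    rw [(plus X Y Z).1, (plus X Y Z').2.1, (minus X' Y' Z').1, (minus X' Y' Z).2.1,
      (plus X Y' Z).2.2, (minus X' Y Z').2.2, swap _ _ _ (plus Y X' Z).2.2,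
      swap _ _ _ (minus Y' X Z').2.2]
    norm_num

theorem endo_comm (x : M) (A : GTan E x) :
    Q.endo 1 1 x (Q.endo (-1) 1 x A) = Q.endo (-1) 1 x (Q.endo 1 1 x A) := by
  obtain ⟨X, Y, rfl⟩ := Q.exists_lift x A
  simp only [(Q.endo _ _ x).map_add, endo_lift_plus, endo_lift_minus, (Q.endo _ _ x).map_smul]
  module

/-- With `I₂` acting as `-J₊` and `J₋`, the product `I₁ I₂` is `-J₊² = 1` here and `J₋² = -1` on the
other graph. -/
theorem endo_endo_lift_plus (x : M) (X : Tan E x) :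
    Q.endo 1 1 x (Q.endo (-1) 1 x (lift Q.g Q.b 1 x X)) = lift Q.g Q.b 1 x X := by
  rw [endo_lift_plus, (Q.endo 1 1 x).map_smul, endo_lift_plus, Q.hermitian_plus.complex.sq,
    lift_neg]
  module

theorem endo_endo_lift_minus (x : M) (X : Tan E x) :
    Q.endo 1 1 x (Q.endo (-1) 1 x (lift Q.g Q.b (-1) x X)) = -lift Q.g Q.b (-1) x X := by
  rw [endo_lift_minus, (Q.endo 1 1 x).map_smul, endo_lift_minus, Q.hermitian_minus.complex.sq,
    lift_neg]
  module

theorem mem_eigenG_plus (x : M) (A : GTan E x) :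
    A ∈ eigenG (Q.endo 1 1) (Q.endo (-1) 1) 1 x ↔ ∃ X, A = lift Q.g Q.b 1 x X := by
  refine Module.End.mem_eigenspace_iff.trans ⟨fun h ↦ ?_, ?_⟩
  · obtain ⟨X, Y, rfl⟩ := Q.exists_lift x A
    change Q.endo 1 1 x (Q.endo (-1) 1 x _) = _ at h
    rw [(Q.endo _ _ x).map_add, (Q.endo _ _ x).map_add, endo_endo_lift_plus,
      endo_endo_lift_minus, one_smul] at h
    have h2 : (2 : ℝ) • lift Q.g Q.b (-1) x Y = 0 := by
      rw [two_smul]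
      nth_rewrite 1 [← add_left_cancel h]
      exact neg_add_cancel _
    refine ⟨X, ?_⟩
    rw [(smul_eq_zero.1 h2).resolve_left two_ne_zero, add_zero]
  · rintro ⟨X, rfl⟩
    exact (Q.endo_endo_lift_plus x X).trans (one_smul ℝ _).symm

theorem mem_eigenG_minus (x : M) (A : GTan E x) :
    A ∈ eigenG (Q.endo 1 1) (Q.endo (-1) 1) (-1) x ↔ ∃ X, A = lift Q.g Q.b (-1) x X := by
  refine Module.End.mem_eigenspace_iff.trans ⟨fun h ↦ ?_, ?_⟩
  · obtain ⟨X, Y, rfl⟩ := Q.exists_lift x A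
    change Q.endo 1 1 x (Q.endo (-1) 1 x _) = _ at h
    rw [(Q.endo _ _ x).map_add, (Q.endo _ _ x).map_add, endo_endo_lift_plus,
      endo_endo_lift_minus] at h
    have h2 : (2 : ℝ) • lift Q.g Q.b 1 x X = 0 := by
      rw [← sub_eq_zero.2 h]
      module
    refine ⟨Y, ?_⟩
    rw [(smul_eq_zero.1 h2).resolve_left two_ne_zero, zero_add]
  · rintro ⟨X, rfl⟩
    exact (Q.endo_endo_lift_minus x X).trans (neg_one_smul ℝ _).symm

theorem isCompl_of_graph {σ : ℝ} {x : M} {L : Submodule ℝ (GTan E x)}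
    (h : ∀ A, A ∈ L ↔ ∃ X, A = lift Q.g Q.b σ x X) : IsCompl L (cotSub x) := by
  constructor
  · refine Submodule.disjoint_def.2 fun A hA ↦ ?_
    rintro ⟨ξ, rfl⟩
    obtain ⟨X, hX⟩ := (h _).1 hA
    have h0 : 0 = X := congrArg Prod.fst hX
    rw [hX, ← h0, lift_zero]
  · refine codisjoint_iff.2 (eq_top_iff.2 fun A _ ↦ Submodule.mem_sup.2
      ⟨lift Q.g Q.b σ x A.1, (h _).2 ⟨_, rfl⟩, _, ⟨A.2 - (lift Q.g Q.b σ x A.1).2, rfl⟩, ?_⟩)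
    exact Prod.ext (add_zero A.1) (add_sub_cancel _ _)

theorem nondeg_of_graph {σ : ℝ} (hσ : σ ≠ 0) {x : M} {L : Submodule ℝ (GTan E x)}
    (h : ∀ A, A ∈ L ↔ ∃ X, A = lift Q.g Q.b σ x X) (A : GTan E x) (hA : A ∈ L)
    (hB : ∀ B ∈ L, pairing A B = 0) : A = 0 := by
  obtain ⟨X, rfl⟩ := (h A).1 hA
  rw [Q.metric.nondeg x X fun Y ↦ ?_, lift_zero]
  have := hB _ ((h _).2 ⟨Y, rfl⟩)
  rw [pairing_lift] at this
  refine (mul_eq_zero.1 this).resolve_left ?_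
  intro h0
  exact hσ (by linarith)

/-- The generalized pseudo-Kähler structure of a quadruple `(g, J₊, J₋, b)`. -/
def toGenPseudoKahler : GenPseudoKahler H where
  I₁ := Q.endo 1 1
  I₂ := Q.endo (-1) 1
  genComplex₁ := Q.isGenComplex_endo (Or.inl rfl) (Or.inl rfl)
  genComplex₂ := Q.isGenComplex_endo (Or.inr rfl) (Or.inl rfl)
  comm := Q.endo_comm
  transversal_plus x := Q.isCompl_of_graph (Q.mem_eigenG_plus x)
  transversal_minus x := Q.isCompl_of_graph (Q.mem_eigenG_minus x)
  nondeg_plus x := Q.nondeg_of_graph one_ne_zero (Q.mem_eigenG_plus x)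
  nondeg_minus x := Q.nondeg_of_graph (neg_ne_zero.2 one_ne_zero) (Q.mem_eigenG_minus x)

theorem isAssociated_toGenPseudoKahler : IsAssociated Q.toGenPseudoKahler Q where
  graph_plus x A := by
    simp only [liftPlus_eq]
    exact Q.mem_eigenG_plus x A
  graph_minus x A := by
    simp only [liftMinus_eq]
    exact Q.mem_eigenG_minus x A
  complex_plus x X := by
    rw [liftPlus_eq, liftPlus_eq]
    exact (Q.endo_lift_plus 1 1 x X).trans (one_smul ℝ _)
  complex_minus x X := by
    rw [liftMinus_eq, liftMinus_eq]
    exact (Q.endo_lift_minus 1 1 x X).trans (one_smul ℝ _)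

end PseudoBihermitian

variable {H : ∀ x : M, Alt E 3 x}

/-- The eigenspaces determine `b - g` and `b + g`, hence both tensors; `J_±` is then read off from
the `TM`-part of `I₁`. -/
theorem IsAssociated.unique_right {S : GenPseudoKahler H} {Q Q' : PseudoBihermitian H}
    (h : IsAssociated S Q) (h' : IsAssociated S Q') : Q = Q' := by
  have plus (x : M) (X : Tan E x) : Q.liftPlus x X = Q'.liftPlus x X := by
    obtain ⟨Y, hY⟩ := (h'.graph_plus x _).1 ((h.graph_plus x _).2 ⟨X, rfl⟩)
    have e : X = Y := congrArg Prod.fst hY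
    rw [hY, e]
  have minus (x : M) (X : Tan E x) : Q.liftMinus x X = Q'.liftMinus x X := by
    obtain ⟨Y, hY⟩ := (h'.graph_minus x _).1 ((h.graph_minus x _).2 ⟨X, rfl⟩)
    have e : X = Y := congrArg Prod.fst hY
    rw [hY, e]
  have eq₁ (x : M) (X Y : Tan E x) : Q.b x ![X, Y] - Q.g x X Y = Q'.b x ![X, Y] - Q'.g x X Y := by
    have := congrArg (fun A : GTan E x ↦ A.2 Y) (plus x X)
    simpa only [PseudoBihermitian.liftPlus, sub_apply, contract₂_apply] using this
  have eq₂ (x : M) (X Y : Tan E x) : Q.b x ![X, Y] + Q.g x X Y = Q'.b x ![X, Y] + Q'.g x X Y := by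
    have := congrArg (fun A : GTan E x ↦ A.2 Y) (minus x X)
    simpa only [PseudoBihermitian.liftMinus, add_apply, contract₂_apply] using this
  have eg : Q.g = Q'.g := by
    funext x
    ext X Y
    linarith [eq₁ x X Y, eq₂ x X Y]
  have eb : Q.b = Q'.b := by
    funext x
    refine alternating_two_ext (V := Tan E x) fun X Y ↦ ?_
    linarith [eq₁ x X Y, eq₂ x X Y]
  have ep : Q.Jp = Q'.Jp := by
    funext x
    ext X
    have := h.complex_plus x X
    rw [plus, plus, h'.complex_plus] at this
    exact (congrArg Prod.fst this).symm
  have em : Q.Jm = Q'.Jm := by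
    funext x
    ext X
    have := h.complex_minus x X
    rw [minus, minus, h'.complex_minus] at this
    exact (congrArg Prod.fst this).symm
  cases Q
  cases Q'
  subst eg eb ep em
  rfl

/-- The two graphs span `TM ⊕ T^*M`. `I₁` is prescribed on each, and there `I₂ = ∓ I₁`. -/
theorem IsAssociated.unique_left {S S' : GenPseudoKahler H} {Q : PseudoBihermitian H}
    (h : IsAssociated S Q) (h' : IsAssociated S' Q) : S = S' := by
  have cases_lift (x : M) {P : GTan E x → Prop} (hp : ∀ X, P (Q.liftPlus x X))
      (hm : ∀ X, P (Q.liftMinus x X)) (hadd : ∀ A B, P A → P B → P (A + B)) (A : GTan E x) : P A := by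
    obtain ⟨X, Y, rfl⟩ := Q.exists_lift x A
    rw [← Q.liftPlus_eq, ← Q.liftMinus_eq]
    exact hadd _ _ (hp X) (hm Y)
  have e₁ (x : M) (A : GTan E x) : S.I₁ x A = S'.I₁ x A := by
    refine cases_lift x (P := fun A ↦ S.I₁ x A = S'.I₁ x A) (fun X ↦ ?_) (fun X ↦ ?_)
      (fun A B hA hB ↦ ?_) A
    · rw [h.complex_plus, h'.complex_plus]
    · rw [h.complex_minus, h'.complex_minus]
    · rw [(S.I₁ x).map_add, (S'.I₁ x).map_add, hA, hB]
  have e₂ (x : M) (A : GTan E x) : S.I₂ x A = S'.I₂ x A := by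
    refine cases_lift x (P := fun A ↦ S.I₂ x A = S'.I₂ x A) (fun X ↦ ?_) (fun X ↦ ?_)
      (fun A B hA hB ↦ ?_) A
    · rw [S.I₂_eq (one_mul 1) (S.mem_eigenG.1 ((h.graph_plus x _).2 ⟨X, rfl⟩)),
        S'.I₂_eq (one_mul 1) (S'.mem_eigenG.1 ((h'.graph_plus x _).2 ⟨X, rfl⟩)), e₁]
    · rw [S.I₂_eq (by norm_num) (S.mem_eigenG.1 ((h.graph_minus x _).2 ⟨X, rfl⟩)),
        S'.I₂_eq (by norm_num) (S'.mem_eigenG.1 ((h'.graph_minus x _).2 ⟨X, rfl⟩)), e₁]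
    · rw [(S.I₂ x).map_add, (S'.I₂ x).map_add, hA, hB]
  have e₁ : S.I₁ = S'.I₁ := funext fun x ↦ ContinuousLinearMap.ext (e₁ x)
  have e₂ : S.I₂ = S'.I₂ := funext fun x ↦ ContinuousLinearMap.ext (e₂ x)
  cases S
  cases S'
  subst e₁ e₂
  rfl

end ToGenComplex

end GenPK

end

theorem theorem2 {E : Type*} [NormedAddCommGroup E] [NormedSpace ℝ E] [FiniteDimensional ℝ E]
    {M : Type*} [TopologicalSpace M] [T2Space M] [SigmaCompactSpace M] [ChartedSpace E M]
    [IsManifold 𝓘(ℝ, E) ∞ M]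
    (H : ∀ x : M, GenPK.Alt E 3 x) (hH : GenPK.SmoothForm H)
    (hdH : ∀ x : M, GenPK.extD H x = 0) :
    ∃ Φ : GenPK.GenPseudoKahler H ≃ GenPK.PseudoBihermitian H,
      ∀ (S : GenPK.GenPseudoKahler H) (Q : GenPK.PseudoBihermitian H),
        Φ S = Q ↔ GenPK.IsAssociated S Q :=
  ⟨{ toFun := GenPK.GenPseudoKahler.toPseudoBihermitian
     invFun := GenPK.PseudoBihermitian.toGenPseudoKahler
     -- Both constructions produce associated partners, so the inverse laws follow from uniqueness
     -- on either side without computing the composites.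
     left_inv := fun S ↦ (GenPK.PseudoBihermitian.isAssociated_toGenPseudoKahler _).unique_left
      S.isAssociated_toPseudoBihermitian
     right_inv := fun Q ↦
      (GenPK.GenPseudoKahler.isAssociated_toPseudoBihermitian _).unique_right
        Q.isAssociated_toGenPseudoKahler },
    fun S Q ↦ ⟨fun h ↦ h ▸ S.isAssociated_toPseudoBihermitian,
      S.isAssociated_toPseudoBihermitian.unique_right⟩⟩
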